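/- Let $$\kappa^* = \min_{\beta>1}\frac{\beta}{1-\beta e^{-(\beta-1)}}\approx 4.911 .$$ For every $\kappa>\kappa^*$ there exists $k_*(\kappa)$ such that for all integers $k\ge k_*(\kappa)$ and $\alpha=\kappa 2^k\log k/k$ the following holds. For each $N$, let $\Gamma_N=\{x_1,\dots,x_N,\bar x_1,\dots,\bar x_N\}$ be the set of literals on $N$ Boolean variables, and let $M=M_N$ satisfy $\lim_{N\to\infty}M_N/N=\alpha$. Let $\boldsymbol y\in\Gamma_N^{kM}$ be a random $k$-SAT instance with $M$ clauses, each a disjunction of $k$ literals, all $kM$ literals being i.i.d. uniform on $\Gamma_N$. Let $\omega$ be a random element, independent of $\boldsymbol y$, of an arbitrary probability space $\Omega_N$, and let $\vec U=(U_1,\dots,U_N)$ be i.i.d. uniform on $[-1,1]$, independent of $(\boldsymbol y,\omega)$. A function $\Gamma_N^{kM}\to\mathbb R^N$ is called a degree $D$ function if each of its $N$ coordinates lies in the linear span of the functions $\boldsymbol y\mapsto\prod_{i\in I}f_i(y_i)$ with $|I|\le D$ and arbitrary $f_i:\Gamma_N\to\mathbb R$. Let $D=D_N=o(N)$, let $C\geq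 0$ be a constant, and let $\mathcal A^\circ=\mathcal A^\circ_N:\Gamma_N^{kM}\times\Omega_N\to\mathbb R^N$ be measurable functions such that $\mathcal A^\circ(\cdot,\omega)$ is a degree $D$ function for each fixed $\omega$, and $\mathbb E[\|\mathcal A^\circ(\boldsymbol y,\omega)\|^2]\le CN$ for all $N$ (Euclidean norm). Let $\mathcal A(\boldsymbol y,\omega,\vec U)\in\{-1,1\}^N$ be its randomized rounding, whose $i$-th coordinate is $1$ if $\mathcal A^\circ(\boldsymbol y,\omega)_i\ge U_i$ and $-1$ otherwise; identify $1$ with true and $-1$ with false. Then, as $N\to\infty$, $$\mathbb P\left[\mathcal A(\boldsymbol y,\omega,\vec U)\text{ is a satisfying assignment of }\boldsymbol y\right]=o(1).$$ -/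

import Mathlib

open MeasureTheory ProbabilityTheory Filter Topology Asymptotics
open scoped ENNReal NNReal

noncomputable section

namespace RandomKSat

/-- The constant `κ* = min_{β > 1} β / (1 - β e^{-(β - 1)}) ≈ 4.911`. On `β > 1` the denominator is
positive. -/
def kappaStar : ℝ :=
  sInf ((fun β : ℝ => β / (1 - β * Real.exp (-(β - 1)))) '' Set.Ioi 1)

theorem one_add_div_pow_le_exp (n : ℕ) (hn : n ≠ 0) (s : ℝ) (h : 0 ≤ 1 + s / n) : (1 + s/n)^n ≤ Real.exp s := by
  have h1 : 1 + s / n ≤ Real.exp (s/n) := by linarith [Real.add_one_le_exp (s/n)]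
  calc (1 + s/n)^n ≤ (Real.exp (s/n))^n := pow_le_pow_left₀ h h1 n
    _ = Real.exp s := by
      rw [← Real.exp_nat_mul]; congr 1; field_simp

theorem exp_neg_five_halves_bounds : (82084/1000000:ℝ) < Real.exp (-(5/2)) ∧ Real.exp (-(5/2)) < 82086/1000000 := by
  have h : Real.exp (-(5/2))^2 * Real.exp 1 ^ 5 = 1 := by
    rw [← Real.exp_nat_mul, ← Real.exp_nat_mul, ← Real.exp_add]; norm_num
  have h1 := Real.exp_one_gt_d9
  have h2 := Real.exp_one_lt_d9
  have hp := Real.exp_pos (-(5/2))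
  have h5 : (148.41:ℝ) < Real.exp 1 ^5 := lt_of_lt_of_le (by norm_num) (pow_le_pow_left₀ (by norm_num) h1.le 5)
  have h6 : Real.exp 1 ^5 < (148.4135:ℝ) := lt_of_le_of_lt (pow_le_pow_left₀ (Real.exp_pos 1).le h2.le 5) (by norm_num) 
  constructor
  · by_contra! hc
    have : Real.exp (-(5/2))^2 ≤ (82084/1000000:ℝ)^2 := pow_le_pow_left₀ hp.le hc 2
    nlinarith
  · by_contra! hc
    have : (82086/1000000:ℝ)^2 ≤ Real.exp (-(5/2))^2 := pow_le_pow_left₀ (by norm_num) hc 2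
    nlinarith

theorem kappaStar_lower_aux {β : ℝ} (hβ : 1 < β) : 4.9105 ≤ β + 4.9105 * (β * Real.exp (-(β - 1))) := by
  have hp := Real.exp_pos (-(β - 1))
  rcases le_total 4.9105 β with h | h
  · nlinarith [mul_pos (by linarith : 0 < β) hp]
  rcases le_total β 2 with h2 | h2
  · have h1 := one_add_div_pow_le_exp 4 (by norm_num) (-(β - 1)) (by push_cast; linarith)
    obtain ⟨u, rfl⟩ : ∃ u, β = 1 + u := ⟨β - 1, by ring⟩
    have hu : 0 < u := by linarith
    have hu1 : 0 ≤ 1 - u := by linarith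
    have h3 := mul_le_mul_of_nonneg_left h1 (show 0 ≤ 1 + u by linarith)
    push_cast at h3
    have h4 : (1 + u) * (1 + -(1 + u - 1) / 4) ^ 4 
       = 1 - 5/8*u^2 + 5/16*u^3 - 15/256*u^4 + u^5/256 := by ring
    rw [h4] at h3
    have h5 : 0 ≤ u^3 * (1 - u) := by positivity
    have h6 : 0 ≤ u^5 := by positivity
    have h7 : 0 ≤ 1 + u - 3.07 * u^2 + 1.246 * u^3 := by
      nlinarith [mul_nonneg hu.le (sq_nonneg (u - 9/10)), mul_nonneg hu1 hu.le, mul_nonneg hu1 hu1, mul_nonneg hu1 (mul_nonneg hu1 hu1)]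
    nlinarith [pow_pos hu 2, pow_pos hu 3]
  · have h1 := one_add_div_pow_le_exp 5 (by norm_num) (-(β - 7/2)) (by push_cast; linarith)
    have hq := exp_neg_five_halves_bounds.1
    have e : Real.exp (-(β-1)) = Real.exp (-(5/2)) * Real.exp (-(β - 7/2)) := by
      rw [← Real.exp_add]; congr 1; ring
    rw [e]
    obtain ⟨x, rfl⟩ : ∃ x, β = 7/2 + x := ⟨β - 7/2, by ring⟩
    push_cast at h1
    have e2 : 1 + -(7/2 + x - 7/2) / 5 = 1 - x/5 := by ring
    rw [e2] at h1
    have hx1 : 0 ≤ x + 3/2 := by linarith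
    have hx2 : 0 ≤ 1.4105 - x := by linarith
    have h3 : 0 ≤ (1 - x/5)^5 := pow_nonneg (by linarith) 5
    have h4 : 82084/1000000 * (1 - x/5)^5 ≤ Real.exp (-(5/2)) * Real.exp (-(7/2 + x - 7/2)) :=
      mul_le_mul hq.le h1 h3 (Real.exp_pos _).le
    have h5 := mul_le_mul_of_nonneg_left h4 (show 0 ≤ 7/2 + x by linarith)
    suffices h6 : 4.9105 ≤ 7/2 + x + 4.9105 * ((7/2 + x) * (82084/1000000 * (1 - x/5)^5)) by linarith
    have h8 : 0.06 * x ^ 2 - 0.007683705 * x + 0.000257187 ≤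
        7/2 + x + 4.9105 * ((7/2 + x) * (82084/1000000 * (1 - x/5)^5)) - 4.9105 ∨
        x ≤ 0 := by
      rcases le_total x 0 with hx | hx
      · exact Or.inr hx
      · left
        have h9 : 0 ≤ 0.1012293928 + 0.04836881784 * x - 0.020959821064 * x^2 +
            0.00277314555616 * x^3 - 0.00012898351424 * x^4 := by
          have : 0 ≤ x^3 * (1.4105 - x) := by positivity
          have : 0 ≤ x * (1.4105 - x) := by positivity
          nlinarith [pow_nonneg hx 3]
        nlinarith [mul_nonneg (sq_nonneg x) h9]
    rcases h8 with h8 | h8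
    · nlinarith [sq_nonneg (x - 0.064)]
    · obtain ⟨y, rfl⟩ : ∃ y, x = -y := ⟨-x, by ring⟩
      have hy : 0 ≤ y := by linarith
      have hy1 : y ≤ 3/2 := by linarith
      have y2 : y^2 ≤ (3/2)^2 := pow_le_pow_left₀ hy hy1 2
      have y3 : y^3 ≤ (3/2)^3 := pow_le_pow_left₀ hy hy1 3
      have y4 : y^4 ≤ (3/2)^4 := pow_le_pow_left₀ hy hy1 4
      have h9 : 0 ≤ 0.1612293928 - 0.04836881784 * y - 0.020959821064 * y^2 -
            0.00277314555616 * y^3 - 0.00012898351424 * y^4 := by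
        linarith
      nlinarith [mul_nonneg (sq_nonneg y) h9]

/-- The numerical value `κ* ≈ 4.911`. -/
theorem abs_kappaStar_sub_le : |kappaStar - 4.911| ≤ 0.0005 := by
  have hpos : ∀ β : ℝ, 1 < β → 0 < 1 - β * Real.exp (-(β - 1)) := fun β hβ => by
    have h := Real.add_one_lt_exp (show β - 1 ≠ 0 by linarith)
    rw [Real.exp_neg, sub_pos, ← div_eq_mul_inv, div_lt_one (Real.exp_pos _)]
    linarith
  have hlow : ∀ v ∈ (fun β : ℝ => β / (1 - β * Real.exp (-(β - 1)))) '' Set.Ioi 1,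
      (4.9105 : ℝ) ≤ v := by
    rintro _ ⟨β, hβ, rfl⟩
    rw [le_div_iff₀ (hpos β hβ)]
    linarith [kappaStar_lower_aux hβ]
  have h1 : (4.9105 : ℝ) ≤ kappaStar :=
    le_csInf ⟨_, 2, by norm_num, rfl⟩ hlow
  have h2 : kappaStar ≤ 4.9115 := by
    have h72 : (7 / 2 : ℝ) ∈ Set.Ioi 1 := by norm_num
    refine (csInf_le ⟨_, hlow⟩ ⟨7 / 2, h72, rfl⟩).trans ?_
    have h3 := hpos _ h72
    rw [div_le_iff₀ h3]
    have h4 := exp_neg_five_halves_bounds.2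
    norm_num at h4 ⊢
    linarith
  rw [abs_le]; constructor <;> linarith

/-- The literals on `N` Boolean variables: `(i, true)` is `x_i` and `(i, false)` is its negation. -/
abbrev Literal (N : ℕ) : Type := Fin N × Bool

/-- The discrete cube `{-1, 1}^N`; `1` stands for true and `-1` for false. -/
abbrev Cube (N : ℕ) : Type := Fin N → ℤˣ

/-- A `k`-SAT instance with `N` variables and `M` clauses: `y (a, j)` is the `j`-th literal of the
`a`-th clause. -/
abbrev Instance (N M k : ℕ) : Type := Fin M × Fin k → Literal N

/-- The literal `l` evaluates to true under the assignment `x`. -/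
def Literal.Holds {N : ℕ} (l : Literal N) (x : Cube N) : Prop :=
  x l.1 = if l.2 then 1 else -1

/-- Every clause, that is, every disjunction of `k` literals, evaluates to true under `x`. -/
def Satisfies {N M k : ℕ} (x : Cube N) (y : Instance N M k) : Prop :=
  ∀ a : Fin M, ∃ j : Fin k, Literal.Holds (y (a, j)) x

/-- The law of random `k`-SAT: all `k M` literals are IID uniform on the `2 N` literals. -/
def instanceLaw (N M k : ℕ) : Measure (Instance N M k) :=
  Measure.pi fun _ => uniformOn (Set.univ : Set (Literal N))

/-- The space of degree `D` functions on `Γ ^ ι`: the span of the products `∏ i ∈ I, f i (y i)`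
with at most `D` factors, the `f i : Γ → ℝ` being arbitrary. -/
def degreeSpace (ι Γ : Type*) (D : ℕ) : Submodule ℝ ((ι → Γ) → ℝ) :=
  Submodule.span ℝ
    {F | ∃ (I : Finset ι) (f : ι → Γ → ℝ), I.card ≤ D ∧ F = fun y => ∏ i ∈ I, f i (y i)}

/-- A vector-valued function is a degree `D` function if each of its coordinates is. -/
def IsDegree {ι Γ : Type*} {N : ℕ} (D : ℕ) (F : (ι → Γ) → EuclideanSpace ℝ (Fin N)) : Prop :=
  ∀ i : Fin N, (fun y => F y i) ∈ degreeSpace ι Γ D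

/-- Coordinatewise rounding with thresholds `U`: the output is `1` where `U i ≤ z i` and `-1`
elsewhere. -/
def roundAt {N : ℕ} (U : Fin N → ℝ) (z : EuclideanSpace ℝ (Fin N)) : Cube N :=
  fun i => if U i ≤ z i then 1 else -1

/-- The law of the thresholds: IID uniform on `[-1, 1]`. -/
def thresholdLaw (N : ℕ) : Measure (Fin N → ℝ) :=
  Measure.pi fun _ => cond volume (Set.Icc (-1 : ℝ) 1)

end RandomKSat

end

/-! The proof is by contradiction: if the rounded low degree function succeeds with probability at
least `δ` for a large `N`, it produces with probability `exp (-o(N))` a structure whose expected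
number is `exp (-Ω(N))`.

Lower bound. Resample each clause independently with probability `ε₀ / (D + 1)`. The noise operator
acts on the degree filtration with eigenvalues at least `ρ ^ D`, so a degree `D` function moves
little in mean square (`sum_noise_sq_sub_le`), and its rounding moves little in Hamming distance.
Averaging over the internal randomness yields one deterministic rule `f` that, on a noise-correlated
pair of instances, satisfies both by nearby assignments with probability at least `γ = δ ^ 2 / 2`
(`exists_stable_rule`). Symmetry of the transition weights then gives probability at least `γ ^ T`
for this to hold at every step of a resampling chain of length `T` (`pow_le_instExp_prod`). A length
`T = O(D + 1) = o(N)` suffices to resample nearly all clauses as often as needed.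

Upper bound. Follow the assignments along such a path and measure each by its empirical entropy
conditioned on the assignments already selected. Two cases arise (`instExp_prod_stablePair_le`).
Either, after `T₀` steps, some satisfying assignment still has conditional entropy at most `b`;
there are only `exp (N b)` such assignments up to polynomial factors, and the nearly fresh instance
is satisfied by each with probability about `exp (-M / 2 ^ k)`. Or the conditional entropy passes
level `b`, and since it moves slowly it can be caught in `[b', b]`; repeating this selects `m + 1`
assignments with all later conditional entropies in the window (`exists_times`). There are about `2
^ N * exp (m N b)` such sequences, and each is satisfied with probability about `exp (-(M m / 2 ^ k)
(1 - overlap))`, because a clause violated by one assignment is rarely violated by an earlier one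
(`pathExp_clause_le`, `sum_exists_match_le`).

Constants. With `b` close to `β log k / k` the overlap tends to `β exp (-(β - 1))`, and the second
first moment decays when `κ (1 - β exp (-(β - 1))) > β` and `m` is a large multiple of `k / log k`.
Optimising over `β` gives `kappaStar` (`exists_parameters`). -/

noncomputable section

set_option linter.unusedSectionVars false

namespace RandomKSat

/-! ### Expectations along finite Markov chains -/

section Chain

variable {S : Type*} [Fintype S]

/-- The expectation of `F` along the first `T` steps of the Markov chain with initial law `π` and
transition matrix `K`. -/
def pathExp (π : S → ℝ) (K : Matrix S S ℝ) : ℕ → ((ℕ → S) → ℝ) → ℝ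
  -- Entries beyond the current time keep the value of the initial state; this filler is invisible
  -- to functions of the entries up to the final time.
  | 0, F => ∑ s, π s * F (fun _ => s)
  | T + 1, F => pathExp π K T fun y => ∑ s, K (y T) s * F (Function.update y (T + 1) s)

variable {π : S → ℝ} {K : Matrix S S ℝ}

theorem pathExp_mono (hπ : ∀ s, 0 ≤ π s) (hK : ∀ s s', 0 ≤ K s s') (T : ℕ)
    {F G : (ℕ → S) → ℝ} (h : ∀ y, F y ≤ G y) : pathExp π K T F ≤ pathExp π K T G := by
  induction T generalizing F G with
  | zero => exact Finset.sum_le_sum fun s _ => mul_le_mul_of_nonneg_left (h _) (hπ s)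
  | succ T ih =>
    exact ih fun y => Finset.sum_le_sum fun s _ => mul_le_mul_of_nonneg_left (h _) (hK _ s)

theorem pathExp_sum {ι : Type*} (A : Finset ι) (T : ℕ) (F : ι → (ℕ → S) → ℝ) :
    pathExp π K T (fun y => ∑ i ∈ A, F i y) = ∑ i ∈ A, pathExp π K T (F i) := by
  induction T generalizing F with
  | zero => simp only [pathExp, Finset.mul_sum]; exact Finset.sum_comm
  | succ T ih =>
    simp only [pathExp, Finset.mul_sum]
    rw [← ih]
    congr 1; ext y; exact Finset.sum_comm

theorem pathExp_add (T : ℕ) (F G : (ℕ → S) → ℝ) :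
    pathExp π K T (fun y => F y + G y) = pathExp π K T F + pathExp π K T G := by
  induction T generalizing F G with
  | zero => simp only [pathExp, mul_add, Finset.sum_add_distrib]
  | succ T ih => simp only [pathExp, mul_add, Finset.sum_add_distrib, ih]

theorem pathExp_const_mul (T : ℕ) (a : ℝ) (F : (ℕ → S) → ℝ) :
    pathExp π K T (fun y => a * F y) = a * pathExp π K T F := by
  induction T generalizing F with
  | zero => simp only [pathExp, Finset.mul_sum]; exact Finset.sum_congr rfl fun s _ => by ring
  | succ T ih =>
    simp only [pathExp]
    rw [← ih]
    congr 1; ext y; rw [Finset.mul_sum]; exact Finset.sum_congr rfl fun s _ => by ring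

theorem pathExp_sub (T : ℕ) (F G : (ℕ → S) → ℝ) :
    pathExp π K T (fun y => F y - G y) = pathExp π K T F - pathExp π K T G := by
  have h := pathExp_add (π := π) (K := K) T F (fun y => -1 * G y)
  rw [pathExp_const_mul] at h
  simp only [neg_mul, one_mul, ← sub_eq_add_neg] at h
  exact h

theorem update_eq_of_le {y : ℕ → S} {t i : ℕ} (s : S) (h : i ≤ t) :
    Function.update y (t + 1) s i = y i :=
  Function.update_of_ne (by omega) _ _

theorem dependsOn_update_succ {F : (ℕ → S) → ℝ} {t : ℕ} (h : DependsOn F (Set.Iic t))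
    (y : ℕ → S) (s : S) : F (Function.update y (t + 1) s) = F y :=
  h fun _ hi => update_eq_of_le s hi

theorem pathExp_succ_mul (T : ℕ) {g : (ℕ → S) → ℝ} (hg : DependsOn g (Set.Iic T)) (h : S → ℝ) :
    pathExp π K (T + 1) (fun y => g y * h (y (T + 1))) =
      pathExp π K T (fun y => g y * (K.mulVec h) (y T)) := by
  rw [pathExp]
  congr 1; ext y
  simp only [dependsOn_update_succ hg, Function.update_self, Matrix.mulVec, dotProduct,
    Finset.mul_sum]
  exact Finset.sum_congr rfl fun s _ => by ring

theorem pathExp_of_dependsOn (hK1 : ∀ s, ∑ s', K s s' = 1) {t T : ℕ} (htT : t ≤ T)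
    {F : (ℕ → S) → ℝ} (hF : DependsOn F (Set.Iic t)) : pathExp π K T F = pathExp π K t F := by
  induction T, htT using Nat.le_induction with
  | base => rfl
  | succ T hT ih =>
    rw [← ih, pathExp]
    congr 1; ext y
    have : ∀ s, F (Function.update y (T + 1) s) = F y := fun s =>
      dependsOn_update_succ (fun a b hab => hF fun i hi => hab i (le_trans hi hT)) y s
    simp only [this, ← Finset.sum_mul, hK1, one_mul]

theorem dependsOn_eval {t T : ℕ} (h : t ≤ T) (g : S → ℝ) :
    DependsOn (fun y : ℕ → S => g (y t)) (Set.Iic T) := fun y y' hy => by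
  simp only [hy t h]

theorem dependsOn_mul {A : Set ℕ} {F G : (ℕ → S) → ℝ} (hF : DependsOn F A)
    (hG : DependsOn G A) : DependsOn (fun y => F y * G y) A := fun y y' h => by
  simp only [hF h, hG h]

theorem dependsOn_mono {F : (ℕ → S) → ℝ} {s t : ℕ} (hF : DependsOn F (Set.Iic s))
    (h : s ≤ t) : DependsOn F (Set.Iic t) := fun _ _ hy => hF fun i hi => hy i (le_trans hi h)

/-- The Markov property: given the path up to time `s`, the mean of `h` at time `s + n` depends on
the state at time `s` only, through `K ^ n`. -/
theorem pathExp_markov [DecidableEq S] (hK1 : ∀ s, ∑ s', K s s' = 1) {s n T : ℕ} (hT : s + n ≤ T)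
    {g : (ℕ → S) → ℝ} (hg : DependsOn g (Set.Iic s)) (h : S → ℝ) :
    pathExp π K T (fun y => g y * h (y (s + n))) =
      pathExp π K T (fun y => g y * ((K ^ n).mulVec h) (y s)) := by
  induction n generalizing h with
  | zero => simp
  | succ n ih =>
    rw [pathExp_of_dependsOn hK1 hT
      (dependsOn_mul (dependsOn_mono hg (by omega)) (dependsOn_eval le_rfl h))]
    rw [show s + (n + 1) = (s + n) + 1 by ring,
      pathExp_succ_mul _ (dependsOn_mono hg (by omega))]
    rw [← pathExp_of_dependsOn hK1 (show s + n ≤ T by omega)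
      (dependsOn_mul (dependsOn_mono hg (by omega)) (dependsOn_eval le_rfl _))]
    rw [ih (by omega), Matrix.mulVec_mulVec, ← pow_succ]

theorem pathExp_eval [DecidableEq S] (hK1 : ∀ s, ∑ s', K s s' = 1)
    (hst : Matrix.vecMul π K = π) {t T : ℕ} (h : t ≤ T) (g : S → ℝ) :
    pathExp π K T (fun y => g (y t)) = ∑ s, π s * g s := by
  rw [pathExp_of_dependsOn hK1 h (dependsOn_eval le_rfl g)]
  clear h
  induction t generalizing g with
  | zero => rfl
  | succ t ih =>
    have h1 := pathExp_succ_mul (π := π) (K := K) t (g := fun _ => 1) (fun _ _ _ => rfl) g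
    simp only [one_mul] at h1
    rw [h1, ih]
    change π ⬝ᵥ (K.mulVec g) = π ⬝ᵥ g
    rw [Matrix.dotProduct_mulVec, hst]

theorem pathExp_one (hK1 : ∀ s, ∑ s', K s s' = 1) (hπ1 : ∑ s, π s = 1) (T : ℕ) :
    pathExp π K T (fun _ => 1) = 1 := by
  rw [pathExp_of_dependsOn hK1 (Nat.zero_le T) (fun _ _ _ => rfl)]
  simpa [pathExp] using hπ1

/-- The two-time marginal of the chain. -/
theorem pathExp_eval_mul_eval [DecidableEq S] (hK1 : ∀ s, ∑ s', K s s' = 1)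
    (hst : Matrix.vecMul π K = π) {s n T : ℕ} (h : s + n ≤ T) (φ ψ : S → ℝ) :
    pathExp π K T (fun y => φ (y s) * ψ (y (s + n))) =
      ∑ a, π a * (φ a * ((K ^ n).mulVec ψ) a) := by
  rw [pathExp_markov hK1 h (dependsOn_eval le_rfl φ)]
  exact pathExp_eval hK1 hst (by omega) fun a => φ a * ((K ^ n).mulVec ψ) a

/-- The expectation of a product along a path of pair weights. -/
theorem pathExp_prod [DecidableEq S] (w : Matrix S S ℝ) (T : ℕ) (h : S → ℝ) :
    pathExp π K T (fun y => (∏ t ∈ Finset.range T, w (y t) (y (t + 1))) * h (y T)) =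
      π ⬝ᵥ (((Matrix.of fun s s' => K s s' * w s s') ^ T).mulVec h) := by
  induction T generalizing h with
  | zero => simp [pathExp, dotProduct]
  | succ T ih =>
    rw [pathExp, pow_succ, ← Matrix.mulVec_mulVec, ← ih]
    congr 1; ext y
    rw [Matrix.mulVec, dotProduct, Finset.mul_sum]
    refine Finset.sum_congr rfl fun s _ => ?_
    rw [Finset.prod_range_succ, Function.update_self, update_eq_of_le s le_rfl, Matrix.of_apply]
    have : ∏ t ∈ Finset.range T, w (Function.update y (T + 1) s t)
        (Function.update y (T + 1) s (t + 1)) = ∏ t ∈ Finset.range T, w (y t) (y (t + 1)) :=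
      Finset.prod_congr rfl fun t ht => by
        rw [Finset.mem_range] at ht
        rw [update_eq_of_le s (by omega), update_eq_of_le s (by omega)]
    rw [this]; ring

/-- Chains with independent coordinates: the expectation of a product of functions of the
coordinate chains is the product of expectations. -/
theorem pathExp_pi {ι Γ : Type*} [Fintype ι] [DecidableEq ι] [Fintype Γ] (π : Γ → ℝ)
    (K : Matrix Γ Γ ℝ) (T : ℕ) (F : ι → (ℕ → Γ) → ℝ) :
    pathExp (fun y : ι → Γ => ∏ a, π (y a)) (Matrix.of fun y y' : ι → Γ => ∏ a, K (y a) (y' a)) T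
      (fun y => ∏ a, F a fun t => y t a) = ∏ a, pathExp π K T (F a) := by
  induction T generalizing F with
  | zero => simp only [pathExp, Finset.prod_univ_sum, Fintype.piFinset_univ,
      Finset.prod_mul_distrib]
  | succ T ih =>
    simp only [pathExp]
    rw [← ih]
    congr 1; ext y
    rw [Finset.prod_univ_sum, Fintype.piFinset_univ]
    refine Finset.sum_congr rfl fun s _ => ?_
    rw [Finset.prod_mul_distrib, Matrix.of_apply]
    congr 1
    refine Finset.prod_congr rfl fun a _ => ?_
    congr 1; ext t
    by_cases h : t = T + 1
    · subst h; simp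
    · simp [h]

end Chain

/-! ### Powers of symmetric nonnegative matrices -/

section Powers

variable {S : Type*} [Fintype S] [DecidableEq S]

theorem sq_one_dotProduct_le (v : S → ℝ) :
    ((1 : S → ℝ) ⬝ᵥ v) ^ 2 ≤ Fintype.card S * (v ⬝ᵥ v) := by
  have h := sq_sum_le_card_mul_sum_sq (s := (Finset.univ : Finset S)) (f := v)
  simpa [dotProduct, sq, Finset.card_univ] using h

/-- Symmetry turns the quadratic form of a square into a squared norm; this is what makes
Cauchy–Schwarz applicable to even powers. -/
theorem one_dotProduct_mul_self_mulVec {W : Matrix S S ℝ} (hW : W.transpose = W) (v : S → ℝ) :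
    v ⬝ᵥ ((W * W).mulVec v) = (W.mulVec v) ⬝ᵥ (W.mulVec v) := by
  rw [← Matrix.mulVec_mulVec, Matrix.dotProduct_mulVec, ← Matrix.mulVec_transpose, hW]

/-- The mean entry sum of a power of a symmetric matrix dominates the power of the mean. -/
theorem pow_mean_le_mean_pow [Nonempty S] {W : Matrix S S ℝ} (hW : W.transpose = W)
    {γ : ℝ} (hγ : 0 ≤ γ) (h : γ * Fintype.card S ≤ (1 : S → ℝ) ⬝ᵥ (W.mulVec 1)) (n : ℕ) :
    γ ^ (2 ^ n) * Fintype.card S ≤ (1 : S → ℝ) ⬝ᵥ ((W ^ (2 ^ n)).mulVec 1) := by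
  induction n with
  | zero => simpa using h
  | succ n ih =>
    have hc : (0 : ℝ) < Fintype.card S := by exact_mod_cast Fintype.card_pos
    -- Doubling the exponent: the entry sum of `W ^ (2 r)` is the squared norm of `W ^ r` applied to
    -- `1`, at least the squared entry sum of `W ^ r` over `card S`. Hence the exponents are powers
    -- of two.
    rw [pow_succ 2 n, mul_two, pow_add W, one_dotProduct_mul_self_mulVec
      (by rw [Matrix.transpose_pow, hW])]
    have h2 := sq_one_dotProduct_le ((W ^ (2 ^ n)).mulVec (1 : S → ℝ))
    have h3 := pow_le_pow_left₀ (by positivity) ih 2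
    have h4 := h3.trans h2
    rw [← mul_le_mul_iff_right₀ hc]
    refine le_trans (le_of_eq ?_) h4
    rw [pow_add]; ring

end Powers

/-! ### Resampling -/

section Noise

variable {Γ : Type*} [Fintype Γ] [DecidableEq Γ]

/-- The transition matrix that keeps the state with probability `ρ` and otherwise resamples it
uniformly. -/
def resample (Γ : Type*) [Fintype Γ] [DecidableEq Γ] (ρ : ℝ) : Matrix Γ Γ ℝ :=
  fun c c' => ρ * (if c = c' then 1 else 0) + (1 - ρ) / Fintype.card Γ

theorem resample_nonneg {ρ : ℝ} (h0 : 0 ≤ ρ) (h1 : ρ ≤ 1) (c c' : Γ) :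
    0 ≤ resample Γ ρ c c' := by
  have : 0 ≤ 1 - ρ := by linarith
  unfold resample; positivity

theorem resample_comm (ρ : ℝ) (c c' : Γ) : resample Γ ρ c c' = resample Γ ρ c' c := by
  simp only [resample, eq_comm]

theorem resample_mulVec (ρ : ℝ) (h : Γ → ℝ) (c : Γ) :
    (resample Γ ρ).mulVec h c = ρ * h c + (1 - ρ) * ((∑ c', h c') / Fintype.card Γ) := by
  simp only [Matrix.mulVec, dotProduct, resample, add_mul, Finset.sum_add_distrib]
  congr 1
  · simp
  · rw [← Finset.mul_sum]; ring

theorem resample_sum [Nonempty Γ] (ρ : ℝ) (c : Γ) : ∑ c', resample Γ ρ c c' = 1 := by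
  have h := resample_mulVec ρ (fun _ => (1 : ℝ)) c
  simp only [Matrix.mulVec, dotProduct, mul_one, Finset.sum_const, Finset.card_univ,
    nsmul_eq_mul] at h
  rw [h, div_self (by exact_mod_cast Fintype.card_ne_zero)]; ring

theorem resample_mul [Nonempty Γ] (ρ σ : ℝ) :
    resample Γ ρ * resample Γ σ = resample Γ (ρ * σ) := by
  ext c c'
  have h := resample_mulVec ρ (fun d => resample Γ σ d c') c
  have h2 : ∑ d, resample Γ σ d c' = 1 := by
    simp_rw [resample_comm σ _ c']; exact resample_sum σ c'
  rw [h2] at h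
  rw [Matrix.mul_apply]
  refine Eq.trans h ?_
  simp only [resample]; ring

theorem resample_one : resample Γ 1 = 1 := by
  ext c c'; simp [resample, Matrix.one_apply]

theorem resample_pow [Nonempty Γ] (ρ : ℝ) (n : ℕ) :
    resample Γ ρ ^ n = resample Γ (ρ ^ n) := by
  induction n with
  | zero => simp [resample_one]
  | succ n ih => rw [pow_succ, ih, resample_mul, pow_succ]

variable {ι : Type*} [Fintype ι] [DecidableEq ι]

/-- Independent resampling of all coordinates. -/
def noise (ι Γ : Type*) [Fintype ι] [Fintype Γ] [DecidableEq Γ] (ρ : ℝ) :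
    Matrix (ι → Γ) (ι → Γ) ℝ :=
  Matrix.of fun y y' => ∏ a, resample Γ ρ (y a) (y' a)

theorem noise_nonneg {ρ : ℝ} (h0 : 0 ≤ ρ) (h1 : ρ ≤ 1) (y y' : ι → Γ) :
    0 ≤ noise ι Γ ρ y y' :=
  Finset.prod_nonneg fun _ _ => resample_nonneg h0 h1 _ _

theorem noise_transpose (ρ : ℝ) : (noise ι Γ ρ).transpose = noise ι Γ ρ := by
  ext y y'
  exact Finset.prod_congr rfl fun a _ => resample_comm ρ _ _

theorem noise_mulVec_prod (ρ : ℝ) (h : ι → Γ → ℝ) (y : ι → Γ) :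
    (noise ι Γ ρ).mulVec (fun y => ∏ a, h a (y a)) y =
      ∏ a, (resample Γ ρ).mulVec (h a) (y a) := by
  simp only [Matrix.mulVec, dotProduct, noise, Matrix.of_apply, Finset.prod_univ_sum,
    Fintype.piFinset_univ, Finset.prod_mul_distrib]

theorem noise_sum [Nonempty Γ] (ρ : ℝ) (y : ι → Γ) : ∑ y', noise ι Γ ρ y y' = 1 := by
  have h := noise_mulVec_prod ρ (fun (_ : ι) (_ : Γ) => (1 : ℝ)) y
  simp only [Finset.prod_const_one] at h
  simp only [Matrix.mulVec, dotProduct, mul_one, resample_sum, Finset.prod_const_one] at h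
  exact h

theorem noise_mul [Nonempty Γ] (ρ σ : ℝ) : noise ι Γ ρ * noise ι Γ σ = noise ι Γ (ρ * σ) := by
  ext y y'
  have h := noise_mulVec_prod ρ (fun (a : ι) (c : Γ) => resample Γ σ c (y' a)) y
  rw [Matrix.mul_apply]
  refine Eq.trans h ?_
  rw [noise, Matrix.of_apply]
  refine Finset.prod_congr rfl fun a _ => ?_
  rw [← resample_mul, Matrix.mul_apply]; rfl

theorem noise_one : noise ι Γ 1 = 1 := by
  ext y y'
  simp only [noise, resample_one, Matrix.of_apply, Matrix.one_apply, funext_iff]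
  by_cases h : ∀ a, y a = y' a
  · simp [h]
  · rw [if_neg h]
    push Not at h
    obtain ⟨a, ha⟩ := h
    exact Finset.prod_eq_zero (Finset.mem_univ a) (if_neg ha)

theorem noise_pow [Nonempty Γ] (ρ : ℝ) (n : ℕ) : noise ι Γ ρ ^ n = noise ι Γ (ρ ^ n) := by
  induction n with
  | zero => simp [noise_one]
  | succ n ih => rw [pow_succ, ih, noise_mul, pow_succ]

/-- A noise-correlated pair lies in a set with probability at least the squared density. -/
theorem sq_le_card_mul_noise [Nonempty Γ] {ρ : ℝ} (h0 : 0 ≤ ρ) (v : (ι → Γ) → ℝ) :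
    (∑ y, v y) ^ 2 ≤ Fintype.card (ι → Γ) * (v ⬝ᵥ ((noise ι Γ ρ).mulVec v)) := by
  -- Noise at level `ρ` is two rounds at level `√ρ`, so the quadratic form is a squared norm;
  -- Cauchy–Schwarz against `1`, which noise fixes, gives the bound.
  have h : noise ι Γ ρ = noise ι Γ (√ρ) * noise ι Γ (√ρ) := by
    rw [noise_mul, Real.mul_self_sqrt h0]
  rw [h, one_dotProduct_mul_self_mulVec (noise_transpose _)]
  refine le_trans (le_of_eq ?_) (sq_one_dotProduct_le _)
  rw [Matrix.dotProduct_mulVec, ← Matrix.mulVec_transpose, noise_transpose]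
  congr 1
  have : (noise ι Γ √ρ).mulVec 1 = 1 := by
    ext y; simp [Matrix.mulVec, dotProduct, noise_sum]
  rw [this]; simp [dotProduct]

end Noise

/-! ### Noise stability of low degree functions -/

/-- A symmetric operator that acts on the successive quotients of a filtration by the scalars
`ρ ^ d` is bounded below by `ρ ^ D` on the `D`-th step of the filtration. -/
theorem pow_mul_norm_sq_le_inner {E : Type*} [NormedAddCommGroup E] [InnerProductSpace ℝ E]
    [FiniteDimensional ℝ E] {T : E →ₗ[ℝ] E} (hT : T.IsSymmetric) {ρ : ℝ} (h0 : 0 ≤ ρ)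
    (h1 : ρ ≤ 1) (V : ℕ → Submodule ℝ E) (hV : Monotone V) (hV0 : ∀ v ∈ V 0, T v = v)
    (hVs : ∀ d, ∀ v ∈ V (d + 1), T v - ρ ^ (d + 1) • v ∈ V d) (D : ℕ) {v : E} (hv : v ∈ V D) :
    ρ ^ D * ‖v‖ ^ 2 ≤ inner ℝ v (T v) := by
  have hinv : ∀ w ∈ V D, T w ∈ V D := by
    intro w hw
    cases D with
    | zero => rw [hV0 w hw]; exact hw
    | succ d =>
      have := hV (Nat.le_succ d) (hVs d w hw)
      simpa using Submodule.add_mem _ this (Submodule.smul_mem _ (ρ ^ (d + 1)) hw)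
  -- An eigenvector in `V (d + 1)` whose eigenvalue differs from `ρ ^ (d + 1)` already lies in `V
  -- d`. Descending the filtration, every eigenvalue on `V D` is some `ρ ^ j` with `j ≤ D`.
  have heig : ∀ d ≤ D, ∀ w ∈ V d, ∀ μ : ℝ, w ≠ 0 → T w = μ • w → ρ ^ D ≤ μ := by
    intro d
    induction d with
    | zero =>
      intro _ w hw μ hw0 hμ
      rw [hV0 w hw] at hμ
      have : (1 - μ) • w = 0 := by rw [sub_smul, one_smul, ← hμ, sub_self]
      have h2 := (smul_eq_zero.1 this).resolve_right hw0
      have := pow_le_one₀ (n := D) h0 h1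
      linarith
    | succ d ih =>
      intro hd w hw μ hw0 hμ
      have h2 := hVs d w hw
      rw [hμ, ← sub_smul] at h2
      by_cases h3 : μ - ρ ^ (d + 1) = 0
      · rw [sub_eq_zero.1 h3]; exact pow_le_pow_of_le_one h0 h1 hd
      · exact ih (by omega) w ((Submodule.smul_mem_iff _ h3).1 h2) μ hw0 hμ
  have hR := hT.restrict_invariant hinv
  set R := T.restrict hinv with hRdef
  let b := hR.eigenvectorBasis rfl
  have hval : ∀ i, ρ ^ D ≤ hR.eigenvalues rfl i := by
    intro i
    have h2 := hR.hasEigenvector_eigenvectorBasis rfl i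
    have h3 := h2.apply_eq_smul
    refine heig D le_rfl (b i : E) (b i).2 _ ?_ ?_
    · simpa using h2.2
    · exact congrArg Subtype.val h3
  let w : V D := ⟨v, hv⟩
  have e1 : inner ℝ v (T v) = inner ℝ w (R w) := rfl
  have e2 : ‖v‖ ^ 2 = inner ℝ w w := by rw [real_inner_self_eq_norm_sq]; rfl
  rw [e1, e2, ← b.sum_inner_mul_inner, ← b.sum_inner_mul_inner, Finset.mul_sum]
  refine Finset.sum_le_sum fun i _ => ?_
  have e3 : inner ℝ (b i) (R w) = hR.eigenvalues rfl i * inner ℝ (b i) w := by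
    have := hR.eigenvectorBasis_apply_self_apply rfl w i
    rw [OrthonormalBasis.repr_apply_apply, OrthonormalBasis.repr_apply_apply] at this
    exact this
  rw [e3, real_inner_comm w (b i)]
  nlinarith [mul_le_mul_of_nonneg_right (hval i) (mul_self_nonneg (inner ℝ w (b i)))]

section Degree

variable {ι Γ : Type*}

theorem degreeSpace_mono : Monotone (degreeSpace ι Γ) := fun _ _ h =>
  Submodule.span_mono fun _ ⟨I, f, hI, hF⟩ => ⟨I, f, hI.trans h, hF⟩

theorem prod_mem_degreeSpace (I : Finset ι) (f : ι → Γ → ℝ) {d : ℕ} (h : I.card ≤ d) :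
    (fun y => ∏ i ∈ I, f i (y i)) ∈ degreeSpace ι Γ d :=
  Submodule.subset_span ⟨I, f, h, rfl⟩

variable [Fintype ι] [DecidableEq ι] [Fintype Γ] [DecidableEq Γ] [Nonempty Γ]

theorem noise_mulVec_monomial (ρ : ℝ) (I : Finset ι) (f : ι → Γ → ℝ) :
    (noise ι Γ ρ).mulVec (fun y => ∏ i ∈ I, f i (y i)) =
      fun y => ∏ i ∈ I, (ρ * f i (y i) + (1 - ρ) * ((∑ c, f i c) / Fintype.card Γ)) := by
  ext y
  have h := noise_mulVec_prod ρ (fun (a : ι) (c : Γ) => if a ∈ I then f a c else 1) y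
  simp only [Finset.prod_ite_mem, Finset.univ_inter] at h
  rw [h, ← Finset.prod_subset (Finset.subset_univ I)]
  · refine Finset.prod_congr rfl fun a ha => ?_
    simp only [ha, if_true]
    exact resample_mulVec ρ _ _
  · intro a _ ha
    simp only [ha, if_false]
    rw [resample_mulVec]
    simp

/-- Noise replaces each factor `f` by `ρ f` plus a constant. Expanding the product, only the full
subset keeps `d + 1` factors, with coefficient `ρ ^ (d + 1)`; all other terms have lower degree. -/
theorem noise_sub_mem_degreeSpace (ρ : ℝ) (d : ℕ) {F : (ι → Γ) → ℝ}
    (hF : F ∈ degreeSpace ι Γ (d + 1)) :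
    (noise ι Γ ρ).mulVec F - ρ ^ (d + 1) • F ∈ degreeSpace ι Γ d := by
  have hmon : ∀ (I : Finset ι) (f : ι → Γ → ℝ), I.card ≤ d + 1 →
      (noise ι Γ ρ).mulVec (fun y => ∏ i ∈ I, f i (y i)) -
        ρ ^ (d + 1) • (fun y => ∏ i ∈ I, f i (y i)) ∈ degreeSpace ι Γ d := by
    intro I f hI
    set m : ι → ℝ := fun i => (1 - ρ) * ((∑ c, f i c) / Fintype.card Γ) with hm
    have hexp : (noise ι Γ ρ).mulVec (fun y => ∏ i ∈ I, f i (y i)) =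
        ∑ J ∈ I.powerset, (ρ ^ J.card * ∏ i ∈ I \ J, m i) • fun y => ∏ i ∈ J, f i (y i) := by
      rw [noise_mulVec_monomial]
      ext y
      change ∏ i ∈ I, (ρ * f i (y i) + m i) = _
      rw [Finset.prod_add, Finset.sum_apply]
      refine Finset.sum_congr rfl fun J _ => ?_
      rw [Finset.prod_mul_distrib, Finset.prod_const, Pi.smul_apply, smul_eq_mul]
      ring
    rcases hI.lt_or_eq with h | h
    · refine Submodule.sub_mem _ ?_ (Submodule.smul_mem _ _ (prod_mem_degreeSpace I f (by omega)))
      rw [hexp]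
      refine Submodule.sum_mem _ fun J hJ => Submodule.smul_mem _ _ (prod_mem_degreeSpace J f ?_)
      have := Finset.card_le_card (Finset.mem_powerset.1 hJ)
      omega
    · rw [hexp, ← Finset.insert_erase (Finset.mem_powerset_self I),
        Finset.sum_insert (Finset.notMem_erase _ _)]
      simp only [sdiff_self, Finset.bot_eq_empty, Finset.prod_empty, mul_one, h,
        add_sub_cancel_left]
      refine Submodule.sum_mem _ fun J hJ => Submodule.smul_mem _ _ (prod_mem_degreeSpace J f ?_)
      rw [Finset.mem_erase, Finset.mem_powerset] at hJ
      have := Finset.card_lt_card (Finset.ssubset_iff_subset_ne.2 ⟨hJ.2, hJ.1⟩)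
      omega
  induction hF using Submodule.span_induction with
  | mem F h => obtain ⟨I, f, hI, rfl⟩ := h; exact hmon I f hI
  | zero => simp
  | add F G _ _ hF hG =>
    rw [Matrix.mulVec_add, smul_add, add_sub_add_comm]
    exact Submodule.add_mem _ hF hG
  | smul a F _ hF =>
    rw [Matrix.mulVec_smul, smul_comm, ← smul_sub]
    exact Submodule.smul_mem _ _ hF

theorem noise_mulVec_of_degree_zero (ρ : ℝ) {F : (ι → Γ) → ℝ} (hF : F ∈ degreeSpace ι Γ 0) :
    (noise ι Γ ρ).mulVec F = F := by
  induction hF using Submodule.span_induction with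
  | mem F h =>
    obtain ⟨I, f, hI, rfl⟩ := h
    rw [noise_mulVec_monomial]
    rw [Finset.card_eq_zero.1 (Nat.le_zero.1 hI)]; simp
  | zero => simp
  | add F G _ _ hF hG => rw [Matrix.mulVec_add, hF, hG]
  | smul a F _ hF => rw [Matrix.mulVec_smul, hF]

/-- Low degree functions are stable under noise. -/
theorem pow_mul_dotProduct_le_noise {ρ : ℝ} (h0 : 0 ≤ ρ) (h1 : ρ ≤ 1) (D : ℕ)
    {F : (ι → Γ) → ℝ} (hF : F ∈ degreeSpace ι Γ D) :
    ρ ^ D * (F ⬝ᵥ F) ≤ F ⬝ᵥ ((noise ι Γ ρ).mulVec F) := by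
  let e := (WithLp.linearEquiv 2 ℝ ((ι → Γ) → ℝ)).toLinearMap
  have hsymm : (Matrix.toEuclideanLin (noise ι Γ ρ)).IsSymmetric := by
    rw [Matrix.isSymmetric_toEuclideanLin_iff,
      Matrix.IsHermitian, Matrix.conjTranspose_eq_transpose_of_trivial, noise_transpose]
  have h := pow_mul_norm_sq_le_inner (E := EuclideanSpace ℝ (ι → Γ)) hsymm h0 h1
    (fun d => (degreeSpace ι Γ d).comap e) (fun _ _ h => Submodule.comap_mono (degreeSpace_mono h))
    (fun v hv => ?_) (fun d v hv => ?_) D (v := WithLp.toLp 2 F) (by simpa [e] using hF)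
  · rw [EuclideanSpace.norm_sq_eq] at h
    rw [show F ⬝ᵥ F = ∑ i, ‖(WithLp.toLp 2 F : EuclideanSpace ℝ (ι → Γ)) i‖ ^ 2 by
      simp [dotProduct, sq]]
    refine h.trans (le_of_eq ?_)
    rw [EuclideanSpace.inner_eq_star_dotProduct, dotProduct_comm]
    simp [Matrix.toEuclideanLin]
  · have h2 := noise_mulVec_of_degree_zero ρ (F := e v) hv
    ext y
    exact congrFun h2 y
  · exact noise_sub_mem_degreeSpace ρ d (F := e v) hv

/-- The mean squared displacement of a low degree function under noise. -/
theorem sum_noise_sq_sub_le {ρ : ℝ} (h0 : 0 ≤ ρ) (h1 : ρ ≤ 1) (D : ℕ)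
    {F : (ι → Γ) → ℝ} (hF : F ∈ degreeSpace ι Γ D) :
    ∑ y, ∑ y', noise ι Γ ρ y y' * (F y - F y') ^ 2 ≤ 2 * (1 - ρ ^ D) * ∑ y, F y ^ 2 := by
  have h := pow_mul_dotProduct_le_noise h0 h1 D hF
  have e1 : F ⬝ᵥ F = ∑ y, F y ^ 2 := by simp [dotProduct, sq]
  have e2 : F ⬝ᵥ ((noise ι Γ ρ).mulVec F) = ∑ y, ∑ y', noise ι Γ ρ y y' * (F y * F y') := by
    simp only [dotProduct, Matrix.mulVec, Finset.mul_sum]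
    exact Finset.sum_congr rfl fun y _ => Finset.sum_congr rfl fun y' _ => by ring
  have e3 : ∑ y, ∑ y', noise ι Γ ρ y y' * F y ^ 2 = ∑ y, F y ^ 2 := by
    simp only [← Finset.sum_mul, noise_sum, one_mul]
  have e4 : ∑ y, ∑ y', noise ι Γ ρ y y' * F y' ^ 2 = ∑ y, F y ^ 2 := by
    rw [Finset.sum_comm, ← e3]
    refine Finset.sum_congr rfl fun y _ => Finset.sum_congr rfl fun y' _ => ?_
    rw [← congrFun (congrFun (noise_transpose ρ) y) y', Matrix.transpose_apply]
  have e5 : ∑ y, ∑ y', noise ι Γ ρ y y' * (F y - F y') ^ 2 =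
      ∑ y, ∑ y', noise ι Γ ρ y y' * F y ^ 2 + ∑ y, ∑ y', noise ι Γ ρ y y' * F y' ^ 2
        - 2 * ∑ y, ∑ y', noise ι Γ ρ y y' * (F y * F y') := by
    rw [Finset.mul_sum, ← Finset.sum_add_distrib, ← Finset.sum_sub_distrib]
    refine Finset.sum_congr rfl fun y _ => ?_
    rw [Finset.mul_sum, ← Finset.sum_add_distrib, ← Finset.sum_sub_distrib]
    exact Finset.sum_congr rfl fun y' _ => by ring
  rw [e5, e3, e4, ← e2]
  rw [e1] at h
  linarith

end Degree

/-- Grouping coordinates into blocks does not increase the degree. -/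
theorem degreeSpace_curry {ι κ Γ : Type*} [DecidableEq ι] [DecidableEq κ] {D : ℕ}
    {F : (ι × κ → Γ) → ℝ} (hF : F ∈ degreeSpace (ι × κ) Γ D) :
    (fun c : ι → κ → Γ => F fun p => c p.1 p.2) ∈ degreeSpace ι (κ → Γ) D := by
  induction hF using Submodule.span_induction with
  | mem F h =>
    obtain ⟨I, f, hI, rfl⟩ := h
    -- Factors sharing a first index merge into one factor depending on that block, so the number of
    -- factors can only drop.
    refine Submodule.subset_span ⟨I.image Prod.fst,
      fun a z => ∏ p ∈ I.filter (fun p => p.1 = a), f p (z p.2),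
      (Finset.card_image_le (f := Prod.fst)).trans hI, ?_⟩
    ext c
    beta_reduce
    rw [← Finset.prod_fiberwise_of_maps_to
      (t := I.image Prod.fst) (g := Prod.fst) (fun p hp => Finset.mem_image_of_mem Prod.fst hp)]
    refine Finset.prod_congr rfl fun a _ => Finset.prod_congr rfl fun p hp => ?_
    rw [← (Finset.mem_filter.1 hp).2]
  | zero => exact Submodule.zero_mem _
  | add F G _ _ hF hG => exact Submodule.add_mem _ hF hG
  | smul a F _ hF => exact Submodule.smul_mem _ a hF

/-! ### Empirical conditional entropy -/

section Entropy

variable {N : ℕ} {P : Type*} [Fintype P] [DecidableEq P]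

/-- The number of variables in the cell `c` of the partition `p` to which `x` assigns `v`. -/
def cellCount (p : Fin N → P) (x : Cube N) (c : P) (v : ℤˣ) : ℕ :=
  (Finset.univ.filter fun i => p i = c ∧ x i = v).card

/-- The number of variables in the cell `c` of the partition `p`. -/
def cellSize (p : Fin N → P) (c : P) : ℕ := (Finset.univ.filter fun i => p i = c).card

/-- The conditional frequency of the value `v` of `x` in the cell `c`. -/
def condFreq (p : Fin N → P) (x : Cube N) (c : P) (v : ℤˣ) : ℝ :=
  cellCount p x c v / cellSize p c

/-- The empirical conditional entropy of the assignment `x` given the partition `p`. -/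
def condEntropy (p : Fin N → P) (x : Cube N) : ℝ :=
  (∑ i, -Real.log (condFreq p x (p i) (x i))) / N

theorem sum_cellCount (p : Fin N → P) (x : Cube N) (c : P) :
    ∑ v, cellCount p x c v = cellSize p c := by
  rw [cellSize, Finset.card_eq_sum_card_fiberwise (f := x) (t := Finset.univ)
    fun _ _ => Finset.mem_univ _]
  exact Finset.sum_congr rfl fun v _ => by rw [cellCount, Finset.filter_filter]

theorem cellCount_le_cellSize (p : Fin N → P) (x : Cube N) (c : P) (v : ℤˣ) :
    cellCount p x c v ≤ cellSize p c :=
  Finset.card_le_card fun i => by simp +contextual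

theorem cellCount_le (p : Fin N → P) (x : Cube N) (c : P) (v : ℤˣ) : cellCount p x c v ≤ N :=
  (Finset.card_le_univ _).trans_eq (Fintype.card_fin N)

theorem sum_cellSize (p : Fin N → P) : ∑ c, cellSize p c = N := by
  have h := Finset.card_eq_sum_card_fiberwise (s := Finset.univ) (f := p) (t := Finset.univ)
    (by simp)
  rw [Finset.card_univ, Fintype.card_fin] at h
  exact h.symm

theorem cellSize_mul_condFreq (p : Fin N → P) (x : Cube N) (c : P) (v : ℤˣ) :
    cellSize p c * condFreq p x c v = cellCount p x c v := by
  unfold condFreq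
  rcases Nat.eq_zero_or_pos (cellSize p c) with h | h
  · have := cellCount_le_cellSize p x c v
    rw [h, Nat.le_zero] at this
    simp [h, this]
  · field_simp

theorem condFreq_nonneg (p : Fin N → P) (x : Cube N) (c : P) (v : ℤˣ) : 0 ≤ condFreq p x c v := by
  unfold condFreq; positivity

theorem condFreq_le_one (p : Fin N → P) (x : Cube N) (c : P) (v : ℤˣ) : condFreq p x c v ≤ 1 :=
  div_le_one_of_le₀ (by exact_mod_cast cellCount_le_cellSize p x c v) (by positivity)

theorem cellSize_pos (p : Fin N → P) (i : Fin N) : 0 < cellSize p (p i) :=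
  Finset.card_pos.2 ⟨i, by simp⟩

theorem condFreq_pos (p : Fin N → P) (x : Cube N) (i : Fin N) : 0 < condFreq p x (p i) (x i) := by
  have h1 : 0 < cellCount p x (p i) (x i) := Finset.card_pos.2 ⟨i, by simp⟩
  have h2 := cellSize_pos p i
  unfold condFreq; positivity

/-- Only cells of the form `p i` are allowed: in an empty cell both frequencies are `0` by division
by zero. -/
theorem sum_condFreq (p : Fin N → P) (x : Cube N) (i : Fin N) :
    ∑ v, condFreq p x (p i) v = 1 := by
  simp only [condFreq, ← Finset.sum_div]
  rw [div_eq_one_iff_eq (by exact_mod_cast (cellSize_pos p i).ne')]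
  exact_mod_cast sum_cellCount p x (p i)

theorem sum_cell (p : Fin N → P) (x : Cube N) (φ : P → ℤˣ → ℝ) :
    ∑ i, φ (p i) (x i) = ∑ c, ∑ v, cellCount p x c v * φ c v := by
  have h : ∀ i, φ (p i) (x i) = ∑ c, ∑ v, if p i = c ∧ x i = v then φ c v else 0 := by
    intro i
    rw [Finset.sum_eq_single (p i) (fun c _ hc => by simp [hc.symm]) (by simp),
      Finset.sum_eq_single (x i) (fun v _ hv => by simp [hv.symm])
        fun h => absurd (Finset.mem_univ _) h]
    simp
  simp_rw [h]
  rw [Finset.sum_comm]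
  refine Finset.sum_congr rfl fun c _ => ?_
  rw [Finset.sum_comm]
  refine Finset.sum_congr rfl fun v _ => ?_
  rw [← Finset.sum_filter, Finset.sum_const, nsmul_eq_mul]; rfl

theorem sum_cell_le (p : Fin N → P) (x : Cube N) (φ : P → ℤˣ → ℝ) {B : ℝ}
    (h : ∀ c, ∑ v, condFreq p x c v * φ c v ≤ B) : ∑ i, φ (p i) (x i) ≤ N * B := by
  rw [sum_cell]
  calc ∑ c, ∑ v, cellCount p x c v * φ c v
      = ∑ c, (cellSize p c : ℝ) * ∑ v, condFreq p x c v * φ c v := by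
        refine Finset.sum_congr rfl fun c _ => ?_
        rw [Finset.mul_sum]
        refine Finset.sum_congr rfl fun v _ => ?_
        rw [← mul_assoc, cellSize_mul_condFreq]
    _ ≤ ∑ c, (cellSize p c : ℝ) * B :=
        Finset.sum_le_sum fun c _ => mul_le_mul_of_nonneg_left (h c) (by positivity)
    _ = N * B := by
        rw [← Finset.sum_mul]
        congr 1
        exact_mod_cast sum_cellSize p

/-- The chain rule: joint entropy minus entropy of the partition. The subtracted term does not
involve `x`, and the other is a sum of boundedly many continuous functions of counts, which is what
continuity in Hamming distance needs. -/
theorem condEntropy_eq (hN : N ≠ 0) (p : Fin N → P) (x : Cube N) :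
    condEntropy p x = ∑ c, (∑ v, Real.negMulLog (cellCount p x c v / N) -
      Real.negMulLog (cellSize p c / N)) := by
  have hN' : (N : ℝ) ≠ 0 := by exact_mod_cast hN
  rw [condEntropy, sum_cell p x fun c v => -Real.log (condFreq p x c v), Finset.sum_div]
  refine Finset.sum_congr rfl fun c _ => ?_
  have hs : (cellSize p c : ℝ) = ∑ v, (cellCount p x c v : ℝ) := by
    exact_mod_cast (sum_cellCount p x c).symm
  have h2 : Real.negMulLog (cellSize p c / N) =
      ∑ v, (cellCount p x c v / N : ℝ) * -Real.log (cellSize p c / N) := by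
    rw [← Finset.sum_mul, ← Finset.sum_div, ← hs, Real.negMulLog]; ring
  rw [h2, ← Finset.sum_sub_distrib, Finset.sum_div]
  refine Finset.sum_congr rfl fun v _ => ?_
  rcases Nat.eq_zero_or_pos (cellCount p x c v) with h | h
  · simp [h]
  · have h3 : 0 < cellSize p c := h.trans_le (cellCount_le_cellSize p x c v)
    have h4 : (cellCount p x c v : ℝ) ≠ 0 := by positivity
    have h5 : (cellSize p c : ℝ) ≠ 0 := by positivity
    rw [condFreq, Real.negMulLog, Real.log_div h4 h5, Real.log_div h4 hN', Real.log_div h5 hN']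
    ring

/-- Conditional entropy is continuous in Hamming distance, uniformly in `N`. -/
theorem exists_condEntropy_sub_le (P : Type*) [Fintype P] [DecidableEq P] {ξ : ℝ} (hξ : 0 < ξ) :
    ∃ η : ℝ, 0 < η ∧ ∀ (N : ℕ) (p : Fin N → P) (x x' : Cube N),
      (hammingDist x x' : ℝ) ≤ η * N → condEntropy p x' - condEntropy p x ≤ ξ := by
  have huc : UniformContinuousOn Real.negMulLog (Set.Icc 0 1) :=
    isCompact_Icc.uniformContinuousOn_of_continuous Real.continuous_negMulLog.continuousOn
  -- There are `2 * card P` pairs of a cell and a value, and each contributes at most this share of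
  -- `ξ`.
  obtain ⟨η, hη, h⟩ := Metric.uniformContinuousOn_iff.1 huc
    (ξ / (2 * (Fintype.card P + 1))) (by positivity)
  refine ⟨η / 2, by positivity, fun N p x x' hx => ?_⟩
  rcases Nat.eq_zero_or_pos N with hN | hN
  · subst hN; simp [condEntropy, hξ.le]
  have hN' : (0 : ℝ) < N := by exact_mod_cast hN
  rw [condEntropy_eq hN.ne', condEntropy_eq hN.ne', ← Finset.sum_sub_distrib]
  have hcell : ∀ c v, |(cellCount p x' c v : ℝ) - cellCount p x c v| ≤ hammingDist x x' := by
    intro c v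
    have key : ∀ x x' : Cube N, cellCount p x c v ≤ cellCount p x' c v + hammingDist x x' := by
      intro x x'
      refine (Finset.card_le_card ?_).trans (Finset.card_union_le _ _)
      intro i
      simp only [Finset.mem_filter, Finset.mem_univ, true_and, Finset.mem_union]
      rintro ⟨h1, h2⟩
      by_cases h3 : x i = x' i
      · exact Or.inl ⟨h1, h3 ▸ h2⟩
      · exact Or.inr h3
    have k1 : (cellCount p x c v : ℝ) ≤ cellCount p x' c v + hammingDist x x' := by
      exact_mod_cast key x x'
    have k2 : (cellCount p x' c v : ℝ) ≤ cellCount p x c v + hammingDist x x' := by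
      rw [hammingDist_comm]; exact_mod_cast key x' x
    rw [abs_le]; constructor <;> linarith
  have hmem : ∀ (x : Cube N) c v, (cellCount p x c v / N : ℝ) ∈ Set.Icc (0 : ℝ) 1 := by
    intro x c v
    refine ⟨by positivity, div_le_one_of_le₀ ?_ hN'.le⟩
    exact_mod_cast cellCount_le p x c v
  have hpt : ∀ c v, Real.negMulLog (cellCount p x' c v / N) -
      Real.negMulLog (cellCount p x c v / N) ≤ ξ / (2 * (Fintype.card P + 1)) := by
    intro c v
    have h1 := h _ (hmem x' c v) _ (hmem x c v) (by
      rw [Real.dist_eq, ← sub_div, abs_div, abs_of_pos hN', div_lt_iff₀ hN']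
      refine (hcell c v).trans_lt (hx.trans_lt ?_)
      nlinarith)
    rw [Real.dist_eq] at h1
    exact (le_abs_self _).trans h1.le
  have hU : (Fintype.card ℤˣ : ℝ) = 2 := by norm_num [Fintype.card_units_int]
  calc _ = ∑ c, ∑ v, (Real.negMulLog (cellCount p x' c v / N) -
            Real.negMulLog (cellCount p x c v / N)) := by
        refine Finset.sum_congr rfl fun c _ => ?_
        rw [Finset.sum_sub_distrib]; ring
    _ ≤ ∑ c : P, ∑ v : ℤˣ, ξ / (2 * (Fintype.card P + 1)) :=
        Finset.sum_le_sum fun c _ => Finset.sum_le_sum fun v _ => hpt c v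
    _ = Fintype.card P * ξ / (Fintype.card P + 1) := by
        simp only [Finset.sum_const, Finset.card_univ, nsmul_eq_mul, hU]
        field_simp
    _ ≤ ξ := by
        rw [div_le_iff₀ (by positivity)]; nlinarith

/-- Under the product measure with marginals given by its own conditional frequencies, `x` has mass
`exp (-N H)`. This drives the method of types below. -/
theorem prod_condFreq (hN : N ≠ 0) (p : Fin N → P) (x : Cube N) :
    ∏ i, condFreq p x (p i) (x i) = Real.exp (-(N * condEntropy p x)) := by
  have hN' : (N : ℝ) ≠ 0 := by exact_mod_cast hN
  rw [condEntropy, mul_div_cancel₀ _ hN', ← Finset.sum_neg_distrib, Real.exp_sum]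
  exact Finset.prod_congr rfl fun i _ => by rw [neg_neg, Real.exp_log (condFreq_pos p x i)]

/-- The number of assignments of conditional entropy at most `b`. -/
theorem card_condEntropy_le (p : Fin N → P) (b : ℝ) :
    ((Finset.univ.filter fun x : Cube N => condEntropy p x ≤ b).card : ℝ) ≤
      (N + 1) ^ Fintype.card P * Real.exp (N * b) := by
  rcases Nat.eq_zero_or_pos N with hN | hN
  · subst hN
    have : (Finset.univ.filter fun x : Cube 0 => condEntropy p x ≤ b).card ≤ 1 := by
      refine (Finset.card_le_univ _).trans ?_
      simp
    simpa using this
  -- The count of `1` in each cell determines all conditional frequencies, and there are at most `(N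
  -- + 1) ^ card P` such types.
  let type : Cube N → P → Fin (N + 1) := fun x c => ⟨cellCount p x c 1, 
    Nat.lt_succ_of_le (cellCount_le p x c 1)⟩
  have htype : ∀ x x', type x = type x' → condFreq p x = condFreq p x' := by
    intro x x' h
    have h1 : ∀ c, cellCount p x c 1 = cellCount p x' c 1 := fun c =>
      congrArg Fin.val (congrFun h c)
    have h2 : ∀ c v, cellCount p x c v = cellCount p x' c v := by
      intro c v
      have e1 := sum_cellCount p x c
      have e2 := sum_cellCount p x' c
      rw [show (Finset.univ : Finset ℤˣ) = {1, -1} from rfl, Finset.sum_pair (by decide)] at e1 e2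
      have e3 := h1 c
      rcases Int.units_eq_one_or v with rfl | rfl
      · exact e3
      · omega
    ext c v
    rw [condFreq, condFreq, h2]
  have hfib : ∀ a ∈ (Finset.univ : Finset (P → Fin (N + 1))),
      (((Finset.univ.filter fun x : Cube N => condEntropy p x ≤ b).filter
        fun x => type x = a).card : ℝ) ≤ Real.exp (N * b) := by
    intro a _
    rcases Finset.eq_empty_or_nonempty ((Finset.univ.filter fun x : Cube N =>
      condEntropy p x ≤ b).filter fun x => type x = a) with h | ⟨x₀, hx₀⟩
    · rw [h]; simp [Real.exp_nonneg]
    rw [Finset.mem_filter] at hx₀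
    -- The frequencies of one member of the type class define a product probability measure giving
    -- every member of low entropy mass at least `exp (-N b)`, so there are at most `exp (N b)` of
    -- them.
    have h1 : ∑ x : Cube N, ∏ i, condFreq p x₀ (p i) (x i) = 1 := by
      have := Finset.prod_univ_sum (fun _ : Fin N => (Finset.univ : Finset ℤˣ))
        (fun i v => condFreq p x₀ (p i) v)
      rw [Fintype.piFinset_univ] at this
      rw [← this]
      exact Finset.prod_eq_one fun i _ => sum_condFreq p x₀ i
    have h2 : ∑ x ∈ (Finset.univ.filter fun x : Cube N => condEntropy p x ≤ b).filter
        fun x => type x = a, Real.exp (-(N * b)) ≤ 1 := by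
      rw [← h1]
      refine (Finset.sum_le_sum fun x hx => ?_).trans (Finset.sum_le_sum_of_subset_of_nonneg
        (Finset.subset_univ _) fun x _ _ => Finset.prod_nonneg fun i _ => condFreq_nonneg _ _ _ _)
      simp only [Finset.mem_filter, Finset.mem_univ, true_and] at hx
      rw [htype x₀ x (hx₀.2.trans hx.2.symm), prod_condFreq hN.ne']
      gcongr
      exact hx.1
    rw [Finset.sum_const, nsmul_eq_mul, Real.exp_neg, ← div_eq_mul_inv,
      div_le_one (Real.exp_pos _)] at h2
    exact h2
  rw [Finset.card_eq_sum_card_fiberwise (f := type) (t := Finset.univ) (by simp)]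
  push_cast
  refine (Finset.sum_le_sum hfib).trans (le_of_eq ?_)
  simp [Finset.card_univ]

theorem mul_exp_neg_le {L u : ℝ} (hL : 1 ≤ L) (h : L ≤ u) :
    u * Real.exp (-u) ≤ L * Real.exp (-L) := by
  have h1 : u / L ≤ Real.exp (u / L - 1) := by linarith [Real.add_one_le_exp (u / L - 1)]
  have h2 : u / L - 1 ≤ u - L := by
    rw [div_sub_one (by positivity), div_le_iff₀ (by positivity)]; nlinarith
  have h3 := h1.trans (Real.exp_le_exp.2 h2)
  rw [div_le_iff₀ (by positivity)] at h3
  calc u * Real.exp (-u) ≤ (Real.exp (u - L) * L) * Real.exp (-u) :=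
        mul_le_mul_of_nonneg_right h3 (Real.exp_nonneg _)
    _ = L * Real.exp (-L) := by
        rw [mul_comm (Real.exp (u - L)), mul_assoc, ← Real.exp_add]; congr 2; ring

/-- The conditional entropy truncated at level `L` loses at most `2 L e ^ (-L)`. -/
theorem sum_neg_log_condFreq_le (p : Fin N → P) (x : Cube N) {L : ℝ} (hL : 1 ≤ L) :
    (∑ i, if L < -Real.log (condFreq p x (p i) (x i)) then
      -Real.log (condFreq p x (p i) (x i)) else 0) ≤ N * (2 * (L * Real.exp (-L))) := by
  refine sum_cell_le p x (fun c v => if L < -Real.log (condFreq p x c v) then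
      -Real.log (condFreq p x c v) else 0) fun c => ?_
  have h : ∀ v ∈ (Finset.univ : Finset ℤˣ), condFreq p x c v *
      (if L < -Real.log (condFreq p x c v) then -Real.log (condFreq p x c v) else 0) ≤
      L * Real.exp (-L) := by
    intro v _
    split_ifs with hv
    · have h0 : condFreq p x c v ≠ 0 := by
        intro h0; rw [h0] at hv; simp at hv; linarith
      -- With `u = -log w` one has `w * (-log w) = u * exp (-u)`, which decreases for `u ≥ 1`.
      have h1 := mul_exp_neg_le hL hv.le
      rw [neg_neg, Real.exp_log (lt_of_le_of_ne (condFreq_nonneg p x c v) h0.symm)] at h1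
      linarith
    · rw [mul_zero]; positivity
  refine (Finset.sum_le_sum h).trans (le_of_eq ?_)
  rw [Finset.sum_const, Finset.card_univ, Fintype.card_units_int]; simp

/-- The exponential moment of the log-likelihood of an assignment of large conditional entropy. -/
theorem sum_condFreq_rpow_le (p : Fin N → P) (x : Cube N) {L l : ℝ} (hL : 1 ≤ L) (hl : 0 ≤ l) :
    ∑ i, condFreq p x (p i) (x i) ^ l ≤
      N * (1 - (1 - Real.exp (-(l * L))) / L * (condEntropy p x - 2 * (L * Real.exp (-L)))) := by
  rcases Nat.eq_zero_or_pos N with hN | hN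
  · subst hN; simp
  have hN' : (0 : ℝ) < N := by exact_mod_cast hN
  have hL0 : 0 < L := by linarith
  set θ := (1 - Real.exp (-(l * L))) / L with hθ
  have hθ0 : 0 ≤ θ := div_nonneg (sub_nonneg.2 (Real.exp_le_one_iff.2 (by
    have := mul_nonneg hl hL0.le; linarith))) hL0.le
  have hpt : ∀ i ∈ (Finset.univ : Finset (Fin N)), condFreq p x (p i) (x i) ^ l ≤
      1 - θ * (-Real.log (condFreq p x (p i) (x i)) -
        if L < -Real.log (condFreq p x (p i) (x i)) then
          -Real.log (condFreq p x (p i) (x i)) else 0) := by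
    intro i _
    have hw := condFreq_pos p x i
    have hw1 := condFreq_le_one p x (p i) (x i)
    set w := condFreq p x (p i) (x i)
    have hY : 0 ≤ -Real.log w := neg_nonneg.2 (Real.log_nonpos hw.le hw1)
    split_ifs with h
    · rw [sub_self, mul_zero, sub_zero]; exact Real.rpow_le_one hw.le hw1 hl
    · push Not at h
      set Y := -Real.log w with hYdef
      -- With `Y = -log w`, the convex function `exp (-l Y)` lies below its chord on `[0, L]`, whose
      -- slope is `-θ`. This makes the bound linear in `Y`, hence in the entropy.
      have hconv := convexOn_exp.2 (Set.mem_univ 0) (Set.mem_univ (-(l * L)))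
        (sub_nonneg.2 ((div_le_one hL0).2 h) : 0 ≤ 1 - Y / L) (by positivity : 0 ≤ Y / L)
        (by ring)
      simp only [smul_eq_mul, mul_zero, zero_add, Real.exp_zero, mul_one] at hconv
      have e1 : w ^ l = Real.exp (Y / L * -(l * L)) := by
        rw [Real.rpow_def_of_pos hw]; congr 1; rw [hYdef]; field_simp
      rw [e1, sub_zero]
      refine hconv.trans (le_of_eq ?_)
      rw [hθ]; ring
  refine (Finset.sum_le_sum hpt).trans ?_
  rw [Finset.sum_sub_distrib, ← Finset.mul_sum, Finset.sum_sub_distrib]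
  have h1 := sum_neg_log_condFreq_le p x hL
  have h2 : ∑ i, -Real.log (condFreq p x (p i) (x i)) = N * condEntropy p x := by
    rw [condEntropy]; field_simp
  rw [h2]
  simp only [Finset.sum_const, Finset.card_univ, Fintype.card_fin, nsmul_eq_mul, mul_one]
  have := mul_le_mul_of_nonneg_left h1 hθ0
  linarith

end Entropy

/-! ### Random index tuples matching an earlier assignment -/

section Match

variable {N k : ℕ} {P : Type*} [Fintype P] [DecidableEq P]

/-- Grouping the tuples by their cells turns each side into a sum over cell tuples in which the
weight enters only through its total in each cell. -/
theorem sum_tuple_congr (p : Fin N → P) {φ ψ : Fin N → ℝ}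
    (h : ∀ c, ∑ i, (if p i = c then φ i else 0) = ∑ i, (if p i = c then ψ i else 0))
    (g : (Fin k → P) → ℝ) :
    ∑ I : Fin k → Fin N, (∏ s, φ (I s)) * g (fun s => p (I s)) =
      ∑ I : Fin k → Fin N, (∏ s, ψ (I s)) * g (fun s => p (I s)) := by
  have key : ∀ φ : Fin N → ℝ, ∑ I : Fin k → Fin N, (∏ s, φ (I s)) * g (fun s => p (I s)) =
      ∑ c : Fin k → P, g c * ∏ s, ∑ i, (if p i = c s then φ i else 0) := by
    intro φ
    have e1 : ∀ c : Fin k → P, g c * ∏ s, ∑ i, (if p i = c s then φ i else 0) =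
        ∑ I : Fin k → Fin N, g c * if (fun s => p (I s)) = c then ∏ s, φ (I s) else 0 := by
      intro c
      rw [Finset.prod_univ_sum, Fintype.piFinset_univ, Finset.mul_sum]
      refine Finset.sum_congr rfl fun I _ => ?_
      congr 1
      split_ifs with hc
      · exact Finset.prod_congr rfl fun s _ => if_pos (congrFun hc s)
      · obtain ⟨s, hs⟩ := Function.ne_iff.1 hc
        exact Finset.prod_eq_zero (Finset.mem_univ s) (if_neg hs)
    simp_rw [e1]
    rw [Finset.sum_comm]
    refine Finset.sum_congr rfl fun I _ => ?_
    rw [Finset.sum_eq_single (fun s => p (I s)) (fun c _ hc => by rw [if_neg hc.symm, mul_zero])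
      (fun h => absurd (Finset.mem_univ _) h), if_pos rfl, mul_comm]
  rw [key, key]
  simp_rw [h]

/-- The threshold event, once `x` matches `z`, depends on cells only. So the indicator that `x`
matches `z` at a variable may be replaced by its cell average, a conditional frequency; the product
of these is at most `τ` wherever the event holds. -/
theorem sum_match_le (p : Fin N → P) (x : Cube N) (z : P → ℤˣ) {τ : ℝ} (hτ : 0 ≤ τ) :
    ∑ I : Fin k → Fin N, (if (∀ s, x (I s) = z (p (I s))) ∧
      ∏ s, condFreq p x (p (I s)) (x (I s)) ≤ τ then (1 : ℝ) else 0) ≤ τ * N ^ k := by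
  let g : (Fin k → P) → ℝ := fun c => if ∏ s, condFreq p x (c s) (z (c s)) ≤ τ then 1 else 0
  have h1 : ∑ I : Fin k → Fin N, (if (∀ s, x (I s) = z (p (I s))) ∧
      ∏ s, condFreq p x (p (I s)) (x (I s)) ≤ τ then (1 : ℝ) else 0) =
      ∑ I : Fin k → Fin N, (∏ s, if x (I s) = z (p (I s)) then (1 : ℝ) else 0) *
        g (fun s => p (I s)) := by
    refine Finset.sum_congr rfl fun I _ => ?_
    rw [Finset.prod_ite_zero]
    simp only [Finset.mem_univ, forall_true_left, Finset.prod_const_one, g]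
    by_cases hx : ∀ s, x (I s) = z (p (I s))
    · simp only [hx]; simp
    · simp [hx]
  rw [h1, sum_tuple_congr p (φ := fun i => if x i = z (p i) then 1 else 0)
    (ψ := fun i => condFreq p x (p i) (z (p i)))]
  · calc _ ≤ ∑ I : Fin k → Fin N, τ := by
          refine Finset.sum_le_sum fun I _ => ?_
          simp only [g]
          split_ifs with h
          · rw [mul_one]; exact h
          · rw [mul_zero]; exact hτ
      _ = τ * N ^ k := by simp [mul_comm]
  · intro c
    have e1 : ∀ i, (if p i = c then (if x i = z (p i) then (1 : ℝ) else 0) else 0) =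
        if p i = c ∧ x i = z c then 1 else 0 := by
      intro i
      by_cases h : p i = c
      · subst h; simp
      · simp [h]
    have e2 : ∀ i, (if p i = c then condFreq p x (p i) (z (p i)) else 0) =
        if p i = c then condFreq p x c (z c) else 0 := by
      intro i
      split_ifs with h
      · rw [h]
      · rfl
    simp_rw [e1, e2]
    rw [← Finset.sum_filter, ← Finset.sum_filter, Finset.sum_const, Finset.sum_const,
      nsmul_eq_mul, nsmul_eq_mul, mul_one]
    exact (cellSize_mul_condFreq p x c (z c)).symm

/-- The number of index tuples on which `x` agrees with one of the assignments `z j ∘ p`. -/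
theorem sum_exists_match_le {ι : Type*} (J : Finset ι) (p : Fin N → P) (x : Cube N)
    (z : ι → P → ℤˣ) {τ l : ℝ} (hτ : 0 < τ) (hl : 0 ≤ l) :
    ∑ I : Fin k → Fin N, (if ∃ j ∈ J, ∀ s, x (I s) = z j (p (I s)) then (1 : ℝ) else 0) ≤
      J.card * (τ * N ^ k) + τ⁻¹ ^ l * (∑ i, condFreq p x (p i) (x i) ^ l) ^ k := by
  -- Split on the product of conditional frequencies. If it is at most `τ`, take a union bound over
  -- `j`; if it exceeds `τ`, use Markov's inequality with exponent `l`, which costs no factor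
  -- `J.card`.
  have hpt : ∀ I : Fin k → Fin N,
      (if ∃ j ∈ J, ∀ s, x (I s) = z j (p (I s)) then (1 : ℝ) else 0) ≤
      ∑ j ∈ J, (if (∀ s, x (I s) = z j (p (I s))) ∧
        ∏ s, condFreq p x (p (I s)) (x (I s)) ≤ τ then (1 : ℝ) else 0) +
      τ⁻¹ ^ l * ∏ s, condFreq p x (p (I s)) (x (I s)) ^ l := by
    intro I
    have hw : 0 < ∏ s, condFreq p x (p (I s)) (x (I s)) :=
      Finset.prod_pos fun s _ => condFreq_pos p x (I s)
    have hs : ∀ j ∈ J, (0 : ℝ) ≤ (if (∀ s, x (I s) = z j (p (I s))) ∧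
        ∏ s, condFreq p x (p (I s)) (x (I s)) ≤ τ then (1 : ℝ) else 0) := fun j _ => by
      split_ifs <;> norm_num
    rw [Real.finsetProd_rpow _ _ fun s _ => (condFreq_pos p x (I s)).le,
      ← Real.mul_rpow (by positivity) hw.le]
    have hr : (0 : ℝ) ≤ (τ⁻¹ * ∏ s, condFreq p x (p (I s)) (x (I s))) ^ l := by positivity
    split_ifs with h
    · obtain ⟨j, hj, hm⟩ := h
      by_cases ht : ∏ s, condFreq p x (p (I s)) (x (I s)) ≤ τ
      · have := Finset.single_le_sum hs hj
        rw [if_pos ⟨hm, ht⟩] at this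
        linarith
      · push Not at ht
        have : 1 ≤ (τ⁻¹ * ∏ s, condFreq p x (p (I s)) (x (I s))) ^ l := by
          refine Real.one_le_rpow ?_ hl
          rw [inv_mul_eq_div, one_le_div hτ]; exact ht.le
        have := Finset.sum_nonneg hs
        linarith
    · have := Finset.sum_nonneg hs
      linarith
  refine (Finset.sum_le_sum fun I _ => hpt I).trans ?_
  rw [Finset.sum_add_distrib, Finset.sum_comm]
  refine add_le_add ?_ (le_of_eq ?_)
  · refine (Finset.sum_le_sum fun j _ => sum_match_le p x (z j) hτ.le).trans (le_of_eq ?_)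
    rw [Finset.sum_const, nsmul_eq_mul]
  · rw [← Finset.mul_sum]
    congr 1
    have := Finset.prod_univ_sum (fun _ : Fin k => (Finset.univ : Finset (Fin N)))
      (fun _ i => condFreq p x (p i) (x i) ^ l)
    rw [Fintype.piFinset_univ] at this
    rw [← this, Finset.prod_const, Finset.card_univ, Fintype.card_fin]

end Match

/-! ### Violated clauses -/

section Clause

variable {N k : ℕ}

instance (l : Literal N) (x : Cube N) : Decidable (l.Holds x) :=
  inferInstanceAs (Decidable (x l.1 = if l.2 then 1 else -1))

/-- All literals of the clause `c` are false under `x`. -/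
def Violates (c : Fin k → Literal N) (x : Cube N) : Prop := ∀ s, ¬ (c s).Holds x

instance (c : Fin k → Literal N) (x : Cube N) : Decidable (Violates c x) :=
  inferInstanceAs (Decidable (∀ s, ¬ (c s).Holds x))

theorem not_holds_iff (l : Literal N) (x : Cube N) :
    ¬ l.Holds x ↔ x l.1 = if l.2 then -1 else 1 := by
  obtain ⟨i, b⟩ := l
  rcases Int.units_eq_one_or (x i) with h | h <;> cases b <;> simp [Literal.Holds, h]

/-- Exactly one of the two literals on each variable is false. -/
theorem sum_not_holds (x : Cube N) :
    ∑ l : Literal N, (if ¬ l.Holds x then (1 : ℝ) else 0) = N := by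
  rw [Fintype.sum_prod_type]
  simp only [not_holds_iff, Fintype.sum_bool, if_true]
  have : ∀ i, ((if x i = -1 then (1 : ℝ) else 0) + if x i = (if false = true then -1 else 1) then
      1 else 0) = 1 := by
    intro i
    rcases Int.units_eq_one_or (x i) with h | h <;> simp [h]
  simp_rw [this]
  simp

/-- The number of clauses violated by an assignment. -/
theorem sum_violates (x : Cube N) :
    ∑ c : Fin k → Literal N, (if Violates c x then (1 : ℝ) else 0) = N ^ k := by
  have := Finset.prod_univ_sum (fun _ : Fin k => (Finset.univ : Finset (Literal N)))
    (fun _ l => if ¬ l.Holds x then (1 : ℝ) else 0)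
  rw [Fintype.piFinset_univ] at this
  simp only [sum_not_holds, Finset.prod_const, Finset.card_univ, Fintype.card_fin] at this
  rw [this]
  refine Finset.sum_congr rfl fun c _ => ?_
  rw [Finset.prod_ite_zero]
  by_cases h : Violates c x
  · rw [if_pos h, if_pos fun s _ => h s]; simp
  · rw [if_neg h, if_neg fun h' => h fun s => h' s (Finset.mem_univ s)]

theorem card_clause : (Fintype.card (Fin k → Literal N) : ℝ) = (2 * N) ^ k := by
  simp [mul_comm]

theorem mean_violates (hN : N ≠ 0) (x : Cube N) :
    (∑ c : Fin k → Literal N, (if Violates c x then (1 : ℝ) else 0)) /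
      Fintype.card (Fin k → Literal N) = (1 / 2) ^ k := by
  have : (N : ℝ) ≠ 0 := by exact_mod_cast hN
  rw [sum_violates, card_clause, ← div_pow]
  congr 1; field_simp

/-- Clauses violated by `x` and an earlier assignment correspond to index tuples on which the two
agree. -/
theorem sum_violates_and_le (x : Cube N) {ι : Type*} (J : Finset ι) (X : ι → Cube N) :
    ∑ c : Fin k → Literal N, (if Violates c x ∧ ∃ j ∈ J, Violates c (X j) then (1 : ℝ) else 0) ≤
      ∑ I : Fin k → Fin N, if ∃ j ∈ J, ∀ s, x (I s) = X j (I s) then (1 : ℝ) else 0 := by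
  rw [← Finset.sum_filter, ← Finset.sum_filter, Finset.sum_const, Finset.sum_const,
    nsmul_eq_mul, nsmul_eq_mul, mul_one, mul_one, Nat.cast_le]
  -- A clause violated by `x` is determined by its variables, since `x` forces every sign.
  refine Finset.card_le_card_of_injOn (fun c s => (c s).1) ?_ ?_
  · intro c hc
    simp only [Finset.coe_filter, Finset.mem_univ, true_and, Set.mem_ofPred_eq] at hc ⊢
    obtain ⟨h1, j, hj, h2⟩ := hc
    exact ⟨j, hj, fun s => by rw [(not_holds_iff _ _).1 (h1 s), (not_holds_iff _ _).1 (h2 s)]⟩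
  · intro c hc c' hc' h
    simp only [Finset.coe_filter, Finset.mem_univ, true_and, Set.mem_ofPred_eq] at hc hc'
    funext s
    have e1 := (not_holds_iff _ _).1 (hc.1 s)
    have e2 := (not_holds_iff _ _).1 (hc'.1 s)
    have e3 : (c s).1 = (c' s).1 := congrFun h s
    rw [e3, e2] at e1
    refine Prod.ext e3 ?_
    revert e1
    cases (c s).2 <;> cases (c' s).2 <;> simp

theorem satisfies_iff_forall_not_violates {M : ℕ} (x : Cube N) (y : Fin M → Fin k → Literal N) :
    Satisfies x (fun q : Fin M × Fin k => y q.1 q.2) ↔ ∀ a, ¬ Violates (y a) x := by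
  simp [Satisfies, Violates]

end Clause

/-! ### Sequences of assignments -/

section Sequence

variable {N k m : ℕ}

/-- The partition of the variables by the values of the assignments `X j` with `j < l`. -/
def pattern (X : Fin (m + 1) → Cube N) (l : Fin (m + 1)) (i : Fin N) : Fin (m + 1) → ℤˣ :=
  -- The filler `1` for `j ≥ l` keeps one index type for all `l`, with `2 ^ (m + 1)` possible cells.
  fun j => if j < l then X j i else 1

/-- A bound on the conditional probability that a clause violated by an assignment of conditional
entropy at least `b` is violated by one of `m` earlier assignments. -/
def overlapBound (k m : ℕ) (l L b : ℝ) : ℝ :=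
  m / k + (k : ℝ) ^ l * (1 - (1 - Real.exp (-(l * L))) / L * (b - 2 * (L * Real.exp (-L)))) ^ k

/-- The threshold is `τ = 1 / k`: the union bound over at most `m` earlier assignments then costs `m
/ k`, and Markov's inequality contributes the factor `k ^ l`. Each earlier `X j` is a function of
the pattern, namely its `j`-th coordinate. -/
theorem sum_violates_and_earlier_le (hk : k ≠ 0) (X : Fin (m + 1) → Cube N) (i : Fin (m + 1))
    {l L b : ℝ} (hl : 0 ≤ l) (hL : 1 ≤ L) (hb : b ≤ condEntropy (pattern X i) (X i)) :
    ∑ c : Fin k → Literal N, (if Violates c (X i) ∧ ∃ j < i, Violates c (X j) then (1 : ℝ) else 0) ≤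
      overlapBound k m l L b * N ^ k := by
  have hk' : (0 : ℝ) < k := by positivity
  have h1 := sum_violates_and_le (k := k) (X i) (Finset.univ.filter (· < i)) X
  simp only [Finset.mem_filter, Finset.mem_univ, true_and] at h1
  refine h1.trans ?_
  have h2 := sum_exists_match_le (k := k) (Finset.univ.filter (· < i)) (pattern X i) (X i)
    (fun j c => c j) (τ := 1 / k) (by positivity) hl
  have h3 : ∀ I : Fin k → Fin N, (∃ j ∈ Finset.univ.filter (· < i), ∀ s,
      X i (I s) = pattern X i (I s) j) ↔ ∃ j < i, ∀ s, X i (I s) = X j (I s) := by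
    intro I
    simp only [Finset.mem_filter, Finset.mem_univ, true_and]
    refine exists_congr fun j => and_congr_right fun hj => ?_
    simp [pattern, hj]
  simp only [h3] at h2
  refine h2.trans ?_
  have hcard : ((Finset.univ.filter (· < i)).card : ℝ) ≤ m := by
    rw [Nat.cast_le]
    have : Finset.univ.filter (· < i) = Finset.Iio i := by ext j; simp
    rw [this, Fin.card_Iio]; omega
  have h4 := sum_condFreq_rpow_le (pattern X i) (X i) hL hl
  have hθ : 0 ≤ (1 - Real.exp (-(l * L))) / L :=
    div_nonneg (sub_nonneg.2 (Real.exp_le_one_iff.2 (by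
      have := mul_nonneg hl (by linarith : 0 ≤ L); linarith))) (by linarith)
  have h5 : ∑ v, condFreq (pattern X i) (X i) (pattern X i v) (X i v) ^ l ≤
      N * (1 - (1 - Real.exp (-(l * L))) / L * (b - 2 * (L * Real.exp (-L)))) := by
    refine h4.trans (mul_le_mul_of_nonneg_left ?_ (by positivity))
    have := mul_le_mul_of_nonneg_left hb hθ
    nlinarith
  have h6 := pow_le_pow_left₀ (Finset.sum_nonneg fun v _ =>
    Real.rpow_nonneg (condFreq_nonneg (pattern X i) (X i) _ _) l) h5 k
  rw [overlapBound, one_div, inv_inv]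
  calc _ ≤ m * ((k : ℝ)⁻¹ * N ^ k) + (k : ℝ) ^ l *
        (N * (1 - (1 - Real.exp (-(l * L))) / L * (b - 2 * (L * Real.exp (-L))))) ^ k := by
        gcongr
    _ = _ := by rw [mul_pow]; ring

/-- The probability that a clause of the resampling chain is satisfied by all assignments of a
sequence in which few violated clauses are violated earlier. -/
theorem pathExp_clause_le (hN : N ≠ 0) {ρ : ℝ} (h0 : 0 ≤ ρ) (h1 : ρ ≤ 1) {Q : ℝ}
    (X : Fin (m + 1) → Cube N) {t : Fin (m + 1) → ℕ} (ht : Monotone t) {T : ℕ} (hT : ∀ i, t i ≤ T)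
    (hQ : ∀ i, i ≠ 0 → ∑ c : Fin k → Literal N,
      (if Violates c (X i) ∧ ∃ j < i, Violates c (X j) then (1 : ℝ) else 0) ≤ Q * N ^ k) :
    pathExp (fun _ => (Fintype.card (Fin k → Literal N) : ℝ)⁻¹) (resample (Fin k → Literal N) ρ) T
      (fun z => if ∀ i, ¬ Violates (z (t i)) (X i) then 1 else 0) ≤
      1 - m * (1 / 2) ^ k * (1 - Q - m * (1 / 2) ^ k) := by
  have : NeZero N := ⟨hN⟩
  set Γ := Fin k → Literal N with hΓ
  have hN' : (N : ℝ) ≠ 0 := by exact_mod_cast hN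
  have hcard : (Fintype.card Γ : ℝ) ≠ 0 := by exact_mod_cast Fintype.card_ne_zero
  set π : Γ → ℝ := fun _ => (Fintype.card Γ : ℝ)⁻¹ with hπ
  set K := resample Γ ρ with hK
  have hπ0 : ∀ s, 0 ≤ π s := fun s => by simp only [hπ]; positivity
  have hπ1 : ∑ s, π s = 1 := by simp [hπ, Finset.card_univ, -Fintype.card_pi]
  have hK0 : ∀ s s', 0 ≤ K s s' := resample_nonneg h0 h1
  have hK1 : ∀ s, ∑ s', K s s' = 1 := resample_sum ρ
  have hst : Matrix.vecMul π K = π := by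
    ext c
    simp only [Matrix.vecMul, dotProduct, hπ, ← Finset.mul_sum]
    simp_rw [hK, resample_comm ρ _ c]
    rw [resample_sum, mul_one]
  have hsum : ∀ g : Γ → ℝ, ∑ s, π s * g s = (∑ s, g s) / Fintype.card Γ := fun g => by
    simp only [hπ, ← Finset.mul_sum]; ring
  let v : Fin (m + 1) → Γ → ℝ := fun i c => if Violates c (X i) then 1 else 0
  let e : Fin (m + 1) → Γ → ℝ := fun i c =>
    if Violates c (X i) ∧ ∃ j < i, Violates c (X j) then 1 else 0
  let ψ : Fin (m + 1) → Fin (m + 1) → Γ → ℝ := fun i j c =>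
    if Violates c (X i) ∧ ¬ Violates c (X j) then 1 else 0
  -- The events that `i` is the first index with a violation are disjoint. A violation at `i` fails
  -- to be first because of some `j < i`; then the clause at time `t i` itself violates `X j`
  -- (counted by `e`), or it does not (counted by `ψ`) and must have been resampled in between. The
  -- index `0` is dropped since `hQ` excludes it.
  have hpt : ∀ z : ℕ → Γ, (if ∀ i, ¬ Violates (z (t i)) (X i) then (1 : ℝ) else 0) ≤
      1 - ∑ i ∈ Finset.univ.erase (0 : Fin (m + 1)), (v i (z (t i)) -
        (e i (z (t i)) + ∑ j ∈ Finset.Iio i, v j (z (t j)) * ψ i j (z (t i)))) := by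
    intro z
    have hi : ∀ i, v i (z (t i)) - (e i (z (t i)) +
        ∑ j ∈ Finset.Iio i, v j (z (t j)) * ψ i j (z (t i))) ≤
        if Violates (z (t i)) (X i) ∧ ∀ j < i, ¬ Violates (z (t j)) (X j) then 1 else 0 := by
      intro i
      have hnn : ∀ j ∈ Finset.Iio i, 0 ≤ v j (z (t j)) * ψ i j (z (t i)) := fun j _ => by
        simp only [v, ψ]; split_ifs <;> norm_num
      have hs := Finset.sum_nonneg hnn
      have he : 0 ≤ e i (z (t i)) := by simp only [e]; split_ifs <;> norm_num
      by_cases hv : Violates (z (t i)) (X i)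
      · have hvi : v i (z (t i)) = 1 := if_pos hv
        by_cases hj : ∀ j < i, ¬ Violates (z (t j)) (X j)
        · rw [if_pos ⟨hv, hj⟩]; linarith
        · rw [if_neg fun h => hj h.2]
          push Not at hj
          obtain ⟨j, hji, hj⟩ := hj
          by_cases hj2 : Violates (z (t i)) (X j)
          · have : e i (z (t i)) = 1 := if_pos ⟨hv, j, hji, hj2⟩
            linarith
          · have h3 := Finset.single_le_sum hnn (Finset.mem_Iio.2 hji)
            have h4 : v j (z (t j)) * ψ i j (z (t i)) = 1 := by
              simp only [v, ψ, if_pos hj, hv, hj2, not_false_eq_true, and_self, if_true, mul_one]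
            linarith
      · have hvi : v i (z (t i)) = 0 := if_neg hv
        rw [if_neg fun h => hv h.1]; linarith
    have hle := Finset.sum_le_sum (s := Finset.univ.erase (0 : Fin (m + 1))) fun i _ => hi i
    have hle2 : ∑ i ∈ Finset.univ.erase (0 : Fin (m + 1)), (if Violates (z (t i)) (X i) ∧
        ∀ j < i, ¬ Violates (z (t j)) (X j) then (1 : ℝ) else 0) ≤
        1 - if ∀ i, ¬ Violates (z (t i)) (X i) then (1 : ℝ) else 0 := by
      split_ifs with hall
      · rw [Finset.sum_eq_zero fun i _ => if_neg fun h => hall i h.1]; norm_num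
      · rw [← Finset.sum_filter, Finset.sum_const, nsmul_eq_mul, mul_one, sub_zero,
          Nat.cast_le_one, Finset.card_le_one]
        intro i hi' j hj'
        simp only [Finset.mem_filter] at hi' hj'
        by_contra hne
        rcases lt_or_gt_of_ne hne with h | h
        · exact hj'.2.2 i h hi'.2.1
        · exact hi'.2.2 j h hj'.2.1
    linarith
  refine (pathExp_mono hπ0 hK0 T hpt).trans ?_
  rw [pathExp_sub, pathExp_one hK1 hπ1, pathExp_sum]
  have hterm : ∀ i ∈ Finset.univ.erase (0 : Fin (m + 1)), (1 / 2 : ℝ) ^ k * (1 - Q - m * (1 / 2) ^ k) ≤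
      pathExp π K T (fun z => v i (z (t i)) -
        (e i (z (t i)) + ∑ j ∈ Finset.Iio i, v j (z (t j)) * ψ i j (z (t i)))) := by
    intro i hi
    rw [pathExp_sub, pathExp_add, pathExp_sum, pathExp_eval hK1 hst (hT i),
      pathExp_eval hK1 hst (hT i), hsum, hsum]
    have h2 : (∑ s, v i s) / Fintype.card Γ = (1 / 2) ^ k := mean_violates hN (X i)
    have h3 : (∑ s, e i s) / Fintype.card Γ ≤ (1 / 2) ^ k * Q := by
      refine (div_le_div_of_nonneg_right (hQ i (Finset.ne_of_mem_erase hi)) (by positivity)).trans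
        (le_of_eq ?_)
      rw [show (Fintype.card Γ : ℝ) = (2 * N) ^ k from card_clause, mul_pow]
      have : (N : ℝ) ^ k ≠ 0 := by positivity
      field_simp
      rw [mul_assoc, ← mul_pow]; norm_num
    have h4 : ∀ j ∈ Finset.Iio i, pathExp π K T (fun z => v j (z (t j)) * ψ i j (z (t i))) ≤
        (1 / 2) ^ k * (1 / 2) ^ k := by
      intro j hj
      obtain ⟨n, hn⟩ := Nat.exists_eq_add_of_le (ht (Finset.mem_Iio.1 hj).le)
      have e1 := pathExp_eval_mul_eval hK1 hst (s := t j) (n := n) (T := T) (by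
        rw [← hn]; exact hT i) (v j) (ψ i j)
      rw [hn, e1, hK, resample_pow]
      -- No clause both violates and does not violate `X j`, so the unresampled part vanishes. The
      -- resampled part factorises, with both factors at most `(1 / 2) ^ k`.
      have e2 : ∀ c, v j c * ((resample Γ (ρ ^ n)).mulVec (ψ i j)) c =
          (1 - ρ ^ n) * ((∑ c', ψ i j c') / Fintype.card Γ) * v j c := by
        intro c
        have : v j c * ψ i j c = 0 := by
          simp only [v, ψ]; split_ifs with a b <;> simp_all
        rw [resample_mulVec]; linear_combination ρ ^ n * this
      simp_rw [e2]
      rw [hsum, ← Finset.mul_sum, mul_div_assoc,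
        show (∑ s, v j s) / Fintype.card Γ = (1 / 2) ^ k from mean_violates hN (X j)]
      refine mul_le_mul_of_nonneg_right ?_ (by positivity)
      have e3 : (∑ c, ψ i j c) / Fintype.card Γ ≤ (1 / 2) ^ k := by
        rw [← h2]
        refine div_le_div_of_nonneg_right (Finset.sum_le_sum fun c _ => ?_) (by positivity)
        simp only [v, ψ]; split_ifs with a b <;> simp_all
      have e4 : 0 ≤ (∑ c, ψ i j c) / Fintype.card Γ :=
        div_nonneg (Finset.sum_nonneg fun c _ => by simp only [ψ]; split_ifs <;> norm_num)
          (by positivity)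
      have e5 : 0 ≤ ρ ^ n := pow_nonneg h0 n
      nlinarith
    have h5 := Finset.sum_le_sum h4
    rw [Finset.sum_const, Fin.card_Iio, nsmul_eq_mul] at h5
    have h6 : ((i : ℕ) : ℝ) ≤ m := by
      have := i.2
      exact_mod_cast (by omega : (i : ℕ) ≤ m)
    have h7 : ((i : ℕ) : ℝ) * ((1 / 2) ^ k * (1 / 2) ^ k) ≤ m * ((1 / 2) ^ k * (1 / 2) ^ k) := by
      gcongr
    rw [h2]
    linarith
  have h8 := Finset.sum_le_sum hterm
  rw [Finset.sum_const, Finset.card_erase_of_mem (Finset.mem_univ _), Finset.card_univ,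
    Fintype.card_fin, nsmul_eq_mul, Nat.add_sub_cancel] at h8
  linarith

end Sequence

/-! ### Counting sequences of assignments -/

section Counting

variable {N m : ℕ}

theorem pattern_congr {X X' : Fin (m + 1) → Cube N} {l : Fin (m + 1)}
    (h : ∀ j < l, X j = X' j) : pattern X l = pattern X' l := by
  funext i j
  simp only [pattern]
  split_ifs with hj
  · rw [h j hj]
  · rfl

/-- The assignments are chosen one after another: `2 ^ N` choices for the first, and for each of the
other `m` the method of types given the pattern of its predecessors. -/
theorem card_sequences_le (N m : ℕ) (b : ℝ) :
    ((Finset.univ.filter fun X : Fin (m + 1) → Cube N =>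
      ∀ i, i ≠ 0 → condEntropy (pattern X i) (X i) ≤ b).card : ℝ) ≤
      2 ^ N * ((N + 1) ^ (2 ^ (m + 1)) * Real.exp (N * b)) ^ m := by
  classical
  set B : ℝ := (N + 1) ^ (2 ^ (m + 1)) * Real.exp (N * b) with hB
  have hB0 : 0 ≤ B := by rw [hB]; positivity
  have hP : Fintype.card (Fin (m + 1) → ℤˣ) = 2 ^ (m + 1) := by
    rw [Fintype.card_fun, Fintype.card_units_int, Fintype.card_fin]
  -- Entries after `n` are frozen at `1`, so that resetting entry `n + 1` maps stage `n + 1` to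
  -- stage `n` with fibres counted by `card_condEntropy_le`.
  let A : ℕ → Finset (Fin (m + 1) → Cube N) := fun n => Finset.univ.filter fun X =>
    (∀ i : Fin (m + 1), i ≠ 0 → (i : ℕ) ≤ n → condEntropy (pattern X i) (X i) ≤ b) ∧
      ∀ i : Fin (m + 1), n < (i : ℕ) → X i = 1
  have hA : ∀ n ≤ m, ((A n).card : ℝ) ≤ 2 ^ N * B ^ n := by
    intro n
    induction n with
    | zero =>
      intro _
      have : (A 0).card ≤ (Finset.univ : Finset (Cube N)).card := by
        refine Finset.card_le_card_of_injOn (fun X => X 0) (fun _ _ => Finset.mem_univ _) ?_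
        intro X hX X' hX' h
        simp only [A, Finset.coe_filter, Finset.mem_univ, true_and, Set.mem_ofPred_eq] at hX hX'
        funext i
        by_cases hi : i = 0
        · rw [hi]; exact h
        · have : 0 < (i : ℕ) := Nat.pos_of_ne_zero fun h0 => hi (Fin.ext h0)
          rw [hX.2 i this, hX'.2 i this]
      rw [Finset.card_univ, Fintype.card_fun, Fintype.card_units_int, Fintype.card_fin] at this
      simpa using (by exact_mod_cast this : ((A 0).card : ℝ) ≤ 2 ^ N)
    | succ n ih =>
      intro hn
      let l : Fin (m + 1) := ⟨n + 1, by omega⟩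
      have hmaps : Set.MapsTo (fun X : Fin (m + 1) → Cube N => Function.update X l 1)
          (A (n + 1) : Set (Fin (m + 1) → Cube N)) (A n) := by
        intro X hX
        simp only [A, Finset.coe_filter, Finset.mem_univ, true_and, Set.mem_ofPred_eq] at hX ⊢
        refine ⟨fun i hi hin => ?_, fun i hi => ?_⟩
        · have hil : i ≠ l := fun h => by rw [h] at hin; simp [l] at hin
          rw [Function.update_of_ne hil, pattern_congr (X' := X)]
          · exact hX.1 i hi (by omega)
          · intro j hj
            refine Function.update_of_ne (fun h => ?_) _ _
            rw [h, Fin.lt_def] at hj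
            simp only [l] at hj; omega
        · by_cases hil : i = l
          · rw [hil, Function.update_self]
          · rw [Function.update_of_ne hil]
            exact hX.2 i (lt_of_le_of_ne hi fun h => hil (Fin.ext h.symm))
      rw [Finset.card_eq_sum_card_fiberwise hmaps]
      push_cast
      have hfib : ∀ X₀ ∈ A n, (((A (n + 1)).filter
          fun X => Function.update X l 1 = X₀).card : ℝ) ≤ B := by
        intro X₀ _
        refine le_trans ?_ (hP ▸ card_condEntropy_le (pattern X₀ l) b)
        rw [Nat.cast_le]
        refine Finset.card_le_card_of_injOn (fun X => X l) ?_ ?_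
        · intro X hX
          simp only [A, Finset.coe_filter, Finset.mem_univ, true_and, Set.mem_ofPred_eq,
            Finset.mem_filter] at hX ⊢
          rw [pattern_congr (X' := X)]
          · exact hX.1.1 l (by simp [l, Fin.ext_iff]) le_rfl
          · intro j hj
            rw [← hX.2, Function.update_of_ne hj.ne]
        · intro X hX X' hX' h
          simp only [Finset.coe_filter, Set.mem_ofPred_eq] at hX hX'
          have e := hX.2.trans hX'.2.symm
          funext i
          by_cases hi : i = l
          · rw [hi]; exact h
          · have := congrFun e i
            rwa [Function.update_of_ne hi, Function.update_of_ne hi] at this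
      refine (Finset.sum_le_sum hfib).trans ?_
      rw [Finset.sum_const, nsmul_eq_mul, pow_succ, ← mul_assoc (2 ^ N)]
      exact mul_le_mul_of_nonneg_right (ih (by omega)) hB0
  refine le_trans ?_ (hA m le_rfl)
  rw [Nat.cast_le]
  refine Finset.card_le_card fun X hX => ?_
  simp only [A, Finset.mem_filter, Finset.mem_univ, true_and] at hX ⊢
  exact ⟨fun i hi _ => hX i hi, fun i hi => absurd i.2 (by omega)⟩

end Counting

/-! ### Choosing times along a slowly moving sequence -/

section Times

variable {N m : ℕ}

/-- An earlier assignment is constant on each cell of the pattern. Thus the conditional entropy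
starts at `0` right after a selection and must later cross level `b`. -/
theorem condEntropy_pattern_self (X : Fin (m + 1) → Cube N) {j l : Fin (m + 1)} (h : j < l) :
    condEntropy (pattern X l) (X j) = 0 := by
  have : ∀ i, condFreq (pattern X l) (X j) (pattern X l i) (X j i) = 1 := by
    intro i
    have h1 : cellCount (pattern X l) (X j) (pattern X l i) (X j i) =
        cellSize (pattern X l) (pattern X l i) := by
      unfold cellCount cellSize
      congr 1
      ext i'
      simp only [Finset.mem_filter, Finset.mem_univ, true_and, and_iff_left_iff_imp]
      intro h'
      have := congrFun h' j
      simpa [pattern, h] using this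
    rw [condFreq, h1, div_self]
    exact_mod_cast (cellSize_pos (pattern X l) i).ne'
  simp [condEntropy, this]

/-- A slowly moving sequence that decouples from its past visits configurations of prescribed
conditional entropies. -/
theorem exists_times {x : ℕ → Cube N} {b' b η : ℝ} {T T₀ : ℕ} (hb : 0 ≤ b)
    (hη : ∀ (p : Fin N → Fin (m + 1) → ℤˣ) (x x' : Cube N), (hammingDist x x' : ℝ) ≤ η * N →
      condEntropy p x' - condEntropy p x ≤ b - b')
    (hstep : ∀ t < T, (hammingDist (x t) (x (t + 1)) : ℝ) ≤ η * N) (hT : m * T₀ ≤ T)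
    (hfar : ∀ τ : Fin (m + 1) → ℕ, Monotone τ → (∀ i, τ i ≤ T) → ∀ i : Fin m,
      τ i.castSucc + T₀ ≤ T →
        b < condEntropy (pattern (fun j => x (τ j)) i.succ) (x (τ i.castSucc + T₀))) :
    ∃ τ : Fin (m + 1) → ℕ, Monotone τ ∧ (∀ i, τ i ≤ T) ∧
      ∀ i, i ≠ 0 → b' ≤ condEntropy (pattern (fun j => x (τ j)) i) (x (τ i)) ∧
        condEntropy (pattern (fun j => x (τ j)) i) (x (τ i)) ≤ b := by
  have key : ∀ n ≤ m, ∃ τ : Fin (m + 1) → ℕ, Monotone τ ∧ (∀ i, τ i ≤ n * T₀) ∧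
      ∀ i : Fin (m + 1), i ≠ 0 → (i : ℕ) ≤ n → b' ≤ condEntropy (pattern (fun j => x (τ j)) i) (x (τ i)) ∧
        condEntropy (pattern (fun j => x (τ j)) i) (x (τ i)) ≤ b := by
    intro n
    induction n with
    | zero =>
      intro _
      refine ⟨fun _ => 0, monotone_const, by simp, fun i hi hi0 => absurd (Fin.ext ?_) hi⟩
      exact Nat.le_zero.1 hi0
    | succ n ih =>
      intro hn
      obtain ⟨τ, hmono, hle, hwin⟩ := ih (by omega)
      let i₀ : Fin m := ⟨n, by omega⟩
      have hnT : n * T₀ + T₀ ≤ T := by nlinarith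
      have hle0 := hle i₀.castSucc
      have hf := hfar τ hmono (fun i => (hle i).trans (by omega)) i₀ (by omega)
      set s := τ i₀.castSucc with hs
      set p := pattern (fun j => x (τ j)) i₀.succ with hp
      -- The first crossing of level `b` after the last selected time occurs within `T₀` steps, and
      -- not immediately.
      have hex : ∃ r, b < condEntropy p (x (s + r)) := ⟨T₀, hf⟩
      classical
      have hr := Nat.find_spec hex
      have hrle : Nat.find hex ≤ T₀ := Nat.find_min' hex hf
      have hr0 : Nat.find hex ≠ 0 := by
        intro h0
        rw [h0, add_zero, hs, hp,
          condEntropy_pattern_self (fun j => x (τ j)) (Fin.castSucc_lt_succ)] at hr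
        linarith
      obtain ⟨r, hr1⟩ := Nat.exists_eq_succ_of_ne_zero hr0
      have hlow : condEntropy p (x (s + r)) ≤ b :=
        not_lt.1 (Nat.find_min hex (by rw [hr1]; exact Nat.lt_succ_self r))
      rw [hr1] at hr hrle
      -- The time just before the crossing is selected: the value is still at most `b`, and one step
      -- adds at most `b - b'`, so it is at least `b'`.
      have hhigh : b' ≤ condEntropy p (x (s + r)) := by
        have := hη p _ _ (hstep (s + r) (by omega))
        have hr' : b < condEntropy p (x (s + r + 1)) := hr
        linarith
      -- All indices after `n` receive the new time, which keeps the sequence monotone; later stages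
      -- overwrite the surplus.
      let τ' : Fin (m + 1) → ℕ := fun j => if (j : ℕ) ≤ n then τ j else s + r
      have hτ' : ∀ j : Fin (m + 1), (j : ℕ) ≤ n → τ' j = τ j := fun j hj => if_pos hj
      have hpat : ∀ i : Fin (m + 1), (i : ℕ) ≤ n + 1 →
          pattern (fun j => x (τ' j)) i = pattern (fun j => x (τ j)) i := fun i hi =>
        pattern_congr fun j hj => by
          have : (j : ℕ) < i := hj
          simp only [hτ' j (by omega)]
      refine ⟨τ', ?_, ?_, ?_⟩
      · intro i j hij
        have hij' : (i : ℕ) ≤ j := hij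
        simp only [τ']
        split_ifs with h1 h2 h2
        · exact hmono hij
        · refine (hmono (b := i₀.castSucc) ?_).trans (Nat.le_add_right _ _)
          exact h1
        · omega
        · exact le_rfl
      · intro i
        simp only [τ']
        split_ifs
        · exact (hle i).trans (by nlinarith)
        · rw [add_mul]; omega
      · intro i hi hin
        rw [hpat i hin]
        rcases Nat.lt_or_ge n i with h | h
        · have hi' : i = i₀.succ := Fin.ext (by simp [i₀]; omega)
          have : τ' i = s + r := if_neg (by omega)
          rw [this, hi']
          exact ⟨hhigh, hlow⟩
        · rw [hτ' i h]; exact hwin i hi h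
  obtain ⟨τ, h1, h2, h3⟩ := key m le_rfl
  exact ⟨τ, h1, fun i => (h2 i).trans hT, fun i hi => h3 i hi (by omega)⟩

end Times

/-! ### The probability of a slowly moving sequence of satisfying assignments -/

section Path

variable {N M k m : ℕ}

/-- The assignment `x` violates no clause of `y`. -/
def AllSat (x : Cube N) (y : Fin M → Fin k → Literal N) : Prop := ∀ a, ¬ Violates (y a) x

instance (x : Cube N) (y : Fin M → Fin k → Literal N) : Decidable (AllSat x y) :=
  inferInstanceAs (Decidable (∀ a, ¬ Violates (y a) x))

/-- The indicator that `f` satisfies both `y` and `y'` by assignments at distance at most `η N`. -/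
def stablePair (f : (Fin M → Fin k → Literal N) → Cube N) (η : ℝ) :
    Matrix (Fin M → Fin k → Literal N) (Fin M → Fin k → Literal N) ℝ :=
  fun y y' => if AllSat (f y) y ∧ AllSat (f y') y' ∧ (hammingDist (f y) (f y') : ℝ) ≤ η * N
    then 1 else 0

/-- The expectation along the stationary resampling chain of `k`-SAT instances. -/
def instExp (N M k : ℕ) (ρ : ℝ) (T : ℕ) (F : (ℕ → Fin M → Fin k → Literal N) → ℝ) : ℝ :=
  pathExp (fun _ : Fin M → Fin k → Literal N =>
    ∏ _a : Fin M, (Fintype.card (Fin k → Literal N) : ℝ)⁻¹)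
    (noise (Fin M) (Fin k → Literal N) ρ) T F

theorem instExp_mono {ρ : ℝ} (h0 : 0 ≤ ρ) (h1 : ρ ≤ 1) (T : ℕ)
    {F G : (ℕ → Fin M → Fin k → Literal N) → ℝ} (h : ∀ y, F y ≤ G y) :
    instExp N M k ρ T F ≤ instExp N M k ρ T G :=
  pathExp_mono (fun _ => by positivity) (noise_nonneg h0 h1) T h

theorem instExp_const (hN : N ≠ 0) (ρ : ℝ) (T : ℕ) (a : ℝ) :
    instExp N M k ρ T (fun _ => a) = a := by
  have : NeZero N := ⟨hN⟩
  have h := pathExp_const_mul (π := fun _ : Fin M → Fin k → Literal N =>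
    ∏ _a : Fin M, (Fintype.card (Fin k → Literal N) : ℝ)⁻¹)
    (K := noise (Fin M) (Fin k → Literal N) ρ) T a (fun _ => 1)
  rw [pathExp_one (noise_sum ρ), mul_one] at h
  · simpa [instExp] using h
  · rw [Finset.sum_const, Finset.card_univ, Fintype.card_fun (α := Fin M), nsmul_eq_mul,
      Finset.prod_const, Finset.card_univ, Nat.cast_pow, ← mul_pow, mul_inv_cancel₀, one_pow]
    exact_mod_cast Fintype.card_ne_zero

/-- Clauses evolve independently, and each is resampled with probability `1 - ρ` and then violated
by the fixed `x` with probability `(1 / 2) ^ k`. -/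
theorem noise_mulVec_allSat_le (hN : N ≠ 0) {ρ : ℝ} (h0 : 0 ≤ ρ) (h1 : ρ ≤ 1) (x : Cube N)
    (y : Fin M → Fin k → Literal N) :
    (noise (Fin M) (Fin k → Literal N) ρ).mulVec (fun y => if AllSat x y then 1 else 0) y ≤
      (1 - (1 - ρ) * (1 / 2) ^ k) ^ M := by
  have : NeZero N := ⟨hN⟩
  have e : (fun y : Fin M → Fin k → Literal N => if AllSat x y then (1 : ℝ) else 0) =
      fun y => ∏ a, if ¬ Violates (y a) x then 1 else 0 := by
    ext y
    rw [Finset.prod_ite_zero]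
    by_cases h : AllSat x y
    · rw [if_pos h, if_pos fun a _ => h a]; simp
    · rw [if_neg h, if_neg fun h' => h fun a => h' a (Finset.mem_univ a)]
  have hm : (∑ c : Fin k → Literal N, if ¬ Violates c x then (1 : ℝ) else 0) /
      Fintype.card (Fin k → Literal N) = 1 - (1 / 2) ^ k := by
    rw [← mean_violates hN x, eq_sub_iff_add_eq, ← add_div, ← Finset.sum_add_distrib]
    rw [Finset.sum_congr rfl (g := fun _ => (1 : ℝ)) fun c _ => by split_ifs <;> norm_num]
    rw [Finset.sum_const, Finset.card_univ, nsmul_eq_mul, mul_one, div_self]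
    exact_mod_cast Fintype.card_ne_zero
  rw [e, noise_mulVec_prod (ι := Fin M) ρ (fun _ c => if ¬ Violates c x then (1 : ℝ) else 0)]
  have hc : ((1 : ℝ) - (1 - ρ) * (1 / 2) ^ k) ^ M =
      ∏ _a : Fin M, ((1 : ℝ) - (1 - ρ) * (1 / 2) ^ k) := by simp
  rw [hc]
  have hk : (1 / 2 : ℝ) ^ k ≤ 1 := pow_le_one₀ (by norm_num) (by norm_num)
  refine Finset.prod_le_prod (fun a _ => ?_) fun a _ => ?_
  · rw [resample_mulVec, hm]
    have : (0 : ℝ) ≤ if ¬ Violates (y a) x then 1 else 0 := by split_ifs <;> norm_num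
    exact add_nonneg (mul_nonneg h0 this) (mul_nonneg (by linarith) (by linarith))
  · rw [resample_mulVec, hm]
    have : (if ¬ Violates (y a) x then (1 : ℝ) else 0) ≤ 1 := by split_ifs <;> norm_num
    nlinarith

/-- After `n` steps of resampling, no assignment of small conditional entropy given the past
satisfies the instance. -/
theorem instExp_near_le (hN : N ≠ 0) {ρ : ℝ} (h0 : 0 ≤ ρ) (h1 : ρ ≤ 1)
    (f : (Fin M → Fin k → Literal N) → Cube N) (b : ℝ) {τ : Fin (m + 1) → ℕ} (hτ : Monotone τ)
    (i : Fin m) {n T : ℕ} (hT : τ i.castSucc + n ≤ T) :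
    instExp N M k ρ T (fun y => ∑ x : Cube N,
      (if condEntropy (pattern (fun j => f (y (τ j))) i.succ) x ≤ b then (1 : ℝ) else 0) *
        (if AllSat x (y (τ i.castSucc + n)) then 1 else 0)) ≤
      ((N + 1) ^ (2 ^ (m + 1)) * Real.exp (N * b)) * (1 - (1 - ρ ^ n) * (1 / 2) ^ k) ^ M := by
  have : NeZero N := ⟨hN⟩
  have hρ0 : 0 ≤ ρ ^ n := pow_nonneg h0 n
  have hρ1 : ρ ^ n ≤ 1 := pow_le_one₀ h0 h1
  set q : ℝ := (1 - (1 - ρ ^ n) * (1 / 2) ^ k) ^ M with hq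
  have hk : (1 / 2 : ℝ) ^ k ≤ 1 := pow_le_one₀ (by norm_num) (by norm_num)
  have hk0 : (0 : ℝ) ≤ (1 / 2) ^ k := by positivity
  have hq0 : 0 ≤ q := pow_nonneg (by nlinarith) M
  set g : Cube N → (ℕ → Fin M → Fin k → Literal N) → ℝ := fun x y =>
    if condEntropy (pattern (fun j => f (y (τ j))) i.succ) x ≤ b then (1 : ℝ) else 0 with hg
  -- The pattern involves only times up to `τ i.castSucc`, so the low-entropy event is part of the
  -- past and the Markov property applies to each fixed `x`.
  have hgdep : ∀ x, DependsOn (g x) (Set.Iic (τ i.castSucc)) := by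
    intro x y y' hy
    simp only [hg]
    rw [pattern_congr (X' := fun j => f (y' (τ j)))]
    intro j hj
    rw [hy (τ j) (hτ (Fin.le_castSucc_iff.2 hj))]
  have hg0 : ∀ x y, 0 ≤ g x y := fun x y => by simp only [hg]; split_ifs <;> norm_num
  have e1 : instExp N M k ρ T (fun y => ∑ x : Cube N, g x y *
        (if AllSat x (y (τ i.castSucc + n)) then 1 else 0)) =
      instExp N M k ρ T (fun y => ∑ x : Cube N, g x y *
        (noise (Fin M) (Fin k → Literal N) (ρ ^ n)).mulVec
          (fun y => if AllSat x y then 1 else 0) (y (τ i.castSucc))) := by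
    rw [instExp, pathExp_sum, instExp, pathExp_sum]
    refine Finset.sum_congr rfl fun x _ => ?_
    rw [← noise_pow]
    exact pathExp_markov (noise_sum ρ) hT (hgdep x) fun y => if AllSat x y then 1 else 0
  rw [e1]
  refine (instExp_mono h0 h1 T fun y => ?_).trans_eq (instExp_const hN ρ T _)
  have hcnt := card_condEntropy_le (pattern (fun j => f (y (τ j))) i.succ) b
  rw [Fintype.card_fun, Fintype.card_units_int, Fintype.card_fin] at hcnt
  calc _ ≤ ∑ x : Cube N, g x y * q := Finset.sum_le_sum fun x _ =>
        mul_le_mul_of_nonneg_left (noise_mulVec_allSat_le hN hρ0 hρ1 x _) (hg0 x y)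
    _ = ((Finset.univ.filter fun x : Cube N =>
          condEntropy (pattern (fun j => f (y (τ j))) i.succ) x ≤ b).card : ℝ) * q := by
        rw [← Finset.sum_mul]
        simp only [hg]
        rw [← Finset.sum_filter, Finset.sum_const, nsmul_eq_mul, mul_one]
    _ ≤ _ := mul_le_mul_of_nonneg_right hcnt hq0

/-- The first moment bound for sequences of satisfying assignments with prescribed conditional
entropies. -/
theorem instExp_sequences_le (hN : N ≠ 0) (hk : k ≠ 0) {ρ : ℝ} (h0 : 0 ≤ ρ) (h1 : ρ ≤ 1)
    {l L b' b : ℝ} (hl : 0 ≤ l) (hL : 1 ≤ L) {τ : Fin (m + 1) → ℕ} (hτ : Monotone τ) {T : ℕ}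
    (hT : ∀ i, τ i ≤ T) :
    instExp N M k ρ T (fun y => ∑ X : Fin (m + 1) → Cube N,
      if (∀ i, i ≠ 0 → b' ≤ condEntropy (pattern X i) (X i) ∧
        condEntropy (pattern X i) (X i) ≤ b) ∧ ∀ i, AllSat (X i) (y (τ i)) then (1 : ℝ) else 0) ≤
      (2 ^ N * ((N + 1) ^ (2 ^ (m + 1)) * Real.exp (N * b)) ^ m) *
        Real.exp (-(M * (m * (1 / 2) ^ k * (1 - overlapBound k m l L b' - m * (1 / 2) ^ k)))) := by
  classical
  have : NeZero N := ⟨hN⟩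
  set u : ℝ := m * (1 / 2) ^ k * (1 - overlapBound k m l L b' - m * (1 / 2) ^ k) with hu
  set W : Finset (Fin (m + 1) → Cube N) := Finset.univ.filter fun X =>
    ∀ i, i ≠ 0 → b' ≤ condEntropy (pattern X i) (X i) ∧ condEntropy (pattern X i) (X i) ≤ b
    with hW
  have e1 : (fun y : ℕ → Fin M → Fin k → Literal N => ∑ X : Fin (m + 1) → Cube N,
      if (∀ i, i ≠ 0 → b' ≤ condEntropy (pattern X i) (X i) ∧
        condEntropy (pattern X i) (X i) ≤ b) ∧ ∀ i, AllSat (X i) (y (τ i)) then (1 : ℝ) else 0) =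
      fun y => ∑ X ∈ W, ∏ a, (fun (_ : Fin M) (z : ℕ → Fin k → Literal N) =>
        if ∀ i, ¬ Violates (z (τ i)) (X i) then (1 : ℝ) else 0) a fun t => y t a := by
    funext y
    rw [hW, Finset.sum_filter]
    refine Finset.sum_congr rfl fun X _ => ?_
    by_cases hX : ∀ i, i ≠ 0 → b' ≤ condEntropy (pattern X i) (X i) ∧
        condEntropy (pattern X i) (X i) ≤ b
    · rw [if_pos hX]
      rw [Finset.prod_ite_zero]
      by_cases h : ∀ i, AllSat (X i) (y (τ i))
      · rw [if_pos ⟨hX, h⟩, if_pos fun a _ i => h i a]; simp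
      · rw [if_neg fun h' => h h'.2, if_neg fun h' => h fun i a => h' a (Finset.mem_univ a) i]
    · rw [if_neg hX, if_neg fun h => hX h.1]
  rw [e1, instExp, pathExp_sum]
  have hX : ∀ X ∈ W, pathExp (fun _ : Fin M → Fin k → Literal N =>
      ∏ _a : Fin M, (Fintype.card (Fin k → Literal N) : ℝ)⁻¹)
      (noise (Fin M) (Fin k → Literal N) ρ) T (fun y => ∏ a,
        (fun (_ : Fin M) (z : ℕ → Fin k → Literal N) =>
        if ∀ i, ¬ Violates (z (τ i)) (X i) then (1 : ℝ) else 0) a fun t => y t a) ≤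
        Real.exp (-(M * u)) := by
    intro X hX
    -- For a fixed sequence `X` the `M` clause chains are independent, so the probability is the
    -- `M`-th power of the one-clause bound.
    have h2 := pathExp_pi (ι := Fin M) (fun _ => (Fintype.card (Fin k → Literal N) : ℝ)⁻¹)
      (resample (Fin k → Literal N) ρ) T (fun (_ : Fin M) (z : ℕ → Fin k → Literal N) =>
        if ∀ i, ¬ Violates (z (τ i)) (X i) then (1 : ℝ) else 0)
    refine (le_of_eq h2).trans ?_
    rw [Finset.prod_const, Finset.card_univ, Fintype.card_fin]
    simp only [hW, Finset.mem_filter, Finset.mem_univ, true_and] at hX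
    rw [← mul_neg, Real.exp_nat_mul]
    refine pow_le_pow_left₀ ?_ ((pathExp_clause_le hN h0 h1 X hτ hT fun i hi =>
      sum_violates_and_earlier_le hk X i hl hL (hX i hi).1).trans ?_) M
    swap
    · rw [← hu]; linarith [Real.add_one_le_exp (-u)]
    have h3 := pathExp_mono (π := fun _ => (Fintype.card (Fin k → Literal N) : ℝ)⁻¹)
      (K := resample (Fin k → Literal N) ρ) (fun _ => by positivity) (resample_nonneg h0 h1) T
      (F := fun _ => 0 * 1) (G := fun z => if ∀ i, ¬ Violates (z (τ i)) (X i) then (1 : ℝ) else 0)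
      (fun z => by split_ifs <;> norm_num)
    rw [pathExp_const_mul, zero_mul] at h3
    exact h3
  refine (Finset.sum_le_sum hX).trans ?_
  rw [Finset.sum_const, nsmul_eq_mul]
  refine mul_le_mul_of_nonneg_right (le_trans ?_ (card_sequences_le N m b)) (Real.exp_nonneg _)
  rw [Nat.cast_le]
  refine Finset.card_le_card fun X hX => ?_
  simp only [hW, Finset.mem_filter, Finset.mem_univ, true_and] at hX ⊢
  exact fun i hi => (hX i hi).2

/-- The probability that an assignment rule stays satisfying and stable along the resampling
chain. -/
theorem instExp_prod_stablePair_le (hN : N ≠ 0) (hk : k ≠ 0) {ρ : ℝ} (h0 : 0 ≤ ρ) (h1 : ρ ≤ 1)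
    (f : (Fin M → Fin k → Literal N) → Cube N) {l L b' b η : ℝ} (hl : 0 ≤ l) (hL : 1 ≤ L)
    (hb : 0 ≤ b) {T T₀ : ℕ} (hT : m * T₀ ≤ T) (hT1 : 1 ≤ T)
    (hη : ∀ (p : Fin N → Fin (m + 1) → ℤˣ) (x x' : Cube N), (hammingDist x x' : ℝ) ≤ η * N →
      condEntropy p x' - condEntropy p x ≤ b - b') :
    instExp N M k ρ T (fun y => ∏ t ∈ Finset.range T, stablePair f η (y t) (y (t + 1))) ≤
      (T + 1) ^ (m + 1) * (m * (((N + 1) ^ (2 ^ (m + 1)) * Real.exp (N * b)) *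
          (1 - (1 - ρ ^ T₀) * (1 / 2) ^ k) ^ M) +
        (2 ^ N * ((N + 1) ^ (2 ^ (m + 1)) * Real.exp (N * b)) ^ m) *
        Real.exp (-(M * (m * (1 / 2) ^ k *
          (1 - overlapBound k m l L b' - m * (1 / 2) ^ k))))) := by
  classical
  have : NeZero N := ⟨hN⟩
  set E₁ : ℝ := ((N + 1) ^ (2 ^ (m + 1)) * Real.exp (N * b)) *
    (1 - (1 - ρ ^ T₀) * (1 / 2) ^ k) ^ M with hE₁
  set E₂ : ℝ := (2 ^ N * ((N + 1) ^ (2 ^ (m + 1)) * Real.exp (N * b)) ^ m) *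
    Real.exp (-(M * (m * (1 / 2) ^ k * (1 - overlapBound k m l L b' - m * (1 / 2) ^ k)))) with hE₂
  have hE₁0 : 0 ≤ E₁ := by
    have hρ1 : ρ ^ T₀ ≤ 1 := pow_le_one₀ h0 h1
    have hρ0 : 0 ≤ ρ ^ T₀ := pow_nonneg h0 _
    have hk1 : (1 / 2 : ℝ) ^ k ≤ 1 := pow_le_one₀ (by norm_num) (by norm_num)
    have hk0 : (0 : ℝ) ≤ (1 / 2) ^ k := by positivity
    have : 0 ≤ 1 - (1 - ρ ^ T₀) * (1 / 2) ^ k := by nlinarith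
    rw [hE₁]; positivity
  have hE₂0 : 0 ≤ E₂ := by rw [hE₂]; positivity
  let near : (Fin (m + 1) → Fin (T + 1)) → Fin m → (ℕ → Fin M → Fin k → Literal N) → ℝ :=
    fun τ i y => ∑ x : Cube N,
      (if condEntropy (pattern (fun j => f (y (τ j : ℕ))) i.succ) x ≤ b then (1 : ℝ) else 0) *
        (if AllSat x (y ((τ i.castSucc : ℕ) + T₀)) then 1 else 0)
  let seq : (Fin (m + 1) → Fin (T + 1)) → (ℕ → Fin M → Fin k → Literal N) → ℝ :=
    fun τ y => ∑ X : Fin (m + 1) → Cube N,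
      if (∀ i, i ≠ 0 → b' ≤ condEntropy (pattern X i) (X i) ∧
        condEntropy (pattern X i) (X i) ≤ b) ∧ ∀ i, AllSat (X i) (y (τ i : ℕ)) then (1 : ℝ) else 0
  let Mon : Finset (Fin (m + 1) → Fin (T + 1)) := Finset.univ.filter Monotone
  let I : (Fin (m + 1) → Fin (T + 1)) → Finset (Fin m) := fun τ =>
    Finset.univ.filter fun i => (τ i.castSucc : ℕ) + T₀ ≤ T
  have hnear0 : ∀ τ i y, 0 ≤ near τ i y := fun τ i y => Finset.sum_nonneg fun x _ => by
    split_ifs <;> norm_num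
  have hseq0 : ∀ τ y, 0 ≤ seq τ y := fun τ y => Finset.sum_nonneg fun x _ => by
    split_ifs <;> norm_num
  have hcol0 : ∀ y, ∀ τ ∈ Mon, 0 ≤ ∑ i ∈ I τ, near τ i y + seq τ y := fun y τ _ =>
    add_nonneg (Finset.sum_nonneg fun i _ => hnear0 τ i y) (hseq0 τ y)
  have hpt : ∀ y : ℕ → Fin M → Fin k → Literal N,
      ∏ t ∈ Finset.range T, stablePair f η (y t) (y (t + 1)) ≤
        ∑ τ ∈ Mon, (∑ i ∈ I τ, near τ i y + seq τ y) := by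
    intro y
    by_cases hgood : ∀ t ∈ Finset.range T, AllSat (f (y t)) (y t) ∧
        AllSat (f (y (t + 1))) (y (t + 1)) ∧
        (hammingDist (f (y t)) (f (y (t + 1))) : ℝ) ≤ η * N
    swap
    · push Not at hgood
      obtain ⟨t, ht, hbad⟩ := hgood
      rw [Finset.prod_eq_zero ht (if_neg fun h => absurd (hbad h.1 h.2.1) (not_lt.2 h.2.2))]
      exact Finset.sum_nonneg (hcol0 y)
    rw [Finset.prod_eq_one (f := fun t => stablePair f η (y t) (y (t + 1)))
      fun t ht => if_pos (hgood t ht)]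
    have hsat : ∀ t ≤ T, AllSat (f (y t)) (y t) := by
      intro t ht
      rcases Nat.lt_or_ge t T with h | h
      · exact (hgood t (Finset.mem_range.2 h)).1
      · obtain ⟨t', rfl⟩ := Nat.exists_eq_succ_of_ne_zero (show t ≠ 0 by omega)
        exact (hgood t' (Finset.mem_range.2 (by omega))).2.1
    -- The dichotomy: if no low-entropy satisfying assignment survives `T₀` steps, the path visits a
    -- windowed sequence; otherwise a `near` term is at least `1`. The union over times costs at
    -- most `(T + 1) ^ (m + 1)`.
    by_cases hfar : ∀ τ ∈ Mon, ∀ i ∈ I τ, b < condEntropy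
        (pattern (fun j => f (y (τ j : ℕ))) i.succ) (f (y ((τ i.castSucc : ℕ) + T₀)))
    · obtain ⟨τ, hmono, hle, hwin⟩ := exists_times (x := fun t => f (y t)) hb hη
        (fun t ht => (hgood t (Finset.mem_range.2 ht)).2.2) hT (fun τ hτ hle i hi =>
          hfar (fun j => ⟨τ j, Nat.lt_succ_of_le (hle j)⟩)
            (Finset.mem_filter.2 ⟨Finset.mem_univ _, fun i j hij => hτ hij⟩) i
            (Finset.mem_filter.2 ⟨Finset.mem_univ _, hi⟩))
      let τ' : Fin (m + 1) → Fin (T + 1) := fun j => ⟨τ j, Nat.lt_succ_of_le (hle j)⟩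
      have hτ' : τ' ∈ Mon := Finset.mem_filter.2 ⟨Finset.mem_univ _, fun i j hij => hmono hij⟩
      refine le_trans ?_ (Finset.single_le_sum (hcol0 y) hτ')
      have h3 : 1 ≤ seq τ' y := by
        refine le_trans ?_ (Finset.single_le_sum (fun X _ => ?_)
          (Finset.mem_univ (fun j => f (y (τ j)))))
        · rw [if_pos ⟨hwin, fun i => hsat _ (hle i)⟩]
        · split_ifs <;> norm_num
      have := Finset.sum_nonneg (s := I τ') fun i _ => hnear0 τ' i y
      linarith
    · push Not at hfar
      obtain ⟨τ, hτ, i, hi, hlow⟩ := hfar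
      refine le_trans ?_ (Finset.single_le_sum (hcol0 y) hτ)
      have h3 : 1 ≤ near τ i y := by
        refine le_trans ?_ (Finset.single_le_sum (fun x _ => ?_)
          (Finset.mem_univ (f (y ((τ i.castSucc : ℕ) + T₀)))))
        · rw [if_pos hlow, if_pos (hsat _ (Finset.mem_filter.1 hi).2), mul_one]
        · split_ifs <;> norm_num
      have h4 := Finset.single_le_sum (fun i _ => hnear0 τ i y) hi
      have := hseq0 τ y
      linarith
  refine (instExp_mono h0 h1 T hpt).trans ?_
  rw [instExp, pathExp_sum]
  have hτ : ∀ τ ∈ Mon, instExp N M k ρ T (fun y => ∑ i ∈ I τ, near τ i y + seq τ y) ≤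
      m * E₁ + E₂ := by
    intro τ hτ
    have hmono : Monotone fun j => (τ j : ℕ) := fun i j hij => (Finset.mem_filter.1 hτ).2 hij
    rw [instExp, pathExp_add, pathExp_sum]
    refine add_le_add ?_ (instExp_sequences_le hN hk h0 h1 hl hL hmono fun i =>
      Nat.le_of_lt_succ (τ i).2)
    refine (Finset.sum_le_sum fun i hi => instExp_near_le hN h0 h1 f b hmono i
      (Finset.mem_filter.1 hi).2).trans ?_
    rw [Finset.sum_const, nsmul_eq_mul]
    refine mul_le_mul_of_nonneg_right ?_ hE₁0
    rw [Nat.cast_le]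
    exact (Finset.card_le_univ _).trans_eq (Fintype.card_fin m)
  refine (Finset.sum_le_sum hτ).trans ?_
  rw [Finset.sum_const, nsmul_eq_mul]
  refine mul_le_mul_of_nonneg_right ?_ (by positivity)
  have : Mon.card ≤ (T + 1) ^ (m + 1) := (Finset.card_le_univ _).trans_eq (by
    rw [Fintype.card_fun, Fintype.card_fin, Fintype.card_fin])
  exact_mod_cast this

end Path

/-- An assignment rule that is satisfying and stable on a noise-correlated pair with probability
`γ` is so along the whole resampling chain with probability at least `γ ^ T`. -/
theorem pow_le_instExp_prod {N M k : ℕ} (hN : N ≠ 0) (ρ : ℝ)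
    {w : Matrix (Fin M → Fin k → Literal N) (Fin M → Fin k → Literal N) ℝ}
    (hw : w.transpose = w) {γ : ℝ} (hγ : 0 ≤ γ)
    (h : γ * Fintype.card (Fin M → Fin k → Literal N) ≤
      ∑ y, ∑ y', noise (Fin M) (Fin k → Literal N) ρ y y' * w y y') (n : ℕ) :
    γ ^ (2 ^ n) ≤ instExp N M k ρ (2 ^ n)
      (fun y => ∏ t ∈ Finset.range (2 ^ n), w (y t) (y (t + 1))) := by
  have : NeZero N := ⟨hN⟩
  set W : Matrix (Fin M → Fin k → Literal N) (Fin M → Fin k → Literal N) ℝ :=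
    Matrix.of fun s s' => noise (Fin M) (Fin k → Literal N) ρ s s' * w s s' with hW
  have hWt : W.transpose = W := by
    ext y y'
    change noise _ _ ρ y' y * w y' y = noise _ _ ρ y y' * w y y'
    rw [show w y' y = w y y' from congrFun (congrFun hw y) y',
      show noise (Fin M) (Fin k → Literal N) ρ y' y = noise _ _ ρ y y' from
        congrFun (congrFun (noise_transpose ρ) y) y']
  have h1 := pow_mean_le_mean_pow hWt hγ (by
    simpa [dotProduct, Matrix.mulVec, hW] using h) n
  have h2 := pathExp_prod (π := fun _ : Fin M → Fin k → Literal N =>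
    ∏ _a : Fin M, (Fintype.card (Fin k → Literal N) : ℝ)⁻¹)
    (K := noise (Fin M) (Fin k → Literal N) ρ) w (2 ^ n) 1
  simp only [Pi.one_apply, mul_one] at h2
  rw [instExp, h2]
  have hc : (Fintype.card (Fin M → Fin k → Literal N) : ℝ) ≠ 0 := by
    exact_mod_cast Fintype.card_ne_zero
  have h3 : (fun _ : Fin M → Fin k → Literal N =>
      ∏ _a : Fin M, (Fintype.card (Fin k → Literal N) : ℝ)⁻¹) =
      (Fintype.card (Fin M → Fin k → Literal N) : ℝ)⁻¹ • (1 : (Fin M → Fin k → Literal N) → ℝ) := by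
    ext y
    rw [Finset.prod_const, Finset.card_univ, Fintype.card_fun (α := Fin M), Nat.cast_pow, inv_pow]
    simp
  rw [h3, smul_dotProduct, smul_eq_mul, inv_mul_eq_div, le_div_iff₀ (by positivity)]
  exact h1

theorem stablePair_transpose {N M k : ℕ} (f : (Fin M → Fin k → Literal N) → Cube N) (η : ℝ) :
    (stablePair f η).transpose = stablePair f η := by
  ext y y'
  simp only [Matrix.transpose_apply, stablePair, hammingDist_comm (f y') (f y)]
  exact if_congr (by tauto) rfl rfl

/-! ### Choice of parameters -/

/-- The scales are `b = β log k / k`, `b' = (1 - s) b`, `L = (1 + s) log k` and `l = log β / log k`.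
Then `k ^ l = β`, `l L` does not depend on `k`, and the tail `2 L exp (-L)` is `o(log k / k)`. The
small `s > 0` pays for the window and for this tail. -/
theorem exists_parameters {κ : ℝ} (hκ : kappaStar < κ) : ∃ k₀ : ℕ, ∀ k : ℕ, k₀ ≤ k →
    ∃ (m : ℕ) (l L b' b : ℝ), k ≠ 0 ∧ 0 ≤ l ∧ 1 ≤ L ∧ b' < b ∧ 0 ≤ b ∧
      b < κ * 2 ^ k * Real.log k / k * (1 / 2) ^ k ∧
      Real.log 2 + m * b < κ * 2 ^ k * Real.log k / k *
        (m * (1 / 2) ^ k * (1 - overlapBound k m l L b' - m * (1 / 2) ^ k)) := by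
  obtain ⟨_, ⟨β, hβ, rfl⟩, hβκ⟩ := exists_lt_of_csInf_lt
    ((Set.nonempty_Ioi (a := (1 : ℝ))).image _) hκ
  simp only at hβκ
  have hβ1 : 1 < β := hβ
  have hβ0 : 0 < β := by linarith
  have hden : 0 < 1 - β * Real.exp (-(β - 1)) := by
    have h := Real.add_one_lt_exp (show β - 1 ≠ 0 by linarith)
    rw [Real.exp_neg, sub_pos, ← div_eq_mul_inv, div_lt_one (Real.exp_pos _)]
    linarith
  rw [div_lt_iff₀ hden] at hβκ
  have hκ0 : 0 < κ := by
    by_contra h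
    push Not at h
    nlinarith
  have hβltκ : β < κ := by
    have : 0 < β * Real.exp (-(β - 1)) := by positivity
    nlinarith
  set g := κ * (1 - β * Real.exp (-(β - 1))) - β with hg
  have hg0 : 0 < g := by linarith
  -- The limiting exponent in the overlap. At `s = 0` it equals `(1 - 1 / β) * β = β - 1`, where the
  -- target inequality has slack `g`; continuity keeps slack `g / 2` for small `s`.
  let A : ℝ → ℝ := fun s => (1 - Real.exp (-((1 + s) * Real.log β))) / (1 + s) * ((1 - s) * β)
  have hA0 : A 0 = β - 1 := by
    simp only [A, add_zero, one_mul, Real.exp_neg, Real.exp_log hβ0]; field_simp; ring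
  obtain ⟨s, hs0, hs1, hs⟩ : ∃ s : ℝ, 0 < s ∧ s < 1 ∧
      g / 2 < κ * (1 - β * Real.exp (-(A s))) - β := by
    have hcont : ContinuousAt (fun s => κ * (1 - β * Real.exp (-(A s))) - β) 0 := by
      have : ContinuousAt A 0 := by
        refine ContinuousAt.mul (ContinuousAt.div ?_ ?_ (by norm_num)) ?_ <;> fun_prop
      fun_prop
    have h1 : ∀ᶠ s in 𝓝 (0 : ℝ), g / 2 < κ * (1 - β * Real.exp (-(A s))) - β := by
      refine hcont.eventually (lt_mem_nhds ?_)
      beta_reduce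
      rw [hA0, ← hg]; linarith
    have h2 : ∀ᶠ s in 𝓝[>] (0 : ℝ), g / 2 < κ * (1 - β * Real.exp (-(A s))) - β :=
      h1.filter_mono nhdsWithin_le_nhds
    obtain ⟨s, h3, h4, h5⟩ := (h2.and (Ioo_mem_nhdsGT (show (0 : ℝ) < 1 by norm_num))).exists
    exact ⟨s, h4, h5, h3⟩
  -- Each of the `m` later assignments gains at least `(log k / k) * (g / 2)`; with `4 / g * (k /
  -- log k)` of them the total is at least `2 > log 2`, which pays for the first assignment, while
  -- `m / k` still tends to `0`.
  let m : ℕ → ℕ := fun k => ⌈4 / g * (k / Real.log k)⌉₊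
  let x : ℕ → ℝ := fun k => (1 - Real.exp (-((1 + s) * Real.log β))) / (1 + s) *
    ((1 - s) * β - 2 * (1 + s) * (k : ℝ) ^ (-s))
  have hlog : Tendsto (fun k : ℕ => Real.log k) atTop atTop :=
    Real.tendsto_log_atTop.comp tendsto_natCast_atTop_atTop
  have hx : Tendsto x atTop (𝓝 (A s)) := by
    have h1 : Tendsto (fun k : ℕ => (k : ℝ) ^ (-s)) atTop (𝓝 0) :=
      (tendsto_rpow_neg_atTop hs0).comp tendsto_natCast_atTop_atTop
    have h2 := ((h1.const_mul (2 * (1 + s))).const_sub ((1 - s) * β)).const_mul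
      ((1 - Real.exp (-((1 + s) * Real.log β))) / (1 + s))
    simpa [A, x] using h2
  have hm : Tendsto (fun k : ℕ => (m k : ℝ) / k) atTop (𝓝 0) := by
    have h1 : Tendsto (fun k : ℕ => 4 / g * (Real.log k)⁻¹ + (k : ℝ)⁻¹) atTop (𝓝 0) := by
      simpa using ((tendsto_inv_atTop_zero.comp hlog).const_mul (4 / g)).add
        (tendsto_inv_atTop_zero.comp tendsto_natCast_atTop_atTop)
    refine squeeze_zero' (Eventually.of_forall fun k => by positivity) ?_ h1
    filter_upwards [hlog.eventually_gt_atTop 0, eventually_gt_atTop 0] with k hk hk0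
    have hk0' : (0 : ℝ) < k := by exact_mod_cast hk0
    rw [div_le_iff₀ hk0']
    refine (Nat.ceil_lt_add_one (by positivity)).le.trans (le_of_eq ?_)
    field_simp
  have hm2 : Tendsto (fun k : ℕ => (m k : ℝ) * (1 / 2) ^ k) atTop (𝓝 0) := by
    have h1 : Tendsto (fun k : ℕ => (k : ℝ) * (1 / 2) ^ k) atTop (𝓝 0) :=
      tendsto_self_mul_const_pow_of_lt_one (by norm_num) (by norm_num)
    have h2 := hm.mul h1
    rw [mul_zero] at h2
    refine h2.congr' ?_
    filter_upwards [eventually_gt_atTop 0] with k hk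
    have hk0' : (0 : ℝ) < k := by exact_mod_cast hk
    field_simp
  have hlim : Tendsto (fun k : ℕ => κ * (1 - ((m k : ℝ) / k + β * Real.exp (-(x k))) -
      (m k : ℝ) * (1 / 2) ^ k) - β) atTop (𝓝 (κ * (1 - β * Real.exp (-(A s))) - β)) := by
    have h1 := (Real.continuous_exp.tendsto _).comp hx.neg
    have h2 := (((((hm.add (h1.const_mul β)).const_sub 1).sub hm2).const_mul κ).sub_const β)
    simpa using h2
  have hev : ∀ᶠ k : ℕ in atTop, k ≠ 0 ∧ 1 ≤ Real.log k ∧ β ≤ k ∧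
      g / 2 < κ * (1 - ((m k : ℝ) / k + β * Real.exp (-(x k))) - (m k : ℝ) * (1 / 2) ^ k) - β := by
    filter_upwards [eventually_gt_atTop 0, hlog.eventually_ge_atTop 1,
      tendsto_natCast_atTop_atTop.eventually_ge_atTop β, hlim.eventually (lt_mem_nhds hs)]
      with k h1 h2 h3 h4
    exact ⟨h1.ne', h2, h3, h4⟩
  obtain ⟨k₀, hk₀⟩ := eventually_atTop.1 hev
  refine ⟨k₀, fun k hk => ?_⟩
  obtain ⟨hk0, hlk, hkβ, hgap⟩ := hk₀ k hk
  have hk' : (0 : ℝ) < k := by positivity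
  have hlk0 : 0 < Real.log k := by linarith
  have hlb : 0 < Real.log β := Real.log_pos hβ1
  have hb0 : 0 < β * Real.log k / k := by positivity
  have h2k : κ * 2 ^ k * Real.log k / k * (1 / 2) ^ k = κ * Real.log k / k := by
    rw [one_div, inv_pow]; field_simp
  refine ⟨m k, Real.log β / Real.log k, (1 + s) * Real.log k, (1 - s) * (β * Real.log k / k),
    β * Real.log k / k, hk0, by positivity, by nlinarith, by nlinarith, hb0.le, ?_, ?_⟩
  · rw [h2k]; gcongr
  have hQ : overlapBound k (m k) (Real.log β / Real.log k) ((1 + s) * Real.log k)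
      ((1 - s) * (β * Real.log k / k)) ≤ (m k : ℝ) / k + β * Real.exp (-(x k)) := by
    unfold overlapBound
    have e1 : (k : ℝ) ^ (Real.log β / Real.log k) = β := by
      rw [Real.rpow_def_of_pos hk', mul_div_cancel₀ _ hlk0.ne', Real.exp_log hβ0]
    have e2 : Real.log β / Real.log k * ((1 + s) * Real.log k) = (1 + s) * Real.log β := by
      field_simp
    have e3 : Real.exp (-((1 + s) * Real.log k)) = (k : ℝ) ^ (-s) / k := by
      rw [Real.rpow_def_of_pos hk', div_eq_mul_inv]
      nth_rewrite 3 [← Real.exp_log hk']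
      rw [← Real.exp_neg, ← Real.exp_add]
      congr 1; ring
    have e4 : (1 : ℝ) - (1 - Real.exp (-((1 + s) * Real.log β))) / ((1 + s) * Real.log k) *
        ((1 - s) * (β * Real.log k / k) - 2 * ((1 + s) * Real.log k * ((k : ℝ) ^ (-s) / k))) =
        1 + (-(x k)) / k := by
      simp only [x]
      have : 1 + s ≠ 0 := by positivity
      field_simp
      ring
    rw [e1, e2, e3, e4]
    have hxβ : x k ≤ β := by
      have h1 : (1 - Real.exp (-((1 + s) * Real.log β))) / (1 + s) ≤ 1 := by
        rw [div_le_one (by positivity)]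
        linarith [Real.exp_pos (-((1 + s) * Real.log β))]
      have h0 : 0 ≤ (1 - Real.exp (-((1 + s) * Real.log β))) / (1 + s) := by
        refine div_nonneg (sub_nonneg.2 (Real.exp_le_one_iff.2 ?_)) (by positivity)
        have : 0 < (1 + s) * Real.log β := by positivity
        linarith
      have h2 : (1 - s) * β - 2 * (1 + s) * (k : ℝ) ^ (-s) ≤ β := by
        have : 0 ≤ 2 * (1 + s) * (k : ℝ) ^ (-s) := by positivity
        nlinarith
      calc x k ≤ (1 - Real.exp (-((1 + s) * Real.log β))) / (1 + s) * β :=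
            mul_le_mul_of_nonneg_left h2 h0
        _ ≤ 1 * β := mul_le_mul_of_nonneg_right h1 hβ0.le
        _ = β := one_mul β
    -- The bound `(1 - x / k) ^ k ≤ exp (-x)` needs `x ≤ k`, which follows from `x ≤ β ≤ k`.
    have h5 := one_add_div_pow_le_exp k hk0 (-(x k)) (by
      rw [neg_div, ← sub_eq_add_neg, sub_nonneg, div_le_one hk']; linarith)
    have := mul_le_mul_of_nonneg_left h5 hβ0.le
    linarith
  have hmk : 4 / g ≤ m k * (Real.log k / k) := by
    have := Nat.le_ceil (4 / g * (k / Real.log k))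
    calc 4 / g = 4 / g * (k / Real.log k) * (Real.log k / k) := by field_simp
      _ ≤ _ := mul_le_mul_of_nonneg_right this (by positivity)
  have h6 : κ * 2 ^ k * Real.log k / k * (m k * (1 / 2) ^ k *
      (1 - overlapBound k (m k) (Real.log β / Real.log k) ((1 + s) * Real.log k)
        ((1 - s) * (β * Real.log k / k)) - m k * (1 / 2) ^ k)) - m k * (β * Real.log k / k) =
      m k * (Real.log k / k) * (κ * (1 - overlapBound k (m k) (Real.log β / Real.log k)
        ((1 + s) * Real.log k) ((1 - s) * (β * Real.log k / k)) - m k * (1 / 2) ^ k) - β) := by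
    linear_combination (m k * (1 - overlapBound k (m k) (Real.log β / Real.log k)
      ((1 + s) * Real.log k) ((1 - s) * (β * Real.log k / k)) - m k * (1 / 2) ^ k)) * h2k
  have h7 : g / 2 ≤ κ * (1 - overlapBound k (m k) (Real.log β / Real.log k)
        ((1 + s) * Real.log k) ((1 - s) * (β * Real.log k / k)) - m k * (1 / 2) ^ k) - β := by
    have := mul_le_mul_of_nonneg_left hQ hκ0.le
    linarith
  have h8 := mul_le_mul hmk h7 (by positivity) (by positivity)
  have h9 : 4 / g * (g / 2) = 2 := by field_simp; norm_num
  have h10 : Real.log 2 < 1 := by linarith [Real.log_two_lt_d9]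
  linarith

/-! ### Laws of the instance and of the thresholds -/

theorem instanceLaw_singleton {N M k : ℕ} (y : Instance N M k) :
    instanceLaw N M k {y} = (Fintype.card (Instance N M k) : ℝ≥0∞)⁻¹ := by
  rw [instanceLaw, Measure.pi_singleton]
  simp only [uniformOn_univ, Measure.count_singleton, one_div, Finset.prod_const]
  rw [Fintype.card_fun, Nat.cast_pow, ENNReal.inv_pow, Finset.card_univ]

instance isProbabilityMeasure_uniformIcc :
    IsProbabilityMeasure (cond volume (Set.Icc (-1 : ℝ) 1)) :=
  cond_isProbabilityMeasure_of_finite (by rw [Real.volume_Icc]; norm_num)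
    (by rw [Real.volume_Icc]; exact ENNReal.ofReal_ne_top)

instance (N : ℕ) : IsProbabilityMeasure (thresholdLaw N) := by
  unfold thresholdLaw; infer_instance

theorem cond_Ioc_le (a b : ℝ) :
    cond volume (Set.Icc (-1 : ℝ) 1) (Set.Ioc a b) ≤ ENNReal.ofReal (b - a) := by
  rw [cond_apply measurableSet_Icc, Real.volume_Icc]
  calc _ ≤ 1 * volume (Set.Ioc a b) := by
        gcongr
        · rw [ENNReal.inv_le_one, ← ENNReal.ofReal_one]
          exact ENNReal.ofReal_le_ofReal (by norm_num)
        · exact Set.inter_subset_right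
    _ = _ := by rw [one_mul, Real.volume_Ioc]

theorem thresholdLaw_separates_le {N : ℕ} (i : Fin N) (a b : ℝ) :
    thresholdLaw N {u | ¬ (u i ≤ a ↔ u i ≤ b)} ≤ ENNReal.ofReal |a - b| := by
  have h : ∀ a b : ℝ, a ≤ b → thresholdLaw N {u | ¬ (u i ≤ a ↔ u i ≤ b)} ≤
      ENNReal.ofReal |a - b| := by
    intro a b hab
    have hset : {u : Fin N → ℝ | ¬ (u i ≤ a ↔ u i ≤ b)} = Function.eval i ⁻¹' Set.Ioc a b := by
      ext u
      simp only [Set.mem_ofPred_eq, Set.mem_preimage, Function.eval, Set.mem_Ioc]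
      constructor
      · intro h
        by_cases h1 : u i ≤ a
        · exact absurd (iff_of_true h1 (h1.trans hab)) h
        · refine ⟨not_le.1 h1, ?_⟩
          by_contra h2
          exact h (iff_of_false h1 h2)
      · rintro ⟨h1, h2⟩ h
        exact absurd (h.2 h2) (not_le.2 h1)
    rw [hset, thresholdLaw, (measurePreserving_eval _ i).measure_preimage
      measurableSet_Ioc.nullMeasurableSet, abs_sub_comm, abs_of_nonneg (sub_nonneg.2 hab)]
    exact cond_Ioc_le a b
  rcases le_total a b with hab | hab
  · exact h a b hab
  · have := h b a hab
    rw [abs_sub_comm] at this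
    simpa only [iff_comm] using this

/-- The probability that a common uniform threshold separates two random variables. -/
theorem prod_thresholdLaw_separates_le {N : ℕ} {Ω : Type*} [MeasurableSpace Ω] (P : Measure Ω)
    [IsProbabilityMeasure P] (i : Fin N) {z z' : Ω → ℝ} (hz : Measurable z) (hz' : Measurable z')
    (hint : Integrable (fun ω => (z ω - z' ω) ^ 2) P) {θ : ℝ} (hθ : 0 < θ) :
    (P.prod (thresholdLaw N)).real {w | ¬ (w.2 i ≤ z w.1 ↔ w.2 i ≤ z' w.1)} ≤
      ∫ ω, (θ + (z ω - z' ω) ^ 2 / θ) / 2 ∂P := by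
  have hm1 : MeasurableSet {w : Ω × (Fin N → ℝ) | w.2 i ≤ z w.1} :=
    measurableSet_le ((measurable_pi_apply i).comp measurable_snd) (hz.comp measurable_fst)
  have hm2 : MeasurableSet {w : Ω × (Fin N → ℝ) | w.2 i ≤ z' w.1} :=
    measurableSet_le ((measurable_pi_apply i).comp measurable_snd) (hz'.comp measurable_fst)
  have hm : MeasurableSet {w : Ω × (Fin N → ℝ) | ¬ (w.2 i ≤ z w.1 ↔ w.2 i ≤ z' w.1)} :=
    (hm1.iff hm2).compl
  have hint2 : Integrable (fun ω => (θ + (z ω - z' ω) ^ 2 / θ) / 2) P :=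
    (((integrable_const θ).add (hint.div_const θ)).div_const 2)
  have hnn : ∀ ω, 0 ≤ (θ + (z ω - z' ω) ^ 2 / θ) / 2 := fun ω => by positivity
  rw [Measure.real, Measure.prod_apply hm]
  refine ENNReal.toReal_le_of_le_ofReal (integral_nonneg hnn) ?_
  rw [ofReal_integral_eq_lintegral_ofReal hint2 (Eventually.of_forall hnn)]
  refine lintegral_mono fun ω => (thresholdLaw_separates_le i (z ω) (z' ω)).trans
    (ENNReal.ofReal_le_ofReal ?_)
  -- The weighted arithmetic–geometric mean inequality bounds `|z - z'|` by the square, keeping `θ`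
  -- free to be tuned.
  have h1 : (θ + (z ω - z' ω) ^ 2 / θ) / 2 - |z ω - z' ω| = (θ - |z ω - z' ω|) ^ 2 / (2 * θ) := by
    rw [← sq_abs (z ω - z' ω)]; field_simp; ring
  have h2 : 0 ≤ (θ - |z ω - z' ω|) ^ 2 / (2 * θ) := by positivity
  linarith

theorem integrable_comp_of_finite {W X : Type*} [MeasurableSpace W] [Fintype X] (Q : Measure W)
    [IsFiniteMeasure Q] {F : W → X} (hF : ∀ x, MeasurableSet (F ⁻¹' {x})) (h : X → ℝ) :
    Integrable (fun w => h (F w)) Q := by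
  classical
  have e : (fun w => h (F w)) = fun w => ∑ x, (F ⁻¹' {x}).indicator (fun _ => h x) w := by
    ext w
    rw [Finset.sum_eq_single (F w)]
    · simp
    · intro x _ hx
      rw [Set.indicator_of_notMem]
      simpa using hx.symm
    · simp
  rw [e]
  exact integrable_finsetSum _ fun x _ => (integrable_const (h x)).indicator (hF x)

/-! ### Fixing the internal randomness -/

section Derandomize

variable {N M k : ℕ} {W : Type*} [MeasurableSpace W]

/-- Markov's inequality in pointwise form: when both assignments satisfy but are far apart, the
subtracted quotient exceeds `1`. -/
theorem sub_le_stablePair (f : (Fin M → Fin k → Literal N) → Cube N) {η : ℝ} (hη : 0 < η)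
    (hN : N ≠ 0) (y y' : Fin M → Fin k → Literal N) :
    (if AllSat (f y) y then (1 : ℝ) else 0) * (if AllSat (f y') y' then 1 else 0) -
      hammingDist (f y) (f y') / (η * N) ≤ stablePair f η y y' := by
  have hN' : (0 : ℝ) < N := by positivity
  have h0 : (0 : ℝ) ≤ hammingDist (f y) (f y') / (η * N) := by positivity
  unfold stablePair
  split_ifs with h1 h2 h3 h3 h3 <;> simp only [mul_one, mul_zero, zero_sub] <;> try linarith
  have h4 : η * N < hammingDist (f y) (f y') := by
    by_contra h5
    exact h3 ⟨h1, h2, not_lt.1 h5⟩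
  have : 1 < (hammingDist (f y) (f y') : ℝ) / (η * N) := by rwa [one_lt_div (by positivity)]
  linarith

/-- A randomized assignment rule that is satisfying with probability `p` and stable under noise has
a realization that is satisfying and stable on a noise-correlated pair with probability close to
`p ^ 2`. -/
theorem exists_stable_realization (hN : N ≠ 0) (Q : Measure W) [IsProbabilityMeasure Q]
    {ρ : ℝ} (h0 : 0 ≤ ρ) (h1 : ρ ≤ 1) {η : ℝ} (hη : 0 < η)
    (F : W → (Fin M → Fin k → Literal N) → Cube N) (hF : ∀ x, MeasurableSet (F ⁻¹' {x}))
    {p R : ℝ} (hp : Fintype.card (Fin M → Fin k → Literal N) * p =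
      ∑ y, Q.real {w | AllSat (F w y) y})
    (hR : ∑ i, ∑ y, ∑ y', noise (Fin M) (Fin k → Literal N) ρ y y' *
      Q.real {w | F w y i ≠ F w y' i} ≤ Fintype.card (Fin M → Fin k → Literal N) * (N * R)) :
    ∃ w, (p ^ 2 - R / η) * Fintype.card (Fin M → Fin k → Literal N) ≤
      ∑ y, ∑ y', noise (Fin M) (Fin k → Literal N) ρ y y' * stablePair (F w) η y y' := by
  classical
  have : NeZero N := ⟨hN⟩
  have hN' : (0 : ℝ) < N := by positivity
  set c : ℝ := (Fintype.card (Fin M → Fin k → Literal N) : ℝ) with hc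
  have hc0 : 0 < c := by rw [hc]; exact_mod_cast Fintype.card_pos
  let K : (Fin M → Fin k → Literal N) → (Fin M → Fin k → Literal N) → ℝ := noise (Fin M) (Fin k → Literal N) ρ
  have hK0 : ∀ y y', 0 ≤ K y y' := noise_nonneg h0 h1
  let v : W → (Fin M → Fin k → Literal N) → ℝ := fun w y => if AllSat (F w y) y then 1 else 0
  let d : W → Fin N → (Fin M → Fin k → Literal N) → (Fin M → Fin k → Literal N) → ℝ := fun w i y y' => if F w y i ≠ F w y' i then 1 else 0
  have hint : ∀ h : ((Fin M → Fin k → Literal N) → Cube N) → ℝ, Integrable (fun w => h (F w)) Q := fun h =>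
    integrable_comp_of_finite Q hF h
  have hmeas : ∀ p : ((Fin M → Fin k → Literal N) → Cube N) → Prop, MeasurableSet {w | p (F w)} := by
    intro p
    have : {w | p (F w)} = ⋃ x ∈ {x | p x}, F ⁻¹' {x} := by ext w; simp
    rw [this]
    exact MeasurableSet.biUnion (Set.to_countable _) fun x _ => hF x
  have hind : ∀ (p : ((Fin M → Fin k → Literal N) → Cube N) → Prop) [DecidablePred p],
      ∫ w, (if p (F w) then (1 : ℝ) else 0) ∂Q = Q.real {w | p (F w)} := by
    intro p _
    rw [← integral_indicator_one (hmeas p)]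
    congr 1; ext w
    by_cases h : p (F w) <;> simp [h]
  -- Among correlated pairs the doubly satisfied ones number at least `S ^ 2 / c`, where `S` is the
  -- number of satisfied instances. Replacing `S ^ 2` by its tangent `2 t S - t ^ 2` at the mean `t
  -- = c p` makes the expectation linear, and some `w` does at least as well as the average.
  let g : W → ℝ := fun w => c⁻¹ * (2 * (c * p) * ∑ y, v w y - (c * p) ^ 2) -
    (∑ i, ∑ y, ∑ y', K y y' * d w i y y') / (η * N)
  have hgint : Integrable g Q := hint fun x =>
    c⁻¹ * (2 * (c * p) * ∑ y, (if AllSat (x y) y then (1 : ℝ) else 0) - (c * p) ^ 2) -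
    (∑ i, ∑ y, ∑ y', K y y' * (if x y i ≠ x y' i then (1 : ℝ) else 0)) / (η * N)
  have hvi : ∀ y, Integrable (fun w => v w y) Q := fun y =>
    hint fun x => if AllSat (x y) y then (1 : ℝ) else 0
  have hdi : ∀ i y y', Integrable (fun w => K y y' * d w i y y') Q := fun i y y' =>
    hint fun x => K y y' * (if x y i ≠ x y' i then (1 : ℝ) else 0)
  have hgI : (p ^ 2 - R / η) * c ≤ ∫ w, g w ∂Q := by
    have e1 : ∫ w, ∑ y, v w y ∂Q = c * p := by
      rw [integral_finsetSum _ fun y _ => hvi y, hp]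
      exact Finset.sum_congr rfl fun y _ => hind fun x => AllSat (x y) y
    have e2 : ∫ w, ∑ i, ∑ y, ∑ y', K y y' * d w i y y' ∂Q =
        ∑ i, ∑ y, ∑ y', K y y' * Q.real {w | F w y i ≠ F w y' i} := by
      rw [integral_finsetSum _ fun i _ => integrable_finsetSum _ fun y _ =>
        integrable_finsetSum _ fun y' _ => hdi i y y']
      refine Finset.sum_congr rfl fun i _ => ?_
      rw [integral_finsetSum _ fun y _ => integrable_finsetSum _ fun y' _ => hdi i y y']
      refine Finset.sum_congr rfl fun y _ => ?_
      rw [integral_finsetSum _ fun y' _ => hdi i y y']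
      refine Finset.sum_congr rfl fun y' _ => ?_
      rw [integral_const_mul]
      congr 1
      exact hind fun x => x y i ≠ x y' i
    have i1 : Integrable (fun w => 2 * (c * p) * ∑ y, v w y) Q :=
      (integrable_finsetSum _ fun y _ => hvi y).const_mul _
    have i2 : Integrable (fun w => ∑ i, ∑ y, ∑ y', K y y' * d w i y y') Q :=
      integrable_finsetSum _ fun i _ => integrable_finsetSum _ fun y _ =>
        integrable_finsetSum _ fun y' _ => hdi i y y'
    have i3 : Integrable (fun w => c⁻¹ * (2 * (c * p) * ∑ y, v w y - (c * p) ^ 2)) Q :=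
      (i1.sub (integrable_const _)).const_mul _
    simp only [g]
    rw [integral_sub i3 (i2.div_const _),
      integral_const_mul, integral_sub i1 (integrable_const _), integral_const_mul, e1,
      integral_div, e2, integral_const]
    simp only [probReal_univ, smul_eq_mul, one_mul]
    have h3 : (∑ i, ∑ y, ∑ y', K y y' * Q.real {w | F w y i ≠ F w y' i}) / (η * N) ≤ R / η * c := by
      rw [div_le_iff₀ (by positivity)]
      refine hR.trans (le_of_eq ?_)
      field_simp
    have h4 : c⁻¹ * (2 * (c * p) * (c * p) - (c * p) ^ 2) = p ^ 2 * c := by field_simp; ring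
    rw [h4]; linarith
  obtain ⟨w, hw⟩ := exists_integral_le hgint
  refine ⟨w, hgI.trans (hw.trans ?_)⟩
  have h5 := sq_le_card_mul_noise (ι := Fin M) (Γ := Fin k → Literal N) h0 (v w)
  have h6 : c⁻¹ * (2 * (c * p) * ∑ y, v w y - (c * p) ^ 2) ≤
      ∑ y, ∑ y', K y y' * (v w y * v w y') := by
    have e3 : v w ⬝ᵥ ((noise (Fin M) (Fin k → Literal N) ρ).mulVec (v w)) =
        ∑ y, ∑ y', K y y' * (v w y * v w y') := by
      simp only [dotProduct, Matrix.mulVec, Finset.mul_sum]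
      exact Finset.sum_congr rfl fun y _ => Finset.sum_congr rfl fun y' _ => by
        simp only [K]; ring
    rw [e3] at h5
    rw [inv_mul_le_iff₀ hc0]
    refine le_trans ?_ h5
    nlinarith [sq_nonneg (∑ y, v w y - c * p)]
  have h7 : (∑ i, ∑ y, ∑ y', K y y' * d w i y y') / (η * N) =
      ∑ y, ∑ y', K y y' * (hammingDist (F w y) (F w y') / (η * N)) := by
    rw [Finset.sum_comm, Finset.sum_div]
    refine Finset.sum_congr rfl fun y _ => ?_
    rw [Finset.sum_comm, Finset.sum_div]
    refine Finset.sum_congr rfl fun y' _ => ?_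
    rw [← Finset.mul_sum, mul_div_assoc]
    congr 2
    simp only [d]
    rw [← Finset.sum_filter, Finset.sum_const, nsmul_eq_mul, mul_one]; rfl
  calc g w ≤ ∑ y, ∑ y', K y y' * (v w y * v w y') -
        ∑ y, ∑ y', K y y' * (hammingDist (F w y) (F w y') / (η * N)) := by
        simp only [g]; rw [h7]; linarith
    _ = ∑ y, ∑ y', K y y' * (v w y * v w y' - hammingDist (F w y) (F w y') / (η * N)) := by
        rw [← Finset.sum_sub_distrib]
        refine Finset.sum_congr rfl fun y _ => ?_
        rw [← Finset.sum_sub_distrib]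
        exact Finset.sum_congr rfl fun y' _ => by ring
    _ ≤ _ := Finset.sum_le_sum fun y _ => Finset.sum_le_sum fun y' _ =>
        mul_le_mul_of_nonneg_left (sub_le_stablePair (F w) hη hN y y') (hK0 y y')

end Derandomize

/-! ### Rounded low degree functions -/

section Rounded

variable {N M k : ℕ} {Ω : Type*} [MeasurableSpace Ω]

theorem roundAt_ne_iff (u : Fin N → ℝ) (z z' : EuclideanSpace ℝ (Fin N)) (i : Fin N) :
    roundAt u z i ≠ roundAt u z' i ↔ ¬ (u i ≤ z i ↔ u i ≤ z' i) := by
  unfold roundAt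
  by_cases h : u i ≤ z i <;> by_cases h' : u i ≤ z' i <;> simp [h, h']

theorem measurable_coord {A : Instance N M k × Ω → EuclideanSpace ℝ (Fin N)} (hA : Measurable A)
    (y : Instance N M k) (i : Fin N) : Measurable fun ω => A (y, ω) i :=
  (EuclideanSpace.proj (𝕜 := ℝ) i).continuous.measurable.comp (hA.comp measurable_prodMk_left)

theorem measurableSet_roundAt {A : Instance N M k × Ω → EuclideanSpace ℝ (Fin N)}
    (hA : Measurable A) (y : Instance N M k) (x : Cube N) :
    MeasurableSet {w : Ω × (Fin N → ℝ) | roundAt w.2 (A (y, w.1)) = x} := by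
  have e : {w : Ω × (Fin N → ℝ) | roundAt w.2 (A (y, w.1)) = x} =
      ⋂ i, {w : Ω × (Fin N → ℝ) | w.2 i ≤ A (y, w.1) i ↔ x i = 1} := by
    ext w
    simp only [Set.mem_ofPred_eq, Set.mem_iInter, funext_iff]
    refine forall_congr' fun i => ?_
    unfold roundAt
    rcases Int.units_eq_one_or (x i) with h | h <;> by_cases h' : w.2 i ≤ A (y, w.1) i <;>
      simp [h, h']
  rw [e]
  refine MeasurableSet.iInter fun i => MeasurableSet.iff ?_ (MeasurableSet.const _)
  exact measurableSet_le ((measurable_pi_apply i).comp measurable_snd)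
    ((measurable_coord hA y i).comp measurable_fst)

theorem measurableSet_satisfies_roundAt {A : Instance N M k × Ω → EuclideanSpace ℝ (Fin N)}
    (hA : Measurable A) (y : Instance N M k) :
    MeasurableSet {w : Ω × (Fin N → ℝ) | Satisfies (roundAt w.2 (A (y, w.1))) y} := by
  have e : {w : Ω × (Fin N → ℝ) | Satisfies (roundAt w.2 (A (y, w.1))) y} =
      ⋃ x ∈ {x : Cube N | Satisfies x y}, {w | roundAt w.2 (A (y, w.1)) = x} := by
    ext w; simp
  rw [e]
  exact MeasurableSet.biUnion (Set.to_countable _) fun x _ => measurableSet_roundAt hA y x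

theorem lintegral_instanceLaw (f : Instance N M k → ℝ≥0∞) :
    ∫⁻ y, f y ∂(instanceLaw N M k) =
      (∑ y : Fin M → Fin k → Literal N, f fun q => y q.1 q.2) *
        (Fintype.card (Fin M → Fin k → Literal N) : ℝ≥0∞)⁻¹ := by
  rw [lintegral_fintype, Finset.sum_mul, ← (Equiv.curry (Fin M) (Fin k) (Literal N)).symm.sum_comp]
  refine Finset.sum_congr rfl fun y _ => ?_
  rw [instanceLaw_singleton, Fintype.card_congr (Equiv.curry (Fin M) (Fin k) (Literal N))]
  rfl

instance (N M k : ℕ) : SFinite (instanceLaw N M k) := by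
  unfold instanceLaw; infer_instance

/-- The success probability as an average over instances. -/
theorem prob_satisfies_eq (P : Measure Ω) [IsProbabilityMeasure P]
    {A : Instance N M k × Ω → EuclideanSpace ℝ (Fin N)} (hA : Measurable A) :
    (((instanceLaw N M k).prod P).prod (thresholdLaw N))
      {q | Satisfies (roundAt q.2 (A q.1)) q.1.1} =
    (∑ y : Fin M → Fin k → Literal N, (P.prod (thresholdLaw N))
      {w | AllSat (roundAt w.2 (A (fun q => y q.1 q.2, w.1))) y}) *
        (Fintype.card (Fin M → Fin k → Literal N) : ℝ≥0∞)⁻¹ := by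
  set Z : Set (Instance N M k × Ω × (Fin N → ℝ)) :=
    {q | Satisfies (roundAt q.2.2 (A (q.1, q.2.1))) q.1} with hZ
  have hZm : MeasurableSet Z := by
    have e : Z = ⋃ y : Instance N M k, {y} ×ˢ
        {w : Ω × (Fin N → ℝ) | Satisfies (roundAt w.2 (A (y, w.1))) y} := by
      ext q; simp [hZ]
    rw [e]
    exact MeasurableSet.iUnion fun y =>
      (measurableSet_singleton y).prod (measurableSet_satisfies_roundAt hA y)
  have e1 : {q : (Instance N M k × Ω) × (Fin N → ℝ) | Satisfies (roundAt q.2 (A q.1)) q.1.1} =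
      MeasurableEquiv.prodAssoc ⁻¹' Z := rfl
  rw [e1, ← Measure.map_apply MeasurableEquiv.prodAssoc.measurable hZm, Measure.prodAssoc_prod,
    Measure.prod_apply hZm, lintegral_instanceLaw]
  congr 1
  refine Finset.sum_congr rfl fun y _ => ?_
  congr 1
  ext w
  simp only [hZ, Set.mem_preimage, Set.mem_ofPred_eq]
  exact satisfies_iff_forall_not_violates _ _

/-- Every instance carries the same positive mass, so finiteness of the total second moment passes
to each instance separately. -/
theorem integrable_coord_sq (hN : N ≠ 0) (P : Measure Ω) [IsProbabilityMeasure P]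
    {A : Instance N M k × Ω → EuclideanSpace ℝ (Fin N)} (hA : Measurable A) {C : ℝ≥0}
    (hC : ∫⁻ p, ‖A p‖ₑ ^ 2 ∂((instanceLaw N M k).prod P) ≤ (C : ℝ≥0∞) * (N : ℝ≥0∞)) :
    (∀ (y : Fin M → Fin k → Literal N) i,
      Integrable (fun ω => A (fun q => y q.1 q.2, ω) i ^ 2) P) ∧
    ∑ i, ∑ y : Fin M → Fin k → Literal N, ∫ ω, A (fun q => y q.1 q.2, ω) i ^ 2 ∂P ≤
      Fintype.card (Fin M → Fin k → Literal N) * (C * N) := by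
  have : NeZero N := ⟨hN⟩
  set c : ℕ := Fintype.card (Fin M → Fin k → Literal N) with hc
  have hc0 : c ≠ 0 := Fintype.card_ne_zero
  let J : (Fin M → Fin k → Literal N) → ℝ≥0∞ := fun y => ∫⁻ ω, ‖A (fun q => y q.1 q.2, ω)‖ₑ ^ 2 ∂P
  have hsum : ∑ y, J y ≤ (c : ℝ≥0∞) * (C * N) := by
    rw [lintegral_prod _ (hA.enorm.pow_const 2).aemeasurable, lintegral_instanceLaw,
      ← div_eq_mul_inv, ENNReal.div_le_iff (by exact_mod_cast hc0) (ENNReal.natCast_ne_top _)] at hC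
    rwa [mul_comm (c : ℝ≥0∞)]
  have htop : (c : ℝ≥0∞) * (C * N) ≠ ∞ :=
    ENNReal.mul_ne_top (ENNReal.natCast_ne_top _)
      (ENNReal.mul_ne_top ENNReal.coe_ne_top (ENNReal.natCast_ne_top _))
  have hJtop : ∀ y, J y ≠ ∞ := fun y =>
    ne_top_of_le_ne_top htop ((Finset.single_le_sum (fun _ _ => zero_le) (Finset.mem_univ y)).trans
      hsum)
  have hmeas : ∀ y : Fin M → Fin k → Literal N, Measurable fun ω => A (fun q => y q.1 q.2, ω) :=
    fun y => hA.comp measurable_prodMk_left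
  have hnorm : ∀ y : Fin M → Fin k → Literal N,
      Integrable (fun ω => ‖A (fun q => y q.1 q.2, ω)‖ ^ 2) P := by
    intro y
    refine ⟨((hmeas y).norm.pow_const 2).aestronglyMeasurable, ?_⟩
    rw [hasFiniteIntegral_iff_enorm]
    simp only [enorm_pow, enorm_norm]
    exact (hJtop y).lt_top
  have hint : ∀ (y : Fin M → Fin k → Literal N) i,
      Integrable (fun ω => A (fun q => y q.1 q.2, ω) i ^ 2) P := by
    intro y i
    refine (hnorm y).mono' ((measurable_coord hA _ i).pow_const 2).aestronglyMeasurable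
      (Eventually.of_forall fun ω => ?_)
    rw [Real.norm_of_nonneg (sq_nonneg _), EuclideanSpace.norm_sq_eq]
    refine le_trans (le_of_eq ?_) (Finset.single_le_sum (fun j _ => sq_nonneg _)
      (Finset.mem_univ i))
    rw [Real.norm_eq_abs, sq_abs]
  refine ⟨hint, ?_⟩
  have e1 : ∀ y : Fin M → Fin k → Literal N,
      ∑ i, ∫ ω, A (fun q => y q.1 q.2, ω) i ^ 2 ∂P = (J y).toReal := by
    intro y
    rw [← integral_finsetSum _ fun i _ => hint y i]
    have : (fun ω => ∑ i, A (fun q => y q.1 q.2, ω) i ^ 2) =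
        fun ω => ‖A (fun q => y q.1 q.2, ω)‖ ^ 2 := by
      ext ω
      rw [EuclideanSpace.norm_sq_eq]
      exact Finset.sum_congr rfl fun i _ => by rw [Real.norm_eq_abs, sq_abs]
    rw [this, integral_eq_lintegral_of_nonneg_ae (Eventually.of_forall fun ω => sq_nonneg _)
      (hnorm y).aestronglyMeasurable]
    congr 1
    refine lintegral_congr fun ω => ?_
    rw [ENNReal.ofReal_pow (norm_nonneg _), ofReal_norm]
  rw [Finset.sum_comm]
  simp_rw [e1]
  rw [← ENNReal.toReal_sum fun y _ => hJtop y]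
  refine (ENNReal.toReal_mono htop hsum).trans (le_of_eq ?_)
  simp

/-- A rounded low degree function has a realization that is satisfying and stable on a
noise-correlated pair with probability close to the square of its success probability. -/
theorem exists_stable_rule (hN : N ≠ 0) (P : Measure Ω) [IsProbabilityMeasure P]
    {A : Instance N M k × Ω → EuclideanSpace ℝ (Fin N)} (hA : Measurable A) {D : ℕ}
    (hD : ∀ ω, IsDegree D fun y => A (y, ω)) {C : ℝ≥0}
    (hC : ∫⁻ p, ‖A p‖ₑ ^ 2 ∂((instanceLaw N M k).prod P) ≤ (C : ℝ≥0∞) * (N : ℝ≥0∞))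
    {ρ : ℝ} (h0 : 0 ≤ ρ) (h1 : ρ ≤ 1) {η θ : ℝ} (hη : 0 < η) (hθ : 0 < θ) {p : ℝ}
    (hp : p = ((((instanceLaw N M k).prod P).prod (thresholdLaw N))
      {q | Satisfies (roundAt q.2 (A q.1)) q.1.1}).toReal) :
    ∃ f : (Fin M → Fin k → Literal N) → Cube N,
      (p ^ 2 - (θ / 2 + (1 - ρ ^ D) * C / θ) / η) * Fintype.card (Fin M → Fin k → Literal N) ≤
        ∑ y, ∑ y', noise (Fin M) (Fin k → Literal N) ρ y y' * stablePair f η y y' := by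
  have : NeZero N := ⟨hN⟩
  have hc0 : (Fintype.card (Fin M → Fin k → Literal N) : ℝ) ≠ 0 := by
    exact_mod_cast Fintype.card_ne_zero
  obtain ⟨hint, hsum⟩ := integrable_coord_sq hN P hA hC
  let F : Ω × (Fin N → ℝ) → (Fin M → Fin k → Literal N) → Cube N := fun w y =>
    roundAt w.2 (A (fun q => y q.1 q.2, w.1))
  refine Exists.imp' F (fun _ hw => hw) (exists_stable_realization hN (P.prod (thresholdLaw N))
    h0 h1 hη F (p := p) (R := θ / 2 + (1 - ρ ^ D) * C / θ) ?_ ?_ ?_)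
  · intro x
    have e : F ⁻¹' {x} = ⋂ y : Fin M → Fin k → Literal N,
        {w | roundAt w.2 (A (fun q => y q.1 q.2, w.1)) = x y} := by
      ext w; simp [F, funext_iff]
    rw [e]
    exact MeasurableSet.iInter fun y => measurableSet_roundAt hA _ (x y)
  · rw [hp, prob_satisfies_eq P hA, ENNReal.toReal_mul, ENNReal.toReal_inv, ENNReal.toReal_natCast,
      ENNReal.toReal_sum fun y _ => measure_ne_top _ _]
    rw [mul_comm, mul_assoc, inv_mul_cancel₀ hc0, mul_one]
    rfl
  · have hK0 : ∀ y y', 0 ≤ noise (Fin M) (Fin k → Literal N) ρ y y' := noise_nonneg h0 h1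
    have hdiff : ∀ (y y' : Fin M → Fin k → Literal N) i, Integrable (fun ω =>
        (A (fun q => y q.1 q.2, ω) i - A (fun q => y' q.1 q.2, ω) i) ^ 2) P := by
      intro y y' i
      refine (((hint y i).const_mul 2).add ((hint y' i).const_mul 2)).mono'
        (((measurable_coord hA _ i).sub (measurable_coord hA _ i)).pow_const 2).aestronglyMeasurable
        (Eventually.of_forall fun ω => ?_)
      rw [Real.norm_of_nonneg (sq_nonneg _)]
      simp only [Pi.add_apply]
      nlinarith [sq_nonneg (A (fun q => y q.1 q.2, ω) i + A (fun q => y' q.1 q.2, ω) i)]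
    have hi : ∀ i, ∑ y, ∑ y', noise (Fin M) (Fin k → Literal N) ρ y y' *
        (P.prod (thresholdLaw N)).real {w | F w y i ≠ F w y' i} ≤
        Fintype.card (Fin M → Fin k → Literal N) * (θ / 2) + (1 - ρ ^ D) / θ *
          ∑ y : Fin M → Fin k → Literal N, ∫ ω, A (fun q => y q.1 q.2, ω) i ^ 2 ∂P := by
      intro i
      have hterm : ∀ y y', noise (Fin M) (Fin k → Literal N) ρ y y' *
          (P.prod (thresholdLaw N)).real {w | F w y i ≠ F w y' i} ≤
          ∫ ω, noise (Fin M) (Fin k → Literal N) ρ y y' * ((θ +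
            (A (fun q => y q.1 q.2, ω) i - A (fun q => y' q.1 q.2, ω) i) ^ 2 / θ) / 2) ∂P := by
        intro y y'
        rw [integral_const_mul]
        refine mul_le_mul_of_nonneg_left ?_ (hK0 y y')
        simp only [F, roundAt_ne_iff]
        exact prod_thresholdLaw_separates_le P i (measurable_coord hA _ i)
          (measurable_coord hA _ i) (hdiff y y' i) hθ
      have hti : ∀ y y', Integrable (fun ω => noise (Fin M) (Fin k → Literal N) ρ y y' * ((θ +
            (A (fun q => y q.1 q.2, ω) i - A (fun q => y' q.1 q.2, ω) i) ^ 2 / θ) / 2)) P :=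
        fun y y' => ((((integrable_const θ).add ((hdiff y y' i).div_const θ)).div_const 2).const_mul
          _)
      refine (Finset.sum_le_sum fun y _ => Finset.sum_le_sum fun y' _ => hterm y y').trans ?_
      simp_rw [← integral_finsetSum _ fun y' _ => hti _ y']
      rw [← integral_finsetSum _ fun y _ => integrable_finsetSum _ fun y' _ => hti y y',
        ← integral_finsetSum _ fun y _ => hint y i, ← integral_const_mul]
      have hrhs : Fintype.card (Fin M → Fin k → Literal N) * (θ / 2) =
          ∫ _ω, Fintype.card (Fin M → Fin k → Literal N) * (θ / 2) ∂P := by simp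
      have hi2 : Integrable (fun ω => (1 - ρ ^ D) / θ *
          ∑ y : Fin M → Fin k → Literal N, A (fun q => y q.1 q.2, ω) i ^ 2) P :=
        (integrable_finsetSum _ fun y _ => hint y i).const_mul _
      rw [hrhs, ← integral_add (integrable_const _) hi2]
      refine integral_mono (integrable_finsetSum _ fun y _ => integrable_finsetSum _
        fun y' _ => hti y y') ((integrable_const _).add hi2) fun ω => ?_
      -- The chain resamples whole clauses, so the degree is measured in clauses after currying.
      have hs := sum_noise_sq_sub_le h0 h1 D (degreeSpace_curry (hD ω i))
      beta_reduce at hs ⊢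
      have e2 : ∑ y, ∑ y', noise (Fin M) (Fin k → Literal N) ρ y y' * ((θ +
            (A (fun q => y q.1 q.2, ω) i - A (fun q => y' q.1 q.2, ω) i) ^ 2 / θ) / 2) =
          (θ / 2) * ∑ y, ∑ y', noise (Fin M) (Fin k → Literal N) ρ y y' + (1 / (2 * θ)) *
            ∑ y, ∑ y', noise (Fin M) (Fin k → Literal N) ρ y y' *
              (A (fun q => y q.1 q.2, ω) i - A (fun q => y' q.1 q.2, ω) i) ^ 2 := by
        rw [Finset.mul_sum, Finset.mul_sum, ← Finset.sum_add_distrib]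
        refine Finset.sum_congr rfl fun y _ => ?_
        rw [Finset.mul_sum, Finset.mul_sum, ← Finset.sum_add_distrib]
        exact Finset.sum_congr rfl fun y' _ => by field_simp
      rw [e2]
      have e3 : ∑ y, ∑ y', noise (Fin M) (Fin k → Literal N) ρ y y' =
          Fintype.card (Fin M → Fin k → Literal N) := by
        rw [Finset.sum_congr rfl fun y _ => noise_sum ρ y]
        rw [Finset.sum_const, Finset.card_univ, nsmul_eq_mul, mul_one]
      rw [e3]
      have h5 := mul_le_mul_of_nonneg_left hs (show 0 ≤ 1 / (2 * θ) by positivity)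
      have e4 : 1 / (2 * θ) * (2 * (1 - ρ ^ D) *
          ∑ y : Fin M → Fin k → Literal N, A (fun q => y q.1 q.2, ω) i ^ 2) = (1 - ρ ^ D) / θ *
          ∑ y : Fin M → Fin k → Literal N, A (fun q => y q.1 q.2, ω) i ^ 2 := by field_simp
      rw [e4] at h5
      linarith
    refine (Finset.sum_le_sum fun i _ => hi i).trans ?_
    rw [Finset.sum_add_distrib, Finset.sum_const, Finset.card_univ,
      Fintype.card_fin, nsmul_eq_mul, ← Finset.mul_sum]
    have h6 : 0 ≤ (1 - ρ ^ D) / θ :=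
      div_nonneg (sub_nonneg.2 (pow_le_one₀ h0 h1)) hθ.le
    have h7 := mul_le_mul_of_nonneg_left hsum h6
    refine (add_le_add_right h7 _).trans (le_of_eq ?_)
    ring

end Rounded

/-! ### Asymptotics in the number of variables -/

theorem eventually_poly_mul_exp_lt (c : ℝ) (E : ℕ) {ν : ℝ} (hν : 0 < ν) :
    ∀ᶠ N : ℕ in atTop, c * ((N : ℝ) + 1) ^ E * Real.exp (-(ν * N)) < 1 := by
  have h1 : Tendsto (fun n : ℕ => (n : ℝ) ^ E * Real.exp (-ν) ^ n) atTop (𝓝 0) :=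
    tendsto_pow_const_mul_const_pow_of_lt_one E (Real.exp_nonneg _)
      (Real.exp_lt_one_iff.2 (by linarith))
  have h2 := ((tendsto_add_atTop_iff_nat 1).2 h1).const_mul (c * Real.exp ν)
  rw [mul_zero] at h2
  filter_upwards [h2.eventually (gt_mem_nhds one_pos)] with N hN
  refine lt_of_le_of_lt (le_of_eq ?_) hN
  have : Real.exp (-(ν * N)) = Real.exp ν * Real.exp (-ν) ^ (N + 1) := by
    rw [← Real.exp_nat_mul, ← Real.exp_add]; congr 1; push_cast; ring
  rw [this]; push_cast; ring

/-- The lower bound on path probabilities is available for lengths that are powers of two; rounding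
up costs a factor `2`. -/
theorem exists_two_pow_between {x : ℕ} (hx : x ≠ 0) : ∃ n, x ≤ 2 ^ n ∧ 2 ^ n ≤ 2 * x := by
  refine ⟨Nat.log 2 x + 1, (Nat.lt_pow_succ_log_self (by norm_num) x).le, ?_⟩
  rw [pow_succ, mul_comm]
  exact Nat.mul_le_mul_left 2 (Nat.pow_log_le_self 2 hx)

/-- The bound on the stable path probability in exponential form. -/
theorem stable_path_bound_le {N M m T : ℕ} {b u q ν : ℝ} (hTN : T ≤ N) {r : ℝ} (hr0 : 0 ≤ r)
    (hr : r ≤ 1 - q) (h1 : N * b - M * q ≤ -(2 * ν * N))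
    (h2 : N * (Real.log 2 + m * b) - M * u ≤ -(2 * ν * N)) :
    ((T : ℝ) + 1) ^ (m + 1) * (m * ((((N : ℝ) + 1) ^ (2 ^ (m + 1)) * Real.exp (N * b)) * r ^ M) +
      (2 ^ N * (((N : ℝ) + 1) ^ (2 ^ (m + 1)) * Real.exp (N * b)) ^ m) *
        Real.exp (-(M * u))) ≤
      (m + 1) * ((N : ℝ) + 1) ^ ((m + 1) + 2 ^ (m + 1) * (m + 1)) *
        Real.exp (-(2 * ν * N)) := by
  have hTN' : (T : ℝ) ≤ N := by exact_mod_cast hTN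
  have hone : (1 : ℝ) ≤ (N : ℝ) + 1 := by linarith [(Nat.cast_nonneg N : (0 : ℝ) ≤ N)]
  set p : ℝ := ((N : ℝ) + 1) ^ (2 ^ (m + 1)) with hp
  have hp1 : 1 ≤ p := one_le_pow₀ hone
  have hrM : r ^ M ≤ Real.exp (-(M * q)) := by
    rw [← mul_neg, Real.exp_nat_mul]
    exact pow_le_pow_left₀ hr0 (hr.trans (by linarith [Real.add_one_le_exp (-q)])) M
  have hA : (p * Real.exp (N * b)) * r ^ M ≤ p ^ (m + 1) * Real.exp (-(2 * ν * N)) := by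
    calc (p * Real.exp (N * b)) * r ^ M ≤ (p * Real.exp (N * b)) * Real.exp (-(M * q)) := by
          gcongr
      _ = p * Real.exp (N * b - M * q) := by
          rw [mul_assoc, ← Real.exp_add]; rfl
      _ ≤ p ^ (m + 1) * Real.exp (-(2 * ν * N)) := by
          gcongr
          exact le_self_pow₀ hp1 (by omega)
  have hB : (2 ^ N * (p * Real.exp (N * b)) ^ m) * Real.exp (-(M * u)) ≤
      p ^ (m + 1) * Real.exp (-(2 * ν * N)) := by
    have e : (2 : ℝ) ^ N = Real.exp (N * Real.log 2) := by
      rw [Real.exp_nat_mul, Real.exp_log (by norm_num)]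
    calc (2 ^ N * (p * Real.exp (N * b)) ^ m) * Real.exp (-(M * u))
        = p ^ m * Real.exp (N * (Real.log 2 + m * b) - M * u) := by
          rw [e, mul_pow, ← Real.exp_nat_mul,
            show N * (Real.log 2 + m * b) - M * u =
              N * Real.log 2 + (m * (N * b) + (-(M * u))) by ring, Real.exp_add, Real.exp_add]
          ring
      _ ≤ p ^ (m + 1) * Real.exp (-(2 * ν * N)) := by
          gcongr
          omega
  calc _ ≤ ((N : ℝ) + 1) ^ (m + 1) * (m * (p ^ (m + 1) * Real.exp (-(2 * ν * N))) +
        p ^ (m + 1) * Real.exp (-(2 * ν * N))) := by gcongr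
    _ = _ := by rw [hp, pow_add _ (m + 1) (2 ^ (m + 1) * (m + 1)), pow_mul]; ring

/-- The bound on the success probability at a fixed number of variables. -/
theorem prob_satisfies_le {N M k m D : ℕ} (hN0 : 0 < N) (hk0 : k ≠ 0) {Ω : Type*}
    [MeasurableSpace Ω] (P : Measure Ω) [IsProbabilityMeasure P]
    {A : Instance N M k × Ω → EuclideanSpace ℝ (Fin N)} (hA : Measurable A)
    (hdeg : ∀ ω, IsDegree D fun y => A (y, ω)) {C : ℝ≥0}
    (hC : ∫⁻ p, ‖A p‖ₑ ^ 2 ∂((instanceLaw N M k).prod P) ≤ (C : ℝ≥0∞) * (N : ℝ≥0∞))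
    {l L b' b η L₀ ν ε₀ δ ν' : ℝ} (hl : 0 ≤ l) (hL : 1 ≤ L) (hb0 : 0 ≤ b) (hη0 : 0 < η)
    (hη : ∀ (p : Fin N → Fin (m + 1) → ℤˣ) (x x' : Cube N), (hammingDist x x' : ℝ) ≤ η * N →
      condEntropy p x' - condEntropy p x ≤ b - b')
    (hL₀ : 0 < L₀) (hδ0 : 0 < δ) (hδ1 : δ ≤ 1) (hε₀0 : 0 < ε₀) (hε₀1 : ε₀ ≤ 1)
    (hε₀C : ε₀ * C ≤ δ ^ 2 * η * (δ ^ 2 * η / 2) / 4)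
    (hν'1 : ν' ≤ 1) (hν' : ν' * -Real.log (δ ^ 2 / 2) ≤ ν)
    (hT : 2 * (m * (L₀ * ((D : ℝ) + 1) / ε₀ + 1) + 1) ≤ ν' * N)
    (hM1 : N * b - M * ((1 - Real.exp (-L₀)) * (1 / 2) ^ k) ≤ -(2 * ν * N))
    (hM2 : N * (Real.log 2 + m * b) - M * (m * (1 / 2) ^ k *
      (1 - overlapBound k m l L b' - m * (1 / 2) ^ k)) ≤ -(2 * ν * N))
    (hpoly : ((m : ℝ) + 1) * ((N : ℝ) + 1) ^ ((m + 1) + 2 ^ (m + 1) * (m + 1)) *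
      Real.exp (-(ν * N)) < 1) :
    (((instanceLaw N M k).prod P).prod (thresholdLaw N))
      {q | Satisfies (roundAt q.2 (A q.1)) q.1.1} ≤ ENNReal.ofReal δ := by
  by_contra hlarge
  push Not at hlarge
  have hN' : (0 : ℝ) < N := by exact_mod_cast hN0
  set p : ℝ := ((((instanceLaw N M k).prod P).prod (thresholdLaw N))
    {q | Satisfies (roundAt q.2 (A q.1)) q.1.1}).toReal with hp
  have hpδ : δ ≤ p := by
    have hne : (((instanceLaw N M k).prod P).prod (thresholdLaw N))
      {q | Satisfies (roundAt q.2 (A q.1)) q.1.1} ≠ ∞ := by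
      have : NeZero N := ⟨hN0.ne'⟩
      rw [prob_satisfies_eq P hA]
      refine ENNReal.mul_ne_top (ENNReal.sum_ne_top.2 fun y _ => measure_ne_top _ _)
        (ENNReal.inv_ne_top.2 ?_)
      exact_mod_cast Fintype.card_ne_zero
    rw [hp]
    exact (ENNReal.ofReal_le_iff_le_toReal hne).1 hlarge.le
  clear_value p
  -- This `θ` makes `θ / 2` equal to `δ ^ 2 * η / 4`, and `hε₀C` bounds the noise term by the same
  -- amount; together they cost at most half of `δ ^ 2`, leaving `γ`.
  set θ : ℝ := δ ^ 2 * η / 2 with hθ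
  have hθ0 : 0 < θ := by positivity
  set γ : ℝ := δ ^ 2 / 2 with hγ
  have hγ0 : 0 < γ := by positivity
  have hγ1 : γ < 1 := by nlinarith only [hγ, hδ0, hδ1]
  have hlγ : Real.log γ < 0 := Real.log_neg hγ0 hγ1
  -- By Bernoulli's inequality `ρ ^ D ≥ 1 - ε₀`; using `D + 1` covers `D = 0`.
  set ρ : ℝ := 1 - ε₀ / (D + 1) with hρ
  have hD1 : (1 : ℝ) ≤ (D : ℝ) + 1 := by linarith [(Nat.cast_nonneg D : (0 : ℝ) ≤ D)]
  have hεD : ε₀ / (D + 1) ≤ 1 := by rw [div_le_one (by positivity)]; linarith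
  have hρ0 : 0 ≤ ρ := by rw [hρ]; linarith
  have hρ1 : ρ ≤ 1 := by
    have : 0 < ε₀ / (D + 1) := by positivity
    rw [hρ]; linarith
  have hρD : 1 - ρ ^ D ≤ ε₀ := by
    have h1 := one_add_mul_le_pow (a := -(ε₀ / (D + 1))) (by linarith) D
    rw [← sub_eq_add_neg, ← hρ] at h1
    have h2 : (D : ℝ) * (ε₀ / (D + 1)) ≤ ε₀ := by
      rw [mul_div_assoc', div_le_iff₀ (by positivity)]; nlinarith
    linarith
  obtain ⟨f, hf⟩ := exists_stable_rule hN0.ne' P hA hdeg hC hρ0 hρ1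
    hη0 hθ0 hp
  have hγf : γ * Fintype.card (Fin M → Fin k → Literal N) ≤
      ∑ y, ∑ y', noise (Fin M) (Fin k → Literal N) ρ y y' *
        stablePair f η y y' := by
    refine le_trans (mul_le_mul_of_nonneg_right ?_ (by positivity)) hf
    have h1 : (1 - ρ ^ D) * C / θ ≤ δ ^ 2 * η / 4 := by
      rw [div_le_iff₀ hθ0]
      have := mul_le_mul_of_nonneg_right hρD (NNReal.coe_nonneg C)
      linarith only [this, hε₀C]
    have h2 : (θ / 2 + (1 - ρ ^ D) * C / θ) / η ≤ δ ^ 2 / 2 := by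
      rw [div_le_iff₀ hη0]
      linarith only [h1, hθ]
    have h3 : δ ^ 2 ≤ p ^ 2 := pow_le_pow_left₀ hδ0.le hpδ 2
    linarith only [h2, h3, hγ]
  -- After this many steps a clause has escaped resampling with probability at most `exp (-L₀)`.
  set T₀ : ℕ := ⌈L₀ * ((D : ℝ) + 1) / ε₀⌉₊ with hT₀
  have hT₀le : (T₀ : ℝ) ≤ L₀ * ((D : ℝ) + 1) / ε₀ + 1 :=
    (Nat.ceil_lt_add_one (by positivity)).le
  obtain ⟨n, hn1, hn2⟩ := exists_two_pow_between (x := m * T₀ + 1) (by omega)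
  have hTν : ((2 ^ n : ℕ) : ℝ) ≤ ν' * N := by
    refine le_trans ?_ hT
    have h1 : ((2 ^ n : ℕ) : ℝ) ≤ 2 * (m * T₀ + 1) := by exact_mod_cast hn2
    have h2 := mul_le_mul_of_nonneg_left hT₀le (Nat.cast_nonneg (α := ℝ) m)
    linarith
  have hTN : 2 ^ n ≤ N := by
    have h1 : ν' * N ≤ 1 * N := mul_le_mul_of_nonneg_right hν'1 hN'.le
    rw [one_mul] at h1
    exact_mod_cast hTν.trans h1
  have hρT : ρ ^ T₀ ≤ Real.exp (-L₀) := by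
    have h1 : ρ ≤ Real.exp (-(ε₀ / (D + 1))) := by
      rw [hρ]; linarith [Real.add_one_le_exp (-(ε₀ / ((D : ℝ) + 1)))]
    refine (pow_le_pow_left₀ hρ0 h1 T₀).trans ?_
    rw [← Real.exp_nat_mul, Real.exp_le_exp, mul_neg, neg_le_neg_iff]
    have h2 := mul_le_mul_of_nonneg_right (Nat.le_ceil (L₀ * ((D : ℝ) + 1) / ε₀))
      (show 0 ≤ ε₀ / ((D : ℝ) + 1) by positivity)
    refine le_trans (le_of_eq ?_) h2
    field_simp
  have hlow := pow_le_instExp_prod hN0.ne' ρ (stablePair_transpose f η)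
    hγ0.le hγf n
  have hup := instExp_prod_stablePair_le hN0.ne' hk0 hρ0 hρ1 f hl hL hb0
    (T := 2 ^ n) (T₀ := T₀) (m := m) (by omega) Nat.one_le_two_pow hη
  have hk2 : (1 / 2 : ℝ) ^ k ≤ 1 := pow_le_one₀ (by norm_num) (by norm_num)
  have hk2' : (0 : ℝ) < (1 / 2) ^ k := by positivity
  have hρT0 : 0 ≤ ρ ^ T₀ := pow_nonneg hρ0 _
  have hρT1 : ρ ^ T₀ ≤ 1 := pow_le_one₀ hρ0 hρ1
  have hbound := stable_path_bound_le (m := m) (b := b)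
    (ν := ν) (M := M) hTN (r := 1 - (1 - ρ ^ T₀) * (1 / 2) ^ k) (by nlinarith only [hk2, hk2', hρT0, hρT1])
    (by nlinarith only [hk2', hρT]) hM1 hM2
  have hfinal := hlow.trans (hup.trans hbound)
  -- The path is short enough for the lower bound to stay above `exp (-ν N)`, while the upper bound
  -- is polynomial times `exp (-2 ν N)`; `hpoly` makes the two incompatible.
  have hγT : Real.exp (-(ν * N)) ≤ γ ^ (2 ^ n) := by
    rw [← Real.exp_log hγ0, ← Real.exp_nat_mul, Real.exp_le_exp]
    have h1 := mul_le_mul_of_nonneg_right hTν (show 0 ≤ -Real.log γ by linarith only [hlγ])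
    have h2 := mul_le_mul_of_nonneg_right hν' hN'.le
    linarith only [h1, h2]
  have h4 := hγT.trans hfinal
  have e : Real.exp (-(2 * ν * N)) = Real.exp (-(ν * N)) * Real.exp (-(ν * N)) := by
    rw [← Real.exp_add]; congr 1; ring
  rw [e, ← mul_assoc] at h4
  have h5 := mul_lt_mul_of_pos_right hpoly (Real.exp_pos (-(ν * N)))
  linarith only [h4, h5]

end RandomKSat

end

theorem corollary3p15 (κ : ℝ) (hκ : RandomKSat.kappaStar < κ) :
    ∃ k₀ : ℕ, ∀ k : ℕ, k₀ ≤ k →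
      ∀ M : ℕ → ℕ,
        Tendsto (fun N => (M N : ℝ) / (N : ℝ)) atTop
          (𝓝 (κ * 2 ^ k * Real.log (k : ℝ) / (k : ℝ))) →
      ∀ (Ω : ℕ → Type*) [∀ N, MeasurableSpace (Ω N)]
        (P : ∀ N, Measure (Ω N)) [∀ N, IsProbabilityMeasure (P N)]
        (D : ℕ → ℕ) (C : ℝ≥0)
        (A : ∀ N, RandomKSat.Instance N (M N) k × Ω N → EuclideanSpace ℝ (Fin N)),
        (fun N => (D N : ℝ)) =o[atTop] (fun N => (N : ℝ)) →
        (∀ N, Measurable (A N)) →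
        (∀ N (ω : Ω N), RandomKSat.IsDegree (D N) fun y => A N (y, ω)) →
        (∀ N, ∫⁻ p, ‖A N p‖ₑ ^ 2 ∂((RandomKSat.instanceLaw N (M N) k).prod (P N))
          ≤ (C : ℝ≥0∞) * (N : ℝ≥0∞)) →
        Tendsto
          (fun N =>
            (((RandomKSat.instanceLaw N (M N) k).prod (P N)).prod (RandomKSat.thresholdLaw N))
              {q | RandomKSat.Satisfies (RandomKSat.roundAt q.2 (A N q.1)) q.1.1})
          atTop (𝓝 0) := by
  obtain ⟨k₀, hk₀⟩ := RandomKSat.exists_parameters hκ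
  refine ⟨k₀, fun k hk M hM Ω _ P _ D C A hD hA hdeg hC => ?_⟩
  obtain ⟨m, l, L, b', b, hk0, hl, hL, hbb, hb0, hbα, hgap⟩ := hk₀ k hk
  set α : ℝ := κ * 2 ^ k * Real.log k / k with hα
  set u : ℝ := m * (1 / 2) ^ k * (1 - RandomKSat.overlapBound k m l L b' - m * (1 / 2) ^ k) with hu
  obtain ⟨η, hη0, hη⟩ := RandomKSat.exists_condEntropy_sub_le (Fin (m + 1) → ℤˣ)
    (sub_pos.2 hbb)
  -- Since `b < α / 2 ^ k` strictly, a finite amount of resampling already beats the count `exp (N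
  -- b)`.
  obtain ⟨L₀, hL₀, hbL⟩ : ∃ L₀ : ℝ, 0 < L₀ ∧
      b < α * ((1 - Real.exp (-L₀)) * (1 / 2) ^ k) := by
    have h1 : Tendsto (fun L₀ : ℝ => α * ((1 - Real.exp (-L₀)) * (1 / 2) ^ k)) atTop
        (𝓝 (α * ((1 - 0) * (1 / 2) ^ k))) :=
      ((Real.tendsto_exp_neg_atTop_nhds_zero.const_sub 1).mul_const _).const_mul α
    rw [sub_zero, one_mul] at h1
    obtain ⟨L₀, h2, h3⟩ := ((h1.eventually (lt_mem_nhds hbα)).and (eventually_gt_atTop 0)).exists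
    exact ⟨L₀, h3, h2⟩
  set q : ℝ := (1 - Real.exp (-L₀)) * (1 / 2) ^ k with hq
  obtain ⟨ν, hν0, hν1, hν2⟩ : ∃ ν : ℝ, 0 < ν ∧ b - α * q < -(2 * ν) ∧
      Real.log 2 + m * b - α * u < -(2 * ν) := by
    refine ⟨min (α * q - b) (α * u - (Real.log 2 + m * b)) / 4, ?_, ?_, ?_⟩
    · have := lt_min (sub_pos.2 hbL) (sub_pos.2 hgap)
      linarith
    · have h1 := min_le_left (α * q - b) (α * u - (Real.log 2 + m * b))
      linarith
    · have h1 := min_le_right (α * q - b) (α * u - (Real.log 2 + m * b))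
      linarith
  rw [ENNReal.tendsto_nhds_zero]
  intro ε hε
  obtain ⟨δ, hδ0, hδ1, hδε⟩ : ∃ δ : ℝ, 0 < δ ∧ δ ≤ 1 ∧ ENNReal.ofReal δ ≤ ε := by
    have h1 : min ε 1 ≠ ∞ := ne_top_of_le_ne_top ENNReal.one_ne_top (min_le_right _ _)
    refine ⟨(min ε 1).toReal, ENNReal.toReal_pos (lt_min hε one_pos).ne' h1, ?_, ?_⟩
    · simpa using ENNReal.toReal_mono ENNReal.one_ne_top (min_le_right ε 1)
    · rw [ENNReal.ofReal_toReal h1]; exact min_le_left _ _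
  set θ : ℝ := δ ^ 2 * η / 2 with hθ
  have hθ0 : 0 < θ := by positivity
  -- The denominator uses `C + 1` so that `C = 0` is allowed.
  set ε₀ : ℝ := min 1 (δ ^ 2 * η * θ / (4 * (C + 1))) with hε₀
  have hε₀0 : 0 < ε₀ := lt_min one_pos (by positivity)
  have hε₀1 : ε₀ ≤ 1 := min_le_left _ _
  have hε₀C : ε₀ * C ≤ δ ^ 2 * η * θ / 4 := by
    have h1 : ε₀ ≤ δ ^ 2 * η * θ / (4 * (C + 1)) := min_le_right _ _
    rw [le_div_iff₀ (by positivity)] at h1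
    have : 0 ≤ ε₀ := hε₀0.le
    nlinarith
  set γ : ℝ := δ ^ 2 / 2 with hγ
  have hγ0 : 0 < γ := by positivity
  have hγ1 : γ < 1 := by nlinarith
  have hlγ : Real.log γ < 0 := Real.log_neg hγ0 hγ1
  set ν' : ℝ := min 1 (ν / -Real.log γ) with hν'
  have hν'0 : 0 < ν' := lt_min one_pos (div_pos hν0 (by linarith))
  -- This is where `D = o(N)` enters: the path length is `O(D + 1)`, with constants independent of
  -- `N`.
  have hT : ∀ᶠ N : ℕ in atTop,
      2 * (m * (L₀ * ((D N : ℝ) + 1) / ε₀ + 1) + 1) ≤ ν' * N := by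
    have h1 : Tendsto (fun N : ℕ => (D N : ℝ) / N) atTop (𝓝 0) := hD.tendsto_div_nhds_zero
    have h2 : Tendsto (fun N : ℕ => (1 : ℝ) / N) atTop (𝓝 0) := tendsto_one_div_atTop_nhds_zero_nat
    have h3 := (h1.const_mul (2 * m * L₀ / ε₀)).add
      (h2.const_mul (2 * (m * (L₀ / ε₀ + 1) + 1)))
    rw [mul_zero, mul_zero, add_zero] at h3
    filter_upwards [h3.eventually (gt_mem_nhds hν'0), eventually_gt_atTop 0] with N hN hN0
    have hN' : (0 : ℝ) < N := by exact_mod_cast hN0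
    have h4 := mul_le_mul_of_nonneg_right hN.le hN'.le
    refine le_trans (le_of_eq ?_) h4
    field_simp
    ring
  have hM1 : ∀ᶠ N : ℕ in atTop, b - (M N : ℝ) / N * q < -(2 * ν) :=
    ((hM.mul_const q).const_sub b).eventually (gt_mem_nhds hν1)
  have hM2 : ∀ᶠ N : ℕ in atTop, Real.log 2 + m * b - (M N : ℝ) / N * u < -(2 * ν) :=
    ((hM.mul_const u).const_sub _).eventually (gt_mem_nhds hν2)
  filter_upwards [hT, hM1, hM2, eventually_gt_atTop 0, RandomKSat.eventually_poly_mul_exp_lt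
    (m + 1) ((m + 1) + 2 ^ (m + 1) * (m + 1)) hν0] with N hT hM1 hM2 hN0 hpoly
  have hN' : (0 : ℝ) < N := by exact_mod_cast hN0
  refine (RandomKSat.prob_satisfies_le hN0 hk0 (P N) (hA N) (hdeg N) (hC N) hl hL hb0 hη0 (hη N)
    hL₀ hδ0 hδ1 hε₀0 hε₀1 hε₀C (min_le_left _ _) ?_ hT ?_ ?_ hpoly).trans hδε
  · refine (mul_le_mul_of_nonneg_right (min_le_right _ _) (by linarith)).trans (le_of_eq ?_)
    exact div_mul_cancel₀ _ (by linarith)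
  · have h1 := mul_le_mul_of_nonneg_right hM1.le hN'.le
    have h2 : (b - (M N : ℝ) / N * q) * N = N * b - M N * q := by field_simp
    linarith
  · have h1 := mul_le_mul_of_nonneg_right hM2.le hN'.le
    have h2 : (Real.log 2 + m * b - (M N : ℝ) / N * u) * N =
        N * (Real.log 2 + m * b) - M N * u := by field_simp
    linarith
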